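/- **Setting.** Let $\lambda\in\mathbb C$ with $\lambda\notin\frac12-\frac12\mathbb Z_{\ge0}$, let $\ell\in\mathbb Z$, and let $N$ be a positive integer. *Test functions.* For a $C^\infty$-function $f:\mathbb R\to\mathbb C$ put $f_\infty(x)=(\operatorname{sgn}x)^{\ell/2}|x|^{-2\lambda}f(-1/x)$ for $x\neq0$, where $(\operatorname{sgn}x)^{\ell/2}=1$ for $x>0$ and $=i^{\ell}$ for $x<0$. Let $\mathcal V_{\lambda,\ell}^\infty$ be the space of $C^\infty$-functions $f$ on $\mathbb R$ such that $f_\infty$ extends to a $C^\infty$-function on $\mathbb R$, again denoted $f_\infty$; put $f(\infty)=f_\infty(0)$ (so $f_\infty(\infty)=(f_\infty)_\infty(0)=i^\ell f(0)$). *Fourier transform.* For $f\in\mathcal V_{\lambda,\ell}^\infty$ and $t\ne0$ let $$(\mathcal Ff)(t)=\Bigl(\frac{-1}{2\pi i t}\Bigr)^m\int_{\mathbb R}f^{(m)}(x)e^{2\pi i xt}\,dx,$$ where $m$ is any positive integer with $\operatorname{Re}\lambda+\frac m2>\frac12$ (the value does not depend on $m$). The local zeta functions $\Phi_\pm(f;s)$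 are the meromorphic functions on $\mathbb C$ given, for $-m<\operatorname{Re}s<2\operatorname{Re}\lambda$ (any integer $m\geq 0$), by $$\Phi_\pm(f;s)=\frac{(\mp1)^m}{s(s+1)\cdots(s+m-1)}\int_0^\infty x^{s+m-1}f^{(m)}(\pm x)\,dx ,$$ and one puts $(\mathcal Ff)(0)=\Phi_+(f;1)+\Phi_-(f;1)$. *$L$-functions.* Let $\alpha=\{\alpha(n)\}$, $\beta=\{\beta(n)\}$ $(n\in\mathbb Z\setminus\{0\})$ be complex sequences of polynomial growth, and for $\operatorname{Re}s$ large put $$\xi_\pm(\alpha;s)=\sum_{n\ge1}\frac{\alpha(\pm n)}{n^s},\qquad \xi_\pm(\beta;s)=\sum_{n\ge1}\frac{\beta(\pm n)}{n^s},$$ and $\Xi_\pm(\ast;s)=(2\pi)^{-s}\Gamma(s)\xi_\pm(\ast;s)$, $\xi_e(\ast;s)=\xi_+(\ast;s)+\xi_-(\ast;s)$, $$\gamma(s)=\begin{pmatrix}e^{\pi si/2}&e^{-\pi si/2}\\e^{-\pi si/2}&e^{\pi si/2}\end{pmatrix},\qquad \Sigma(\ell)=\begin{pmatrix}0&i^\ell\\1&0\end{pmatrix}.$$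 **Assumptions.** * **[A1]** $\xi_\pm(\alpha;s)$ and $\xi_\pm(\beta;s)$ continue meromorphically to $\mathbb C$, and $(s-1)(s-2+2\lambda)\xi_\pm(\alpha;s)$ and $(s-1)(s-2+2\lambda)\xi_\pm(\beta;s)$ are entire and of finite order in every vertical strip, i.e. for all $\sigma_1<\sigma_2$ each of them is bounded on $\sigma_1\le\operatorname{Re}s\le\sigma_2$ by $A e^{B|\operatorname{Im}s|^\rho}$ for some $A,B,\rho>0$. * **[A2]** $\operatorname{Res}_{s=1}\xi_+(\alpha;s)=\operatorname{Res}_{s=1}\xi_-(\alpha;s)$ and $\operatorname{Res}_{s=1}\xi_+(\beta;s)=\operatorname{Res}_{s=1}\xi_-(\beta;s)$. * **[A3]** As an identity of meromorphic functions, $$\gamma(s)\begin{pmatrix}\Xi_+(\alpha;s)\\\Xi_-(\alpha;s)\end{pmatrix}=N^{2-2\lambda-s}\,\Sigma(\ell)\,\gamma(2-2\lambda-s)\begin{pmatrix}\Xi_+(\beta;2-2\lambda-s)\\\Xi_-(\beta;2-2\lambda-s)\end{pmatrix}.$$ * **[A4]** If $\lambda=\frac q2$ with an integer $q\ge4$,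 then $\xi_+(\alpha;-k)+(-1)^k\xi_-(\alpha;-k)=0$ for $k=1,\dots,q-3$. If $\lambda=1$, then $\operatorname{Res}_{s=0}\xi_e(\alpha;s)=\operatorname{Res}_{s=0}\xi_e(\beta;s)=0$. If $\lambda=1$ and $\ell\equiv0\pmod4$, then $\xi_\pm(\alpha;s)$ and $\xi_\pm(\beta;s)$ are holomorphic at $s=0$. **Definition of the remaining coefficients.** With an arbitrary constant $c\in\mathbb C$ (the same in both lines, and used only if $\lambda=1$ and $\ell\equiv0\pmod4$) put $$\alpha(0)=\begin{cases}-\xi_e(\alpha;0)&(\lambda\ne1)\\-\frac12\xi_e(\alpha;0)+c&(\lambda=1,\ \ell\equiv0\ (4))\\\frac{2\pi i}{1-i^{-\ell}}\operatorname{Res}_{s=0}\xi_+(\beta;s)&(\lambda=1,\ \ell\not\equiv0\ (4)),\end{cases}$$ $$\beta(0)=\begin{cases}-\xi_e(\beta;0)&(\lambda\ne1)\\-\frac12\xi_e(\beta;0)+c&(\lambda=1,\ \ell\equiv0\ (4))\\\frac{2\pi i}{i^{\ell}-1}\operatorname{Res}_{s=0}\xi_+(\alpha;s)&(\lambda=1,\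 \ell\not\equiv0\ (4)),\end{cases}$$ $$\alpha(\infty)=\frac N2\operatorname{Res}_{s=1}\xi_e(\beta;s),\qquad \beta(\infty)=\frac{i^{-\ell}}2\operatorname{Res}_{s=1}\xi_e(\alpha;s).$$ **Theorem.** Under [A1]–[A4], for every $f\in\mathcal V_{\lambda,\ell}^\infty$ both series below converge absolutely and $$\alpha(\infty)f(\infty)+\sum_{n=-\infty}^\infty\alpha(n)(\mathcal Ff)(n)=\beta(\infty)f_\infty(\infty)+\sum_{n=-\infty}^\infty\beta(n)(\mathcal Ff_\infty)\Bigl(\frac nN\Bigr).$$ -/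

import Mathlib

open Filter Topology
open scoped ContDiff

noncomputable section

/-! ### The line model of the principal series -/

/-- `f_∞(x) = (sgn x)^{ℓ/2} |x|^{-2λ} f(-1/x)` for `x ≠ 0`, where `(sgn x)^{ℓ/2}` is `1` for `x > 0`
and `i^ℓ` for `x < 0`. -/
def inftyRaw (lam : ℂ) (ℓ : ℤ) (f : ℝ → ℂ) (x : ℝ) : ℂ :=
  (if 0 < x then 1 else Complex.I ^ ℓ) * ((|x| : ℝ) : ℂ) ^ (-2 * lam) * f (-1 / x)

/-- `f_∞` on all of `ℝ`; the value at `0` is the limit, that is, the only value that can make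
the function continuous. -/
def inftyTransform (lam : ℂ) (ℓ : ℤ) (f : ℝ → ℂ) : ℝ → ℂ :=
  Function.update (inftyRaw lam ℓ f) 0 (limUnder (𝓝[≠] (0 : ℝ)) (inftyRaw lam ℓ f))

/-- The space `V_{λ,ℓ}^∞`: smooth `f` for which `f_∞` extends to a smooth function on `ℝ`. -/
def lineModel (lam : ℂ) (ℓ : ℤ) : Set (ℝ → ℂ) :=
  {f | ContDiff ℝ ∞ f ∧ ContDiff ℝ ∞ (inftyTransform lam ℓ f)}

/-- `f(∞) = f_∞(0)`. -/
def valueAtInfty (lam : ℂ) (ℓ : ℤ) (f : ℝ → ℂ) : ℂ := inftyTransform lam ℓ f 0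

/-! ### Local zeta functions and the generalized Fourier transform -/

/-- `G` is the local zeta function `Φ_ε(f; s)` (`ε = ±1`): the meromorphic function on `ℂ` which is
given by
`(-ε)^m / (s (s+1) ⋯ (s+m-1)) * ∫_0^∞ x^{s+m-1} f^{(m)}(ε x) dx` for `-m < Re s < 2 Re λ`.
Normal form means that `G` takes its limit value at every point that is not a pole.
For `m = 0` the formula is `∫_0^∞ x^{s-1} f(ε x) dx`. -/
def IsLocalZeta (lam : ℂ) (ε : ℤˣ) (f : ℝ → ℂ) (G : ℂ → ℂ) : Prop :=
  MeromorphicNFOn G Set.univ ∧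
  ∀ (m : ℕ) (s : ℂ), -(m : ℝ) < s.re → s.re < 2 * lam.re → (∀ j : ℕ, j < m → s ≠ -(j : ℂ)) →
    G s = (-((ε : ℤ) : ℂ)) ^ m / (∏ j ∈ Finset.range m, (s + (j : ℂ))) *
      ∫ x in Set.Ioi (0 : ℝ), (x : ℂ) ^ (s + (m : ℂ) - 1) * iteratedDeriv m f (((ε : ℤ) : ℝ) * x)

open Classical in
/-- The local zeta function `Φ_ε(f; s)` of `f ∈ V_{λ,ℓ}^∞`, continued meromorphically to `ℂ`.
The continuation is unique if it exists, by the identity theorem. -/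
def localZeta (lam : ℂ) (ε : ℤˣ) (f : ℝ → ℂ) : ℂ → ℂ :=
  if h : ∃ G, IsLocalZeta lam ε f G then h.choose else 0

/-- The order of differentiation used for the Fourier transform; it is positive and
`Re λ + m / 2 > 1 / 2`. -/
def fourierOrder (lam : ℂ) : ℕ := ⌈1 - 2 * lam.re⌉₊ + 1

/-- The generalized Fourier transform `𝓕 f` of `f ∈ V_{λ,ℓ}^∞`: for `t ≠ 0` it is
`(-1 / (2 π i t))^m ∫ f^{(m)}(x) e^{2 π i x t} dx`, and the regularized value at `t = 0` is
`Φ_+(f; 1) + Φ_-(f; 1)`. -/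
def genFourier (lam : ℂ) (f : ℝ → ℂ) (t : ℝ) : ℂ :=
  if t = 0 then localZeta lam 1 f 1 + localZeta lam (-1) f 1
  else (-1 / (2 * (Real.pi : ℂ) * Complex.I * (t : ℂ))) ^ fourierOrder lam *
    ∫ x : ℝ, iteratedDeriv (fourierOrder lam) f x *
      Complex.exp (2 * (Real.pi : ℂ) * Complex.I * (x : ℂ) * (t : ℂ))

/-! ### `L`-functions -/

/-- A two-sided sequence, considered on the nonzero integers, has polynomial growth. -/
def PolynomialGrowth (α : ℤ → ℂ) : Prop :=
  ∃ (C : ℝ) (k : ℕ), ∀ n : ℤ, n ≠ 0 → ‖α n‖ ≤ C * (1 + |(n : ℝ)|) ^ k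

/-- `ξ` is the meromorphic continuation to `ℂ` of `∑_{n ≥ 1} α(ε n) n^{-s}` (`ε = ±1`), with its
limit value at every point that is not a pole. -/
def IsLContinuation (α : ℤ → ℂ) (ε : ℤˣ) (ξ : ℂ → ℂ) : Prop :=
  MeromorphicNFOn ξ Set.univ ∧
  ∃ σ : ℝ, ∀ s : ℂ, σ < s.re → ξ s = LSeries (fun n : ℕ => α ((ε : ℤ) * (n : ℤ))) s

/-- `f` is of finite order on every vertical strip. -/
def FiniteOrderOnStrips (f : ℂ → ℂ) : Prop :=
  ∀ σ₁ σ₂ : ℝ, σ₁ < σ₂ → ∃ A B ρ : ℝ, 0 < A ∧ 0 < B ∧ 0 < ρ ∧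
    ∀ s : ℂ, σ₁ ≤ s.re → s.re ≤ σ₂ → ‖f s‖ < A * Real.exp (B * |s.im| ^ ρ)

/-- The residue of `F` at `s₀`, where `F` has at most a simple pole. -/
def simpleResidue (F : ℂ → ℂ) (s₀ : ℂ) : ℂ :=
  limUnder (𝓝[≠] s₀) (fun s => (s - s₀) * F s)

/-- `(s-1)(s-2+2λ) ξ(s)` is an entire function of finite order in vertical strips. -/
def EntireOfFiniteOrder (lam : ℂ) (ξ : ℂ → ℂ) : Prop :=
  ∃ E : ℂ → ℂ, Differentiable ℂ E ∧
    (∀ s : ℂ, s ≠ 1 → s ≠ 2 - 2 * lam → E s = (s - 1) * (s - 2 + 2 * lam) * ξ s) ∧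
    FiniteOrderOnStrips E

/-- `Ξ_±(s) = (2π)^{-s} Γ(s) ξ_±(s)`, as a column vector. -/
def completedL (ξ : ℤˣ → ℂ → ℂ) (s : ℂ) : Fin 2 → ℂ :=
  ![(2 * (Real.pi : ℂ)) ^ (-s) * Complex.Gamma s * ξ 1 s,
    (2 * (Real.pi : ℂ)) ^ (-s) * Complex.Gamma s * ξ (-1) s]

def gammaMatrix (s : ℂ) : Matrix (Fin 2) (Fin 2) ℂ :=
  !![Complex.exp (Real.pi * s * Complex.I / 2), Complex.exp (-(Real.pi * s * Complex.I / 2));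
     Complex.exp (-(Real.pi * s * Complex.I / 2)), Complex.exp (Real.pi * s * Complex.I / 2)]

def sigmaMatrix (ℓ : ℤ) : Matrix (Fin 2) (Fin 2) ℂ :=
  !![0, Complex.I ^ ℓ; 1, 0]

/-- `ξ_e = ξ_+ + ξ_-`. -/
def evenPart (ξ : ℤˣ → ℂ → ℂ) (s : ℂ) : ℂ := ξ 1 s + ξ (-1) s

/-- [A1] Meromorphic continuation, location of the poles, growth. -/
def ConditionA1 (lam : ℂ) (α β : ℤ → ℂ) (ξα ξβ : ℤˣ → ℂ → ℂ) : Prop :=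
  ∀ ε : ℤˣ, IsLContinuation α ε (ξα ε) ∧ IsLContinuation β ε (ξβ ε) ∧
    EntireOfFiniteOrder lam (ξα ε) ∧ EntireOfFiniteOrder lam (ξβ ε)

/-- [A2] Symmetry of the residues at `s = 1`. -/
def ConditionA2 (ξα ξβ : ℤˣ → ℂ → ℂ) : Prop :=
  simpleResidue (ξα 1) 1 = simpleResidue (ξα (-1)) 1 ∧
  simpleResidue (ξβ 1) 1 = simpleResidue (ξβ (-1)) 1

/-- [A3] The functional equation, as an identity of meromorphic functions, that is, outside a
discrete closed set. -/
def ConditionA3 (lam : ℂ) (ℓ : ℤ) (N : ℕ) (ξα ξβ : ℤˣ → ℂ → ℂ) : Prop :=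
  ∀ᶠ s in codiscrete ℂ,
    (gammaMatrix s).mulVec (completedL ξα s) =
      ((N : ℂ) ^ (2 - 2 * lam - s)) •
        (sigmaMatrix ℓ * gammaMatrix (2 - 2 * lam - s)).mulVec (completedL ξβ (2 - 2 * lam - s))

/-- [A4] Vanishing conditions. -/
def ConditionA4 (lam : ℂ) (ℓ : ℤ) (ξα ξβ : ℤˣ → ℂ → ℂ) : Prop :=
  (∀ q : ℕ, 4 ≤ q → lam = (q : ℂ) / 2 → ∀ k : ℕ, 1 ≤ k → k + 3 ≤ q →
    ξα 1 (-(k : ℂ)) + (-1) ^ k * ξα (-1) (-(k : ℂ)) = 0) ∧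
  (lam = 1 → simpleResidue (evenPart ξα) (2 - 2 * lam) = 0 ∧
    simpleResidue (evenPart ξβ) (2 - 2 * lam) = 0) ∧
  (lam = 1 → ℓ ≡ 0 [ZMOD 4] → ∀ ε : ℤˣ,
    AnalyticAt ℂ (ξα ε) (2 - 2 * lam) ∧ AnalyticAt ℂ (ξβ ε) (2 - 2 * lam))

open Classical in
/-- `α(0)`; `c` is an arbitrary constant, used only for `λ = 1`, `4 ∣ ℓ`. -/
def alphaZero (lam : ℂ) (ℓ : ℤ) (c : ℂ) (ξα ξβ : ℤˣ → ℂ → ℂ) : ℂ :=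
  if lam ≠ 1 then -evenPart ξα 0
  else if ℓ ≡ 0 [ZMOD 4] then -(1 / 2) * evenPart ξα 0 + c
  else 2 * (Real.pi : ℂ) * Complex.I / (1 - Complex.I ^ (-ℓ)) * simpleResidue (ξβ 1) 0

open Classical in
/-- `β(0)`; `c` is the same constant as in `α(0)`. -/
def betaZero (lam : ℂ) (ℓ : ℤ) (c : ℂ) (ξα ξβ : ℤˣ → ℂ → ℂ) : ℂ :=
  if lam ≠ 1 then -evenPart ξβ 0
  else if ℓ ≡ 0 [ZMOD 4] then -(1 / 2) * evenPart ξβ 0 + c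
  else 2 * (Real.pi : ℂ) * Complex.I / (Complex.I ^ ℓ - 1) * simpleResidue (ξα 1) 0

/-- `α(∞)`. -/
def alphaInfty (N : ℕ) (ξβ : ℤˣ → ℂ → ℂ) : ℂ :=
  (N : ℂ) / 2 * simpleResidue (evenPart ξβ) 1

/-- `β(∞)`. -/
def betaInfty (ℓ : ℤ) (ξα : ℤˣ → ℂ → ℂ) : ℂ :=
  Complex.I ^ (-ℓ) / 2 * simpleResidue (evenPart ξα) 1

end

/-! Write κ = 2 - 2λ. Up to the terms at n = 0, each of the two series is an integral over one
vertical line Re s = b, and the summation formula is a shift of contour from Re s = b to Re s = Re κ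
- b.

Local side. The Mellin transform of t ↦ 𝓕f(εt), ε = ±1, is `mellinPhi`, a combination of Φ_+(f; 1-s)
and Φ_-(f; 1-s). For a rapidly enough decaying function this is Fubini after a factor e^{-δt} has
been inserted (`SymbolDecay.mellin_fourierInt`); applied to a high derivative of f it gives
`mellin_genFourier`. Two applications of the Euler operator x d/dx yield decay of order (1 + |Im
s|)^{-2} on the line, so Mellin inversion holds and may be summed against the coefficients
(`hasSum_int_genFourier`); the integrand that results is `pairing`. The continuation `localPhi` of
Φ_± splits the Mellin integral at x = 1 and inverts the outer piece. Passing from f to f_∞ then only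
exchanges the two pieces, so that Φ_±(f_∞; s) equals Φ_∓(f; 2λ-s) up to a power of i.

Global side. Since γ(s) is symmetric it can be moved from the Φ to the ξ (`pairing_eq`). Then [A3]
and the symmetry of Φ combine into H(s) = N^{κ-s} G(κ-s), where H is the integrand for (α, f) and G
the one for (β, f_∞) (`ConditionA3.eventually_pairing`). The integral of H over the left line is
therefore the integral that represents the β-series.

Contour shift. Decay is available on the two edges only; inside the strip there is just finite
order. After subtraction of the polar parts, Phragmén-Lindelöf transports the edge bound to the
interior (`vertical_integral_sub_eq_sum_residues`).

Residues. At s = 1 the poles of ξ_± cancel in γ(s)Ξ by [A2], and the pole of Φ_±(f; 1-s) leaves f(0)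
Res ξ. At s = 0 the pole of Γ leaves 𝓕f(0) ξ_e(0), if λ ≠ 1. The points κ - 1 and κ carry the mirror
images for (β, f_∞). Every other candidate is harmless (`hasResAt_pairing_of_ne`): at 1 + k the rows
of γ are proportional and the two contributions cancel; at -k either the mirror side is regular, or
λ = q/2 with q ≥ 4 and [A4] applies. If λ = 1, the points 0 and κ coincide; [A4] keeps the pole
there simple, and α(0), β(0) are chosen so as to absorb its residue (`zero_terms_of_eq_one`). -/

/-! ### Removable values and residues -/

/-- `F` agrees near `s₀` (away from `s₀`) with a function analytic at `s₀` of value `v` there. -/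
def RegAt (F : ℂ → ℂ) (s₀ v : ℂ) : Prop :=
  ∃ g : ℂ → ℂ, AnalyticAt ℂ g s₀ ∧ g s₀ = v ∧ F =ᶠ[𝓝[≠] s₀] g

/-- `F` has at most a simple pole at `s₀`, with residue `r`. -/
def HasResAt (F : ℂ → ℂ) (s₀ r : ℂ) : Prop := RegAt (fun s => (s - s₀) * F s) s₀ r

theorem AnalyticAt.regAt {F : ℂ → ℂ} {s₀ : ℂ} (h : AnalyticAt ℂ F s₀) : RegAt F s₀ (F s₀) :=
  ⟨F, h, rfl, EventuallyEq.rfl⟩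

theorem AnalyticAt.regAt' {F : ℂ → ℂ} {s₀ v : ℂ} (h : AnalyticAt ℂ F s₀) (hv : F s₀ = v) :
    RegAt F s₀ v := ⟨F, h, hv, EventuallyEq.rfl⟩

namespace RegAt

variable {F G : ℂ → ℂ} {s₀ v w : ℂ}

theorem congr (h : RegAt F s₀ v) (hFG : G =ᶠ[𝓝[≠] s₀] F) : RegAt G s₀ v := by
  obtain ⟨g, hg, hv, he⟩ := h
  exact ⟨g, hg, hv, hFG.trans he⟩

theorem add (h : RegAt F s₀ v) (h' : RegAt G s₀ w) : RegAt (fun s => F s + G s) s₀ (v + w) := by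
  obtain ⟨g, hg, rfl, he⟩ := h
  obtain ⟨k, hk, rfl, he'⟩ := h'
  exact ⟨fun s => g s + k s, hg.add hk, rfl, he.add he'⟩

theorem mul (h : RegAt F s₀ v) (h' : RegAt G s₀ w) : RegAt (fun s => F s * G s) s₀ (v * w) := by
  obtain ⟨g, hg, rfl, he⟩ := h
  obtain ⟨k, hk, rfl, he'⟩ := h'
  exact ⟨fun s => g s * k s, hg.mul hk, rfl, he.mul he'⟩

theorem const (c s₀ : ℂ) : RegAt (fun _ => c) s₀ c := analyticAt_const.regAt

theorem const_mul (c : ℂ) (h : RegAt F s₀ v) : RegAt (fun s => c * F s) s₀ (c * v) :=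
  (const c s₀).mul h

theorem tendsto (h : RegAt F s₀ v) : Tendsto F (𝓝[≠] s₀) (𝓝 v) := by
  obtain ⟨g, hg, rfl, he⟩ := h
  exact (tendsto_congr' he).2 (hg.continuousAt.tendsto.mono_left nhdsWithin_le_nhds)

theorem unique (h : RegAt F s₀ v) (h' : RegAt F s₀ w) : v = w :=
  tendsto_nhds_unique h.tendsto h'.tendsto

theorem value_eq (h : RegAt F s₀ v) (hv : v = w) : RegAt F s₀ w := hv ▸ h

theorem meromorphicAt (h : RegAt F s₀ v) : MeromorphicAt F s₀ := by
  obtain ⟨g, hg, -, he⟩ := h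
  exact hg.meromorphicAt.congr he.symm

theorem comp_sub {a : ℂ} (h : RegAt F (a - s₀) v) : RegAt (fun s => F (a - s)) s₀ v := by
  obtain ⟨g, hg, rfl, he⟩ := h
  have hc : AnalyticAt ℂ (fun s : ℂ => a - s) s₀ := by fun_prop
  refine ⟨fun s => g (a - s), hg.fun_comp hc, rfl, ?_⟩
  have ht : Tendsto (fun s : ℂ => a - s) (𝓝[≠] s₀) (𝓝[≠] (a - s₀)) := by
    refine tendsto_nhdsWithin_iff.2 ⟨hc.continuousAt.tendsto.mono_left nhdsWithin_le_nhds, ?_⟩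
    filter_upwards [self_mem_nhdsWithin] with s hs
    simpa using hs
  exact ht.eventually he

/-- Division by `s - s₀` when the value is zero. -/
theorem exists_of_value_zero (h : HasResAt F s₀ 0) : ∃ v, RegAt F s₀ v := by
  obtain ⟨g, ⟨p, hp⟩, h0, he⟩ := h
  refine ⟨_, dslope g s₀, ⟨_, hp.has_fpower_series_dslope_fslope⟩, rfl, ?_⟩
  filter_upwards [he, self_mem_nhdsWithin] with s hs hne
  have hne' : s - s₀ ≠ 0 := sub_ne_zero.2 hne
  rw [dslope_of_ne _ hne, slope_def_field, h0, sub_zero, eq_div_iff hne', ← hs, mul_comm]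

theorem hasResAt (h : RegAt F s₀ v) : HasResAt F s₀ 0 := by
  have : AnalyticAt ℂ (fun s : ℂ => s - s₀) s₀ := by fun_prop
  exact (this.regAt.mul h).value_eq (by simp)

end RegAt

namespace HasResAt

variable {F G : ℂ → ℂ} {s₀ r v w : ℂ}

theorem congr (h : HasResAt F s₀ r) (hFG : G =ᶠ[𝓝[≠] s₀] F) : HasResAt G s₀ r :=
  RegAt.congr h (hFG.mono fun s hs => by simp only [hs])

theorem value_eq (h : HasResAt F s₀ v) (hv : v = w) : HasResAt F s₀ w := hv ▸ h

theorem unique (h : HasResAt F s₀ v) (h' : HasResAt F s₀ w) : v = w := RegAt.unique h h'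

theorem add (h : HasResAt F s₀ v) (h' : HasResAt G s₀ w) :
    HasResAt (fun s => F s + G s) s₀ (v + w) :=
  (RegAt.add h h').congr (Eventually.of_forall fun s => by ring)

theorem mul_regAt (h : HasResAt F s₀ v) (h' : RegAt G s₀ w) :
    HasResAt (fun s => F s * G s) s₀ (v * w) :=
  (RegAt.mul h h').congr (Eventually.of_forall fun s => by ring)

theorem regAt_mul (h : RegAt F s₀ v) (h' : HasResAt G s₀ w) :
    HasResAt (fun s => F s * G s) s₀ (v * w) :=
  (RegAt.mul h h').congr (Eventually.of_forall fun s => by ring)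

theorem const_mul (c : ℂ) (h : HasResAt F s₀ v) : HasResAt (fun s => c * F s) s₀ (c * v) :=
  regAt_mul (RegAt.const c s₀) h

theorem comp_sub {a : ℂ} (h : HasResAt F (a - s₀) r) : HasResAt (fun s => F (a - s)) s₀ (-r) :=
  ((RegAt.comp_sub h).const_mul (-1)).congr (Eventually.of_forall fun s => by ring)
    |>.value_eq (by ring)

theorem meromorphicAt (h : HasResAt F s₀ r) : MeromorphicAt F s₀ := by
  have h1 : MeromorphicAt (fun s : ℂ => (s - s₀)⁻¹) s₀ :=
    (show AnalyticAt ℂ (fun s : ℂ => s - s₀) s₀ by fun_prop).meromorphicAt.inv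
  refine (h1.mul (RegAt.meromorphicAt h)).congr ?_
  filter_upwards [self_mem_nhdsWithin] with s hs
  have : s - s₀ ≠ 0 := sub_ne_zero.2 hs
  simp [this]

theorem simpleResidue_eq (h : HasResAt F s₀ r) : simpleResidue F s₀ = r := h.tendsto.limUnder_eq

end HasResAt

theorem hasResAt_inv_sub (p r : ℂ) : HasResAt (fun s => r / (s - p)) p r := by
  refine (RegAt.const r p).congr ?_
  filter_upwards [self_mem_nhdsWithin] with s hs
  have : s - p ≠ 0 := sub_ne_zero.2 hs
  field_simp

/-- A function all of whose singularities are removable agrees with an entire function. -/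
theorem exists_entire_of_regAt {F : ℂ → ℂ} (h : ∀ s, ∃ v, RegAt F s v) :
    ∃ E : ℂ → ℂ, Differentiable ℂ E ∧ (∀ s, RegAt F s (E s)) ∧
      ∀ s, AnalyticAt ℂ F s → E s = F s := by
  choose E hE using h
  refine ⟨E, fun s₀ => ?_, hE, fun s hs => (hE s).unique hs.regAt⟩
  obtain ⟨g, hg, h0, he⟩ := hE s₀
  have h1 := hg.eventually_analyticAt
  have h2 := eventually_nhdsWithin_iff.1 (eventually_eventually_nhdsWithin.2 he)
  -- `E` is the function of all removable values. At a point near `s₀` the germ `g` is still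
  -- analytic and agrees with `F` around it, so by uniqueness of the limit it supplies the value of
  -- `E` there.
  have : E =ᶠ[𝓝 s₀] g := by
    filter_upwards [h1, h2] with s hs hs'
    by_cases hne : s = s₀
    · rw [hne, h0]
    · refine (hE s).unique ⟨g, hs, rfl, ?_⟩
      have h3 := hs' hne
      rw [nhdsWithin_eq_nhds.2 (IsOpen.mem_nhds isOpen_compl_singleton hne)] at h3
      exact h3.filter_mono nhdsWithin_le_nhds
  exact (hg.congr this.symm).differentiableAt

/-! ### Growth in vertical strips -/

/-- The filter `|Im z| → ∞` in the closed strip `a ≤ Re z ≤ b`. -/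
def stripFilter (a b : ℝ) : Filter ℂ :=
  comap (fun z : ℂ => |z.im|) atTop ⊓ 𝓟 (Complex.re ⁻¹' Set.Icc a b)

/-- Growth slow enough for the Phragmen-Lindelöf principle in the strip, of any width. -/
def MildGrowth (a b : ℝ) (F : ℂ → ℂ) : Prop :=
  ∀ c : ℝ, 0 < c → ∃ B : ℝ, F =O[stripFilter a b] fun z => Real.exp (B * Real.exp (c * |z.im|))

theorem eventually_stripFilter {a b T : ℝ} {P : ℂ → Prop}
    (h : ∀ z : ℂ, a ≤ z.re → z.re ≤ b → T ≤ |z.im| → P z) : ∀ᶠ z in stripFilter a b, P z := by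
  have h1 : ∀ᶠ z : ℂ in comap (fun z : ℂ => |z.im|) atTop, T ≤ |z.im| :=
    tendsto_comap.eventually (eventually_ge_atTop T)
  filter_upwards [mem_inf_of_left h1, mem_inf_of_right (mem_principal_self _)] with z hz hz'
  exact h z hz'.1 hz'.2 hz

namespace MildGrowth

variable {a b : ℝ} {F G : ℂ → ℂ}

theorem mul (hF : MildGrowth a b F) (hG : MildGrowth a b G) :
    MildGrowth a b (fun z => F z * G z) := by
  intro c hc
  obtain ⟨B, hB⟩ := hF c hc
  obtain ⟨B', hB'⟩ := hG c hc
  refine ⟨B + B', (hB.mul hB').congr_right fun z => ?_⟩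
  rw [← Real.exp_add, add_mul]

theorem add (hF : MildGrowth a b F) (hG : MildGrowth a b G) :
    MildGrowth a b (fun z => F z + G z) := by
  intro c hc
  obtain ⟨B, hB⟩ := hF c hc
  obtain ⟨B', hB'⟩ := hG c hc
  have key : ∀ u v : ℝ, u ≤ v → (fun z : ℂ => Real.exp (u * Real.exp (c * |z.im|)))
      =O[stripFilter a b] fun z => Real.exp (v * Real.exp (c * |z.im|)) := fun u v huv =>
    Asymptotics.IsBigO.of_bound 1 (Eventually.of_forall fun z => by
      rw [one_mul, Real.norm_of_nonneg (by positivity), Real.norm_of_nonneg (by positivity)]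
      gcongr)
  exact ⟨max B B', (hB.trans (key _ _ (le_max_left _ _))).add
    (hB'.trans (key _ _ (le_max_right _ _)))⟩

theorem of_bounded {C T : ℝ} (h : ∀ z : ℂ, a ≤ z.re → z.re ≤ b → T ≤ |z.im| → ‖F z‖ ≤ C) :
    MildGrowth a b F := fun c _ => ⟨0, Asymptotics.IsBigO.of_bound C (by
      refine eventually_stripFilter (T := T) fun z h1 h2 h3 => ?_
      simpa using h z h1 h2 h3)⟩

/-- Every power t^ρ is eventually below e^{ct}, whatever ρ and c > 0. Hence finite order of any
order is admissible in strips of any width. -/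
theorem of_exp_rpow {A B ρ T : ℝ} (hB : 0 ≤ B) (h : ∀ z : ℂ, a ≤ z.re → z.re ≤ b → T ≤ |z.im| →
    ‖F z‖ ≤ A * Real.exp (B * |z.im| ^ ρ)) : MildGrowth a b F := by
  intro c hc
  refine ⟨B, ?_⟩
  have h1 : ∀ᶠ t : ℝ in atTop, t ^ ρ ≤ Real.exp (c * t) := by
    have := (isLittleO_rpow_exp_pos_mul_atTop ρ hc).bound (zero_lt_one)
    filter_upwards [this] with t ht
    rw [one_mul, Real.norm_of_nonneg (Real.exp_pos _).le] at ht
    exact (le_abs_self _).trans ht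
  obtain ⟨T', hT'⟩ := eventually_atTop.1 h1
  refine Asymptotics.IsBigO.of_bound |A| (eventually_stripFilter (T := max T T')
    fun z h2 h3 h4 => ?_)
  rw [Real.norm_of_nonneg (Real.exp_pos _).le]
  calc ‖F z‖ ≤ A * Real.exp (B * |z.im| ^ ρ) := h z h2 h3 ((le_max_left _ _).trans h4)
    _ ≤ |A| * Real.exp (B * |z.im| ^ ρ) := by gcongr; exact le_abs_self A
    _ ≤ _ := by gcongr; exact hT' _ ((le_max_right _ _).trans h4)

theorem const (w : ℂ) : MildGrowth a b (fun _ => w) :=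
  of_bounded (C := ‖w‖) (T := 0) fun _ _ _ _ => le_rfl

theorem congr {T : ℝ} (hF : MildGrowth a b F)
    (h : ∀ z : ℂ, a ≤ z.re → z.re ≤ b → T ≤ |z.im| → G z = F z) : MildGrowth a b G := fun c hc => by
  obtain ⟨B, hB⟩ := hF c hc
  exact ⟨B, hB.congr' (eventually_stripFilter fun z h1 h2 h3 => (h z h1 h2 h3).symm)
    EventuallyEq.rfl⟩

theorem id : MildGrowth a b (fun z => z) := by
  refine of_exp_rpow (A := |a| + |b| + 1) (B := 1) (ρ := 1) (T := 0) zero_le_one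
    fun z h1 h2 _ => ?_
  have h3 : |z.re| ≤ |a| + |b| := by
    rw [abs_le]; constructor
    · linarith [neg_abs_le a, abs_nonneg b]
    · linarith [le_abs_self b, abs_nonneg a]
  have h4 := Complex.norm_le_abs_re_add_abs_im z
  have h5 := Real.add_one_le_exp |z.im|
  have h6 : 1 ≤ Real.exp |z.im| := Real.one_le_exp (abs_nonneg _)
  simp only [Real.rpow_one, one_mul]
  nlinarith [abs_nonneg a, abs_nonneg b]

end MildGrowth

/-! ### Integrals over vertical lines -/

theorem integrable_inv_one_add_abs_sq : MeasureTheory.Integrable fun t : ℝ => ((1 + |t|) ^ 2)⁻¹ := by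
  refine integrable_inv_one_add_sq.mono' (by fun_prop) (Eventually.of_forall fun t => ?_)
  rw [Real.norm_of_nonneg (by positivity)]
  gcongr
  nlinarith [abs_nonneg t, sq_abs t]

theorem integrable_of_le_inv_sq {F : ℝ → ℂ} (hF : Continuous F) {C : ℝ}
    (h : ∀ t, ‖F t‖ ≤ C / (1 + |t|) ^ 2) : MeasureTheory.Integrable F :=
  (integrable_inv_one_add_abs_sq.const_mul C).mono' hF.aestronglyMeasurable
    (Eventually.of_forall fun t => by simpa [div_eq_mul_inv] using h t)

theorem exists_one_add_abs_le {σ : ℝ} {p : ℂ} (h : p.re ≠ σ) :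
    ∃ C : ℝ, 0 < C ∧ ∀ t : ℝ, 1 + |t| ≤ C * ‖(σ : ℂ) + t * Complex.I - p‖ := by
  have hd : 0 < |σ - p.re| := abs_pos.2 (sub_ne_zero.2 (Ne.symm h))
  refine ⟨(1 + |p.im|) / |σ - p.re| + 1, by positivity, fun t => ?_⟩
  set z : ℂ := (σ : ℂ) + t * Complex.I - p with hz
  have h1 : |σ - p.re| ≤ ‖z‖ := by simpa [hz] using Complex.abs_re_le_norm z
  have h2 : |t - p.im| ≤ ‖z‖ := by simpa [hz] using Complex.abs_im_le_norm z
  have h3 : |t| ≤ |t - p.im| + |p.im| := by simpa using abs_add_le (t - p.im) p.im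
  have h4 : 1 + |p.im| ≤ (1 + |p.im|) / |σ - p.re| * ‖z‖ := by
    rw [div_mul_eq_mul_div, le_div_iff₀ hd]; gcongr
  linarith

theorem exists_bound_inv_sub {σ : ℝ} {p : ℂ} (h : p.re ≠ σ) :
    ∃ C : ℝ, 0 < C ∧ ∀ t : ℝ, ‖1 / ((σ : ℂ) + t * Complex.I - p)‖ ≤ C / (1 + |t|) := by
  obtain ⟨C, hC, hb⟩ := exists_one_add_abs_le h
  refine ⟨C, hC, fun t => ?_⟩
  have h1 := hb t
  have h2 : 0 < ‖(σ : ℂ) + t * Complex.I - p‖ := by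
    by_contra h3
    have : ‖(σ : ℂ) + t * Complex.I - p‖ = 0 := le_antisymm (not_lt.1 h3) (norm_nonneg _)
    rw [this] at h1
    linarith [abs_nonneg t]
  rw [norm_div, norm_one, div_le_div_iff₀ h2 (by positivity)]
  linarith

theorem line_sub_ne_zero {σ : ℝ} {p : ℂ} (h : p.re ≠ σ) (t : ℝ) :
    (σ : ℂ) + t * Complex.I - p ≠ 0 := fun h0 => h (by
  have := congrArg Complex.re h0
  simp at this
  linarith)

theorem continuous_inv_line {σ : ℝ} {p : ℂ} (h : p.re ≠ σ) :
    Continuous fun t : ℝ => 1 / ((σ : ℂ) + t * Complex.I - p) :=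
  Continuous.div (by fun_prop) (by fun_prop) (line_sub_ne_zero h)

theorem integrable_kernel {σ : ℝ} {p q : ℂ} (hp : p.re ≠ σ) (hq : q.re ≠ σ) :
    MeasureTheory.Integrable fun t : ℝ =>
      1 / ((σ : ℂ) + t * Complex.I - p) - 1 / ((σ : ℂ) + t * Complex.I - q) := by
  obtain ⟨C, hC, hb⟩ := exists_bound_inv_sub hp
  obtain ⟨D, hD, hb'⟩ := exists_bound_inv_sub hq
  refine integrable_of_le_inv_sq (C := ‖p - q‖ * (C * D))
    ((continuous_inv_line hp).sub (continuous_inv_line hq)) fun t => ?_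
  have h1 := line_sub_ne_zero hp t
  have h2 := line_sub_ne_zero hq t
  have : 1 / ((σ : ℂ) + t * Complex.I - p) - 1 / ((σ : ℂ) + t * Complex.I - q) =
      (p - q) * (1 / ((σ : ℂ) + t * Complex.I - p) * (1 / ((σ : ℂ) + t * Complex.I - q))) := by
    field_simp; ring
  rw [this, norm_mul, norm_mul]
  calc _ ≤ ‖p - q‖ * (C / (1 + |t|) * (D / (1 + |t|))) := by gcongr; exacts [hb t, hb' t]
    _ = _ := by field_simp

/-- With both poles on the left, the kernel is the Mellin transform of t^{-p} - t^{-q} cut off to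
(0, 1], and the integral is 2π times its value 0 at t = 1. A single 1/(s - p) would not be
integrable on the line; in the difference the jumps at t = 1 cancel as well, so that inversion
applies there. -/
theorem integral_kernel_right {σ : ℝ} {p q : ℂ} (hp : p.re < σ) (hq : q.re < σ) :
    ∫ t : ℝ, (1 / ((σ : ℂ) + t * Complex.I - p) - 1 / ((σ : ℂ) + t * Complex.I - q)) = 0 := by
  have hm : ∀ s : ℂ, s.re = σ → HasMellin (fun t : ℝ =>
      (Set.Ioc (0 : ℝ) 1).indicator (fun t : ℝ => (t : ℂ) ^ (-p)) t -
      (Set.Ioc (0 : ℝ) 1).indicator (fun t : ℝ => (t : ℂ) ^ (-q)) t) s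
      (1 / (s - p) - 1 / (s - q)) := fun s hs => by
    have h1 := hasMellin_cpow_Ioc (-p) (s := s) (by simp; linarith)
    have h2 := hasMellin_cpow_Ioc (-q) (s := s) (by simp; linarith)
    have := hasMellin_sub h1.1 h2.1
    rwa [h1.2, h2.2, ← sub_eq_add_neg, ← sub_eq_add_neg] at this
  have hline : ∀ y : ℝ, ((σ : ℂ) + y * Complex.I).re = σ := fun y => by simp
  have hv : ∀ y : ℝ, mellin _ ((σ : ℂ) + y * Complex.I) = _ := fun y => (hm _ (hline y)).2
  have := mellinInv_mellin_eq σ (fun t : ℝ =>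
      (Set.Ioc (0 : ℝ) 1).indicator (fun t : ℝ => (t : ℂ) ^ (-p)) t -
      (Set.Ioc (0 : ℝ) 1).indicator (fun t : ℝ => (t : ℂ) ^ (-q)) t) (x := 1) one_pos
      (hm _ (by simp)).1 ?_ ?_
  · rw [mellinInv] at this
    simp only [hv] at this
    simpa [Real.pi_ne_zero] using this
  · rw [Complex.VerticalIntegrable]
    simp only [hv]
    exact integrable_kernel hp.ne hq.ne
  · have hc : ContinuousAt (fun t : ℝ => (t : ℂ) ^ (-p) - (t : ℂ) ^ (-q)) 1 :=
      (Complex.continuousAt_ofReal_cpow_const _ _ (Or.inr one_ne_zero)).sub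
        (Complex.continuousAt_ofReal_cpow_const _ _ (Or.inr one_ne_zero))
    have hpos : ∀ᶠ t : ℝ in 𝓝 1, 0 < t := eventually_gt_nhds one_pos
    rw [Metric.continuousAt_iff'] at hc ⊢
    intro ε hε
    filter_upwards [hc ε hε, hpos] with t ht h0
    by_cases h1 : t ≤ 1
    · simpa [Set.indicator, h0, h1] using ht
    · simpa [Set.indicator, h0, h1] using hε

/-- The pole `p` now lies to the right of the line, so its power belongs on (1, ∞). The function `ψ`
glued from t^{-q} and t^{-p} is continuous at t = 1 with value 1, and its transform is minus the
kernel. -/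
theorem integral_kernel_left {σ : ℝ} {p q : ℂ} (hp : σ < p.re) (hq : q.re < σ) :
    ∫ t : ℝ, (1 / ((σ : ℂ) + t * Complex.I - p) - 1 / ((σ : ℂ) + t * Complex.I - q)) =
      -(2 * Real.pi) := by
  set ψ : ℝ → ℂ := fun t => if t ≤ 1 then (t : ℂ) ^ (-q) else (t : ℂ) ^ (-p) with hψ
  have hm : ∀ s : ℂ, s.re = σ → HasMellin ψ s (1 / (s - q) - 1 / (s - p)) := fun s hs => by
    have e1 : Set.EqOn (fun t : ℝ => (t : ℂ) ^ (s - 1) • ψ t) (fun t : ℝ => (t : ℂ) ^ (s - 1 - q))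
        (Set.Ioc 0 1) := fun t ht => by
      have : (t : ℂ) ≠ 0 := by exact_mod_cast ht.1.ne'
      simp only [hψ, ht.2, if_true, smul_eq_mul]
      rw [← Complex.cpow_add _ _ this, sub_eq_add_neg (s - 1)]
    have e2 : Set.EqOn (fun t : ℝ => (t : ℂ) ^ (s - 1) • ψ t) (fun t : ℝ => (t : ℂ) ^ (s - 1 - p))
        (Set.Ioi 1) := fun t ht => by
      have : (t : ℂ) ≠ 0 := by exact_mod_cast (one_pos.trans ht).ne'
      simp only [hψ, not_le.2 (Set.mem_Ioi.1 ht), if_false, smul_eq_mul]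
      rw [← Complex.cpow_add _ _ this, sub_eq_add_neg (s - 1)]
    have r1 : -1 < (s - 1 - q).re := by simp; linarith
    have r2 : (s - 1 - p).re < -1 := by simp; linarith
    have i1 : MeasureTheory.IntegrableOn (fun t : ℝ => (t : ℂ) ^ (s - 1) • ψ t) (Set.Ioc 0 1) := by
      rw [MeasureTheory.integrableOn_congr_fun e1 measurableSet_Ioc,
        ← intervalIntegrable_iff_integrableOn_Ioc_of_le zero_le_one]
      exact intervalIntegral.intervalIntegrable_cpow' r1
    have i2 : MeasureTheory.IntegrableOn (fun t : ℝ => (t : ℂ) ^ (s - 1) • ψ t) (Set.Ioi 1) := by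
      rw [MeasureTheory.integrableOn_congr_fun e2 measurableSet_Ioi]
      exact integrableOn_Ioi_cpow_of_lt r2 one_pos
    refine ⟨?_, ?_⟩
    · rw [MellinConvergent, ← Set.Ioc_union_Ioi_eq_Ioi zero_le_one]
      exact i1.union i2
    · rw [mellin, ← Set.Ioc_union_Ioi_eq_Ioi zero_le_one, MeasureTheory.setIntegral_union
        (Set.Ioc_disjoint_Ioi le_rfl) measurableSet_Ioi i1 i2,
        MeasureTheory.setIntegral_congr_fun measurableSet_Ioc e1,
        MeasureTheory.setIntegral_congr_fun measurableSet_Ioi e2,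
        ← intervalIntegral.integral_of_le zero_le_one, integral_cpow (Or.inl r1),
        integral_Ioi_cpow_of_lt r2 one_pos]
      have : s - 1 - q + 1 ≠ 0 := fun h => by
        have := congrArg Complex.re h; simp at this; linarith
      simp [Complex.zero_cpow this]
      ring
  have hline : ∀ y : ℝ, ((σ : ℂ) + y * Complex.I).re = σ := fun y => by simp
  have hv : ∀ y : ℝ, mellin _ ((σ : ℂ) + y * Complex.I) = _ := fun y => (hm _ (hline y)).2
  have := mellinInv_mellin_eq σ ψ (x := 1) one_pos (hm _ (by simp)).1 ?_ ?_
  · rw [mellinInv] at this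
    simp only [hv] at this
    simp only [hψ, Complex.ofReal_one, Complex.one_cpow, one_smul, le_refl, if_true] at this
    have h2 : ∀ t : ℝ, 1 / ((σ : ℂ) + t * Complex.I - p) - 1 / ((σ : ℂ) + t * Complex.I - q) =
      -(1 / ((σ : ℂ) + t * Complex.I - q) - 1 / ((σ : ℂ) + t * Complex.I - p)) := fun t => by ring
    simp only [h2, MeasureTheory.integral_neg]
    have hpi : (Real.pi : ℂ) ≠ 0 := by exact_mod_cast Real.pi_ne_zero
    rw [Complex.real_smul] at this
    push_cast at this
    field_simp at this
    rw [neg_inj]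
    simpa using this
  · rw [Complex.VerticalIntegrable]
    simp only [hv]
    exact integrable_kernel hq.ne hp.ne'
  · have hc : ∀ w : ℂ, ContinuousAt (fun t : ℝ => (t : ℂ) ^ w) 1 := fun w =>
      Complex.continuousAt_ofReal_cpow_const _ _ (Or.inr one_ne_zero)
    have h1 := hc (-p)
    have h2 := hc (-q)
    rw [Metric.continuousAt_iff'] at h1 h2 ⊢
    intro ε hε
    filter_upwards [h1 ε hε, h2 ε hε] with t ht ht'
    by_cases h1 : t ≤ 1
    · simpa [hψ, h1] using ht'
    · simpa [hψ, h1] using ht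

/-- Cauchy's theorem on rectangles of height 2T; the horizontal sides are O(T^{-2}). -/
theorem vertical_integral_eq_of_decay {V : ℂ → ℂ} {a b C : ℝ} (hab : a < b)
    (hV : ∀ s : ℂ, a ≤ s.re → s.re ≤ b → DifferentiableAt ℂ V s)
    (hb : ∀ s : ℂ, a ≤ s.re → s.re ≤ b → ‖V s‖ ≤ C / (1 + |s.im|) ^ 2) :
    MeasureTheory.Integrable (fun t : ℝ => V (a + t * Complex.I)) ∧
    MeasureTheory.Integrable (fun t : ℝ => V (b + t * Complex.I)) ∧
    ∫ t : ℝ, V (a + t * Complex.I) = ∫ t : ℝ, V (b + t * Complex.I) := by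
  have key : ∀ σ : ℝ, a ≤ σ → σ ≤ b →
      MeasureTheory.Integrable (fun t : ℝ => V (σ + t * Complex.I)) := fun σ h1 h2 => by
    refine integrable_of_le_inv_sq (C := C) ?_ fun t => by
      simpa using hb (σ + t * Complex.I) (by simpa) (by simpa)
    rw [continuous_iff_continuousAt]
    intro t
    have h3 : ContinuousAt V ((fun t : ℝ => (σ : ℂ) + t * Complex.I) t) :=
      (hV _ (by simpa) (by simpa)).continuousAt
    exact h3.comp (f := fun t : ℝ => (σ : ℂ) + t * Complex.I) (by fun_prop)
  have ia := key a le_rfl hab.le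
  have ib := key b hab.le le_rfl
  refine ⟨ia, ib, ?_⟩
  have ta := MeasureTheory.intervalIntegral_tendsto_integral ia tendsto_neg_atTop_atBot tendsto_id
  have tb := MeasureTheory.intervalIntegral_tendsto_integral ib tendsto_neg_atTop_atBot tendsto_id
  have hrect : ∀ T : ℝ, Complex.I • ((∫ y : ℝ in (-T)..T, V (b + y * Complex.I)) -
      (∫ y : ℝ in (-T)..T, V (a + y * Complex.I))) =
      (∫ x : ℝ in a..b, V (x + (T : ℂ) * Complex.I)) -
      ∫ x : ℝ in a..b, V (x + ((-T : ℝ) : ℂ) * Complex.I) := fun T => by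
    have := Complex.integral_boundary_rect_eq_zero_of_differentiableOn V
      ⟨a, -T⟩ ⟨b, T⟩ (fun s hs => by
        have h1 := hs.1
        simp only [Set.uIcc_of_le hab.le, Set.mem_preimage, Set.mem_Icc] at h1
        exact (hV s h1.1 h1.2).differentiableWithinAt)
    simp only at this
    rw [smul_sub]
    linear_combination this
  have hT : ∀ σ : ℝ → ℝ, (∀ T, |σ T| = |T|) →
      Tendsto (fun T : ℝ => ∫ x : ℝ in a..b, V (x + (σ T : ℂ) * Complex.I)) atTop (𝓝 0) := by
    intro σ hσ
    have h0 : Tendsto (fun T : ℝ => C / (1 + |T|) ^ 2 * |b - a|) atTop (𝓝 0) := by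
      have : Tendsto (fun T : ℝ => (1 + |T|) ^ 2) atTop atTop :=
        (tendsto_pow_atTop two_ne_zero).comp
          (tendsto_atTop_add_const_left _ _ tendsto_abs_atTop_atTop)
      simpa using (this.const_div_atTop C).mul_const |b - a|
    refine squeeze_zero_norm (fun T => ?_) h0
    refine intervalIntegral.norm_integral_le_of_norm_le_const fun x hx => ?_
    rw [Set.uIoc_of_le hab.le] at hx
    simpa [hσ] using hb (x + (σ T : ℂ) * Complex.I) (by simpa using hx.1.le) (by simpa using hx.2)
  have h1 := (hT (fun T => T) fun T => rfl).sub (hT (fun T => -T) fun T => abs_neg T)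
  have h2 := (tb.sub ta).const_smul Complex.I
  simp only [← hrect, sub_zero, id] at h1 h2
  have h3 := tendsto_nhds_unique h1 h2
  have h4 := (smul_eq_zero.1 h3.symm).resolve_left Complex.I_ne_zero
  exact (sub_eq_zero.1 h4).symm

/-- Shifting a vertical line of integration across finitely many simple poles. -/
theorem vertical_integral_sub_eq_sum_residues {H : ℂ → ℂ} {a b C T : ℝ} (hab : a < b)
    (S : Finset ℂ) (r : ℂ → ℂ) (hS : ∀ p ∈ S, a < p.re ∧ p.re < b)
    (hres : ∀ p ∈ S, HasResAt H p (r p)) (hreg : ∀ p, p ∉ S → ∃ v, RegAt H p v)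
    (han : ∀ s : ℂ, s.re = a ∨ s.re = b → AnalyticAt ℂ H s)
    (hanT : ∀ s : ℂ, T ≤ |s.im| → AnalyticAt ℂ H s)
    (hgrow : MildGrowth a b H)
    (hedge : ∀ s : ℂ, s.re = a ∨ s.re = b → ‖H s‖ ≤ C / (1 + |s.im|) ^ 2) :
    (∫ t : ℝ, H (b + t * Complex.I)) - ∫ t : ℝ, H (a + t * Complex.I) =
      2 * Real.pi * ∑ p ∈ S, r p := by
  classical
  -- `E` is `H` minus its polar parts, with the removable singularities filled in.
  obtain ⟨E, hE, -, hEq⟩ := exists_entire_of_regAt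
    (F := fun s => H s + ∑ p ∈ S, -r p / (s - p)) (fun s => by
      by_cases hs : s ∈ S
      · refine RegAt.exists_of_value_zero ?_
        have h1 : ∃ v, RegAt (fun z => ∑ p ∈ S.erase s, -r p / (z - p)) s v := by
          refine ⟨_, (AnalyticAt.regAt (Finset.analyticAt_fun_sum _ fun p hp => ?_))⟩
          refine AnalyticAt.div (by fun_prop) (by fun_prop) (sub_ne_zero.2 ?_)
          exact (Finset.ne_of_mem_erase hp).symm
        obtain ⟨v, hv⟩ := h1
        have h2 := ((hres s hs).add (hasResAt_inv_sub s (-r s))).add hv.hasResAt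
        refine (h2.congr (Eventually.of_forall fun z => ?_)).value_eq (by ring)
        simp only [← Finset.add_sum_erase S _ hs]
        ring
      · obtain ⟨v, hv⟩ := hreg s hs
        refine ⟨_, hv.add (AnalyticAt.regAt (Finset.analyticAt_fun_sum _ fun p hp => ?_))⟩
        refine AnalyticAt.div (by fun_prop) (by fun_prop) (sub_ne_zero.2 ?_)
        rintro rfl
        exact hs hp)
  set R := ∑ p ∈ S, r p with hR
  -- An auxiliary point to the left of the strip. Adding R/(s - q) to `E` pairs each r_p/(s - p)
  -- with r_p/(s - q), so what is subtracted from `H` is O(|s|^{-2}) on the edges and has known line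
  -- integrals. The factor (s - q)² then turns quadratic decay of `V` into boundedness of the entire
  -- function `U`.
  set q : ℂ := ((a - 1 : ℝ) : ℂ) with hq
  set U : ℂ → ℂ := fun s => (s - q) ^ 2 * E s + (s - q) * R with hU
  have hUd : Differentiable ℂ U := by
    have := hE
    intro s
    exact ((by fun_prop : DifferentiableAt ℂ (fun s : ℂ => (s - q) ^ 2) s).mul (hE s)).add
      (by fun_prop)
  set V : ℂ → ℂ := fun s => U s / (s - q) ^ 2 with hVdef
  have hsq : ∀ s : ℂ, a ≤ s.re → s - q ≠ 0 := fun s hs h0 => by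
    have := congrArg Complex.re h0
    simp [hq] at this
    linarith
  have hVeq : ∀ s : ℂ, a ≤ s.re → (∀ p ∈ S, s ≠ p) → AnalyticAt ℂ H s →
      V s = H s - ∑ p ∈ S, r p * (1 / (s - p) - 1 / (s - q)) := fun s hs hsp hsH => by
    have h1 : E s = H s + ∑ p ∈ S, -r p / (s - p) := by
      refine hEq s (hsH.add (Finset.analyticAt_fun_sum _ fun p hp => ?_))
      exact AnalyticAt.div (by fun_prop) (by fun_prop) (sub_ne_zero.2 (hsp p hp))
    have h2 := hsq s hs
    have h3 : V s = E s + R / (s - q) := by simp only [hVdef, hU]; field_simp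
    rw [h3, h1, hR, Finset.sum_div, add_assoc, ← Finset.sum_add_distrib, sub_eq_add_neg (H s),
      ← Finset.sum_neg_distrib]
    congr 1
    refine Finset.sum_congr rfl fun p _ => ?_
    ring
  have hline : ∀ σ : ℝ, σ = a ∨ σ = b → ∀ t : ℝ, V (σ + t * Complex.I) = H (σ + t * Complex.I) -
      ∑ p ∈ S, r p * (1 / ((σ : ℂ) + t * Complex.I - p) - 1 / ((σ : ℂ) + t * Complex.I - q)) := by
    intro σ hσ t
    refine hVeq _ (by rcases hσ with rfl | rfl <;> simp [hab.le]) (fun p hp h0 => ?_)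
      (han _ (by simpa using hσ))
    have := hS p hp
    rw [← h0] at this
    rcases hσ with rfl | rfl <;> simp at this
  have hpσ : ∀ σ : ℝ, σ = a ∨ σ = b → ∀ p ∈ S, p.re ≠ σ := by
    rintro σ (rfl | rfl) p hp
    exacts [(hS p hp).1.ne', (hS p hp).2.ne]
  have hqσ : ∀ σ : ℝ, σ = a ∨ σ = b → q.re ≠ σ := by
    rintro σ (rfl | rfl) <;> simp [hq] <;> linarith
  -- bounds on the edges
  have hedgeU : ∀ σ : ℝ, σ = a ∨ σ = b → ∃ D : ℝ, ∀ s : ℂ, s.re = σ → ‖U s‖ ≤ D := by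
    intro σ hσ
    have hK : ∀ p ∈ S, ∃ K : ℝ, ∀ t : ℝ,
        ‖r p * (1 / ((σ : ℂ) + t * Complex.I - p) - 1 / ((σ : ℂ) + t * Complex.I - q))‖ ≤
          K / (1 + |t|) ^ 2 := by
      intro p hp
      obtain ⟨C₁, hC₁, hb₁⟩ := exists_bound_inv_sub (hpσ σ hσ p hp)
      obtain ⟨C₂, hC₂, hb₂⟩ := exists_bound_inv_sub (hqσ σ hσ)
      refine ⟨‖r p * (p - q)‖ * (C₁ * C₂), fun t => ?_⟩
      have h1 := line_sub_ne_zero (hpσ σ hσ p hp) t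
      have h2 := line_sub_ne_zero (hqσ σ hσ) t
      have : r p * (1 / ((σ : ℂ) + t * Complex.I - p) - 1 / ((σ : ℂ) + t * Complex.I - q)) =
          r p * (p - q) *
            (1 / ((σ : ℂ) + t * Complex.I - p) * (1 / ((σ : ℂ) + t * Complex.I - q))) := by
        field_simp; ring
      rw [this, norm_mul, norm_mul (1 / _)]
      calc _ ≤ ‖r p * (p - q)‖ * (C₁ / (1 + |t|) * (C₂ / (1 + |t|))) := by
            gcongr; exacts [hb₁ t, hb₂ t]
        _ = _ := by field_simp
    choose! K hK using hK
    refine ⟨(C + ∑ p ∈ S, K p) * (1 + |σ| + ‖q‖) ^ 2, fun s hs => ?_⟩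
    have hs' : s = (σ : ℂ) + s.im * Complex.I := by
      rw [← hs]; exact (Complex.re_add_im s).symm
    have h1 : ‖V s‖ ≤ (C + ∑ p ∈ S, K p) / (1 + |s.im|) ^ 2 := by
      rw [hs', hline σ hσ, ← hs', add_div, Finset.sum_div]
      refine (norm_sub_le _ _).trans (add_le_add (hedge s (by rw [hs]; exact hσ)) ?_)
      refine (norm_sum_le _ _).trans (Finset.sum_le_sum fun p hp => ?_)
      have := hK p hp s.im
      rwa [← hs'] at this
    have h2 : U s = V s * (s - q) ^ 2 := by
      have := hsq s (by rw [hs]; rcases hσ with rfl | rfl <;> linarith)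
      simp only [hVdef]; field_simp
    have h3 : ‖s - q‖ ≤ (1 + |σ| + ‖q‖) * (1 + |s.im|) := by
      have h4 := norm_sub_le s q
      have h5 := Complex.norm_le_abs_re_add_abs_im s
      rw [hs] at h5
      nlinarith [abs_nonneg σ, abs_nonneg s.im, norm_nonneg q,
        mul_nonneg (add_nonneg (abs_nonneg σ) (norm_nonneg q)) (abs_nonneg s.im)]
    have h6 : 0 < (1 + |s.im|) ^ 2 := by positivity
    rw [h2, norm_mul, norm_pow]
    calc ‖V s‖ * ‖s - q‖ ^ 2
        ≤ (C + ∑ p ∈ S, K p) / (1 + |s.im|) ^ 2 * ((1 + |σ| + ‖q‖) * (1 + |s.im|)) ^ 2 := by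
          gcongr
          exact (norm_nonneg _).trans h1
      _ = _ := by field_simp
  obtain ⟨Da, hDa⟩ := hedgeU a (Or.inl rfl)
  obtain ⟨Db, hDb⟩ := hedgeU b (Or.inr rfl)
  -- growth inside
  have hUgrow : MildGrowth a b U := by
    set T' : ℝ := max T (1 + ∑ p ∈ S, |p.im|) with hT'
    have h0 : ∀ z : ℂ, T' ≤ |z.im| → ∀ p ∈ S, 1 ≤ ‖z - p‖ := fun z hz p hp => by
      have h1 : |p.im| ≤ ∑ p ∈ S, |p.im| :=
        Finset.single_le_sum (f := fun p : ℂ => |p.im|) (fun _ _ => abs_nonneg _) hp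
      have h2 : |z.im| ≤ |z.im - p.im| + |p.im| := by simpa using abs_add_le (z.im - p.im) p.im
      have h3 : |z.im - p.im| ≤ ‖z - p‖ := by simpa using Complex.abs_im_le_norm (z - p)
      linarith [(le_max_right _ _).trans hz]
    have hE' : MildGrowth a b E := by
      have h4 : MildGrowth a b (fun s => ∑ p ∈ S, -r p / (s - p)) := by
        refine MildGrowth.of_bounded (C := ∑ p ∈ S, ‖r p‖) (T := T') fun z _ _ hz => ?_
        refine (norm_sum_le _ _).trans (Finset.sum_le_sum fun p hp => ?_)
        rw [norm_div, norm_neg]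
        exact div_le_self (norm_nonneg _) (h0 z hz p hp)
      refine (hgrow.add h4).congr (T := T') fun z _ _ hz => hEq z ?_
      refine (hanT z ((le_max_left _ _).trans hz)).add
        (Finset.analyticAt_fun_sum _ fun p hp => ?_)
      refine AnalyticAt.div (by fun_prop) (by fun_prop) fun h => ?_
      have := h0 z hz p hp
      rw [h, norm_zero] at this
      linarith
    have hid : MildGrowth a b (fun s => s - q) := by
      simpa [sub_eq_add_neg] using MildGrowth.id.add (MildGrowth.const (-q))
    refine (((hid.mul hid).mul hE').add (hid.mul (MildGrowth.const R))).congr (T := 0) ?_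
    intro z _ _ _
    simp only [hU]; ring
  -- Phragmén-Lindelöf in the strip. Its growth condition needs some exponent below π/(b - a); half
  -- of that is used.
  have hUbound : ∀ s : ℂ, a ≤ s.re → s.re ≤ b → ‖U s‖ ≤ max Da Db := by
    intro s h1 h2
    refine PhragmenLindelof.vertical_strip (a := a) (b := b) hUd.diffContOnCl ?_
      (fun z hz => (hDa z hz).trans (le_max_left _ _))
      (fun z hz => (hDb z hz).trans (le_max_right _ _)) h1 h2
    have hc : 0 < Real.pi / (b - a) / 2 := by
      have := Real.pi_pos
      have := sub_pos.2 hab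
      positivity
    obtain ⟨B, hB⟩ := hUgrow _ hc
    refine ⟨_, half_lt_self (by linarith), B, hB.mono ?_⟩
    exact inf_le_inf le_rfl (principal_mono.2 (Set.preimage_mono Set.Ioo_subset_Icc_self))
  have hVb : ∃ D, ∀ s : ℂ, a ≤ s.re → s.re ≤ b → ‖V s‖ ≤ D / (1 + |s.im|) ^ 2 := by
    refine ⟨max Da Db * 4, fun s h1 h2 => ?_⟩
    have h3 : (1 + |s.im|) ≤ 2 * ‖s - q‖ := by
      have h4 : |s.im| ≤ ‖s - q‖ := by simpa [hq] using Complex.abs_im_le_norm (s - q)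
      have h5 : |s.re - (a - 1)| ≤ ‖s - q‖ := by
        simpa [hq] using Complex.abs_re_le_norm (s - q)
      have := le_abs_self (s.re - (a - 1))
      linarith
    have h6 := hUbound s h1 h2
    have h7 : 0 < ‖s - q‖ := by linarith [abs_nonneg s.im]
    simp only [hVdef]
    rw [norm_div, norm_pow, div_le_div_iff₀ (by positivity) (by positivity)]
    calc ‖U s‖ * (1 + |s.im|) ^ 2 ≤ max Da Db * (2 * ‖s - q‖) ^ 2 := by
          gcongr
          exact (norm_nonneg _).trans h6
      _ = _ := by ring
  obtain ⟨D, hD⟩ := hVb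
  obtain ⟨ia, ib, hVV⟩ := vertical_integral_eq_of_decay (V := V) hab (fun s h1 _ =>
    (hUd s).div (by fun_prop) (pow_ne_zero 2 (hsq s h1))) hD
  have hker : ∀ σ : ℝ, σ = a ∨ σ = b →
      MeasureTheory.Integrable (fun t : ℝ => V (σ + t * Complex.I)) →
      ∫ t : ℝ, H (σ + t * Complex.I) = (∫ t : ℝ, V (σ + t * Complex.I)) +
      ∑ p ∈ S, r p * ∫ t : ℝ, (1 / ((σ : ℂ) + t * Complex.I - p) -
        1 / ((σ : ℂ) + t * Complex.I - q)) := by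
    intro σ hσ hi
    have h1 : ∀ p ∈ S, MeasureTheory.Integrable (fun t : ℝ => r p *
        (1 / ((σ : ℂ) + t * Complex.I - p) - 1 / ((σ : ℂ) + t * Complex.I - q))) := fun p hp =>
      (integrable_kernel (hpσ σ hσ p hp) (hqσ σ hσ)).const_mul _
    simp only [← MeasureTheory.integral_const_mul]
    rw [← MeasureTheory.integral_finsetSum _ h1, ← MeasureTheory.integral_add hi
      (MeasureTheory.integrable_finsetSum _ h1)]
    refine MeasureTheory.integral_congr_ae (Eventually.of_forall fun t => ?_)
    simp only [hline σ hσ t, sub_add_cancel]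
  rw [hker b (Or.inr rfl) ib, hker a (Or.inl rfl) ia, hVV, add_sub_add_left_eq_sub,
    ← Finset.sum_sub_distrib, Finset.mul_sum]
  refine Finset.sum_congr rfl fun p hp => ?_
  -- The kernels integrate to 0 on the right edge and to -2π on the left edge, where `p` and `q` are
  -- separated by the line.
  rw [integral_kernel_right (hS p hp).2 (by simp [hq]; linarith),
    integral_kernel_left (hS p hp).1 (by simp [hq])]
  ring

noncomputable section

/-! ### The Mellin transform of a smooth function on the unit interval -/

/-- `∫_0^1 x^{s-1} h(x) dx`. -/
def unitMellin (h : ℝ → ℂ) (s : ℂ) : ℂ := ∫ x in (0 : ℝ)..1, (x : ℂ) ^ (s - 1) * h x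

/-- The continuation of `unitMellin h` to `Re s > -K`, by `K` integrations by parts. -/
def unitMellinStep : ℕ → (ℝ → ℂ) → ℂ → ℂ
  | 0, h, s => unitMellin h s
  | K + 1, h, s => (h 1 - unitMellinStep K (deriv h) (s + 1)) / s

/-- The continuation of `unitMellin h` to the complex plane. -/
def unitMellinExt (h : ℝ → ℂ) (s : ℂ) : ℂ := unitMellinStep (⌈-s.re⌉₊ + 1) h s

theorem ContDiff.deriv_infty {h : ℝ → ℂ} (hh : ContDiff ℝ ∞ h) : ContDiff ℝ ∞ (deriv h) :=
  (contDiff_infty_iff_deriv.1 hh).2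

theorem ContDiff.hasDerivAt_infty {h : ℝ → ℂ} (hh : ContDiff ℝ ∞ h) (x : ℝ) :
    HasDerivAt h (deriv h x) x := ((contDiff_infty_iff_deriv.1 hh).1 x).hasDerivAt

theorem intervalIntegrable_cpow_mul {h : ℝ → ℂ} (hh : Continuous h) {s : ℂ} (hs : 0 < s.re) :
    IntervalIntegrable (fun x : ℝ => (x : ℂ) ^ (s - 1) * h x) MeasureTheory.volume 0 1 :=
  (intervalIntegral.intervalIntegrable_cpow' (by simpa using hs)).mul_continuousOn hh.continuousOn

theorem unitMellin_eq_mellin (h : ℝ → ℂ) (s : ℂ) :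
    unitMellin h s = mellin ((Set.Ioc (0 : ℝ) 1).indicator h) s := by
  have h1 : (fun t : ℝ => (t : ℂ) ^ (s - 1) • (Set.Ioc (0 : ℝ) 1).indicator h t) =
      (Set.Ioc (0 : ℝ) 1).indicator (fun t : ℝ => (t : ℂ) ^ (s - 1) * h t) := by
    funext t
    by_cases ht : t ∈ Set.Ioc (0 : ℝ) 1
    · rw [Set.indicator_of_mem ht, Set.indicator_of_mem ht, smul_eq_mul]
    · rw [Set.indicator_of_notMem ht, Set.indicator_of_notMem ht, smul_zero]
  rw [mellin, h1, MeasureTheory.setIntegral_indicator measurableSet_Ioc,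
    Set.inter_eq_right.2 Set.Ioc_subset_Ioi_self, unitMellin,
    intervalIntegral.integral_of_le zero_le_one]

theorem exists_bound_unit {h : ℝ → ℂ} (hh : Continuous h) :
    ∃ C : ℝ, 0 ≤ C ∧ ∀ x ∈ Set.Icc (0 : ℝ) 1, ‖h x‖ ≤ C := by
  obtain ⟨C, hC⟩ := isCompact_Icc.exists_bound_of_continuousOn (s := Set.Icc (0 : ℝ) 1)
    hh.continuousOn
  exact ⟨C, (norm_nonneg _).trans (hC 0 (by simp)), hC⟩

theorem differentiableAt_unitMellin {h : ℝ → ℂ} (hh : Continuous h) {s : ℂ} (hs : 0 < s.re) :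
    DifferentiableAt ℂ (unitMellin h) s := by
  rw [show unitMellin h = mellin ((Set.Ioc (0 : ℝ) 1).indicator h) from
    funext (unitMellin_eq_mellin h)]
  obtain ⟨C, hC, hb⟩ := exists_bound_unit hh
  refine mellin_differentiableAt_of_isBigO_rpow (a := s.re + 1) (b := 0) ?_ ?_ (by simp) ?_ hs
  · exact ((hh.integrableOn_Icc (a := 0) (b := 1)).mono_set
      Set.Ioc_subset_Icc_self).integrable_indicator measurableSet_Ioc
        |>.locallyIntegrable.locallyIntegrableOn _
  · refine Asymptotics.IsBigO.of_bound 1 ?_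
    filter_upwards [eventually_gt_atTop 1] with t ht
    rw [Set.indicator_of_notMem (fun h => absurd h.2 (not_le.2 ht))]
    simp
  · refine Asymptotics.IsBigO.of_bound C ?_
    filter_upwards [Ioo_mem_nhdsGT one_pos] with t ht
    rw [Set.indicator_of_mem (show t ∈ Set.Ioc (0 : ℝ) 1 from ⟨ht.1, ht.2.le⟩)]
    simpa using hb t ⟨ht.1.le, ht.2.le⟩

theorem analyticAt_unitMellin {h : ℝ → ℂ} (hh : Continuous h) {s : ℂ} (hs : 0 < s.re) :
    AnalyticAt ℂ (unitMellin h) s := by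
  have ho : IsOpen {z : ℂ | 0 < z.re} := isOpen_lt continuous_const Complex.continuous_re
  exact DifferentiableOn.analyticAt (s := {z : ℂ | 0 < z.re})
    (fun z hz => (differentiableAt_unitMellin hh hz).differentiableWithinAt) (ho.mem_nhds hs)

theorem mul_unitMellin {h : ℝ → ℂ} (hh : ContDiff ℝ ∞ h) {s : ℂ} (hs : 0 < s.re) :
    s * unitMellin h s = h 1 - unitMellin (deriv h) (s + 1) := by
  have hs0 : s ≠ 0 := fun h0 => by simp [h0] at hs
  have i1 := intervalIntegrable_cpow_mul hh.continuous hs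
  have i2 := intervalIntegrable_cpow_mul (s := s + 1) hh.deriv_infty.continuous (by simp; linarith)
  have := intervalIntegral.integral_eq_sub_of_hasDerivAt_of_le (f := fun x : ℝ => (x : ℂ) ^ s * h x)
    (f' := fun x : ℝ => s * ((x : ℂ) ^ (s - 1) * h x) + (x : ℂ) ^ (s + 1 - 1) * deriv h x)
    zero_le_one ?_ ?_ ((i1.const_mul s).add i2)
  · rw [intervalIntegral.integral_add (i1.const_mul s) i2, intervalIntegral.integral_const_mul] at this
    rw [unitMellin, unitMellin, eq_sub_iff_add_eq, this]
    simp [Complex.zero_cpow hs0]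
  · exact ((Complex.continuous_ofReal_cpow_const hs).mul hh.continuous).continuousOn
  · intro x hx
    have h1 := hasDerivAt_ofReal_cpow_const' hx.1.ne' (r := s - 1) (by
      intro h0; exact hs0 (by linear_combination h0))
    have h2 := (hasDerivAt_ofReal_cpow_const (x := x) hx.1.ne' hs0).mul (hh.hasDerivAt_infty x)
    refine h2.congr_deriv ?_
    rw [add_sub_cancel_right]; ring

theorem unitMellinStep_succ_eq {h : ℝ → ℂ} (hh : ContDiff ℝ ∞ h) (K : ℕ) {s : ℂ}
    (hs : -(K : ℝ) < s.re) : unitMellinStep (K + 1) h s = unitMellinStep K h s := by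
  induction K generalizing h s with
  | zero =>
    have h1 : 0 < s.re := by simpa using hs
    have h0 : s ≠ 0 := fun h0 => by simp [h0] at h1
    simp only [unitMellinStep]
    rw [div_eq_iff h0, ← mul_unitMellin hh h1, mul_comm]
  | succ K ih =>
    have h1 : -(K : ℝ) < (s + 1).re := by push_cast at hs; simp; linarith
    change (h 1 - unitMellinStep (K + 1) (deriv h) (s + 1)) / s =
      (h 1 - unitMellinStep K (deriv h) (s + 1)) / s
    rw [ih hh.deriv_infty h1]

/-- The number of integrations by parts in the definition varies with s. Any number K > -Re s gives
the same value, so the recursion holds at every s, and induction can lower the abscissa one unit at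
a time. -/
theorem unitMellinExt_eq_step {h : ℝ → ℂ} (hh : ContDiff ℝ ∞ h) (K : ℕ) {s : ℂ}
    (hs : -(K : ℝ) < s.re) : unitMellinExt h s = unitMellinStep K h s := by
  have key : ∀ K j : ℕ, -(K : ℝ) < s.re → unitMellinStep (K + j) h s = unitMellinStep K h s := by
    intro K j hK
    induction j with
    | zero => rfl
    | succ j ih =>
      rw [← add_assoc, unitMellinStep_succ_eq hh, ih]
      push_cast
      linarith [(Nat.cast_nonneg j : (0 : ℝ) ≤ j)]
  have h0 : -((⌈-s.re⌉₊ + 1 : ℕ) : ℝ) < s.re := by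
    push_cast; linarith [Nat.le_ceil (-s.re)]
  rw [unitMellinExt, ← key _ K h0, ← key K (⌈-s.re⌉₊ + 1) hs, add_comm]

theorem unitMellinExt_eq {h : ℝ → ℂ} (hh : ContDiff ℝ ∞ h) {s : ℂ} (hs : 0 < s.re) :
    unitMellinExt h s = unitMellin h s := unitMellinExt_eq_step hh 0 (by simpa using hs)

theorem unitMellinExt_rec {h : ℝ → ℂ} (hh : ContDiff ℝ ∞ h) (s : ℂ) :
    unitMellinExt h s = (h 1 - unitMellinExt (deriv h) (s + 1)) / s := by
  obtain ⟨K, hK⟩ := exists_nat_gt (-s.re)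
  rw [unitMellinExt_eq_step hh (K + 1) (s := s) (by push_cast; linarith), unitMellinStep,
    unitMellinExt_eq_step hh.deriv_infty K (by simp; linarith)]

theorem analyticAt_unitMellinExt {h : ℝ → ℂ} (hh : ContDiff ℝ ∞ h) {s : ℂ}
    (hs : ∀ k : ℕ, s ≠ -(k : ℂ)) : AnalyticAt ℂ (unitMellinExt h) s := by
  obtain ⟨K, hK⟩ := exists_nat_gt (-s.re)
  induction K generalizing h s with
  | zero =>
    have h1 : 0 < s.re := by simpa using hK
    have ho : IsOpen {z : ℂ | 0 < z.re} := isOpen_lt continuous_const Complex.continuous_re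
    refine (analyticAt_unitMellin hh.continuous h1).congr ?_
    filter_upwards [ho.mem_nhds h1] with z hz using (unitMellinExt_eq hh hz).symm
  | succ K ih =>
    have h1 : AnalyticAt ℂ (unitMellinExt (deriv h)) (s + 1) := by
      refine ih hh.deriv_infty (fun k hk => hs (k + 1) ?_) ?_
      · push_cast; linear_combination hk
      · push_cast at hK; simp; linarith
    have h2 : AnalyticAt ℂ (fun z => unitMellinExt (deriv h) (z + 1)) s :=
      h1.fun_comp_of_eq (by fun_prop) rfl
    have h3 : AnalyticAt ℂ (fun z => (h 1 - unitMellinExt (deriv h) (z + 1)) / z) s :=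
      (analyticAt_const.sub h2).div analyticAt_id (by simpa using hs 0)
    exact h3.congr (Eventually.of_forall fun z => (unitMellinExt_rec hh z).symm)

theorem unitMellin_deriv_one {h : ℝ → ℂ} (hh : ContDiff ℝ ∞ h) :
    unitMellin (deriv h) 1 = h 1 - h 0 := by
  have := intervalIntegral.integral_deriv_eq_sub (f := h) (a := 0) (b := 1)
    (fun x _ => (hh.hasDerivAt_infty x).differentiableAt)
    (hh.deriv_infty.continuous.intervalIntegrable _ _)
  simpa [unitMellin] using this

/-- The residues are the Taylor coefficients. At 0 the numerator of the recursion is h(1) - ∫_0^1 h'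
= h(0); a pole at -(k+1) comes from the pole at -k for h', divided by -(k+1) with the opposite sign.
-/
theorem hasResAt_unitMellinExt {h : ℝ → ℂ} (hh : ContDiff ℝ ∞ h) (k : ℕ) :
    HasResAt (unitMellinExt h) (-(k : ℂ)) (iteratedDeriv k h 0 / (k.factorial : ℂ)) := by
  induction k generalizing h with
  | zero =>
    have h2 : AnalyticAt ℂ (fun z => unitMellinExt (deriv h) (z + 1)) 0 := by
      refine (analyticAt_unitMellinExt hh.deriv_infty (s := 1) fun k hk => ?_).fun_comp_of_eq
        (by fun_prop) (by simp)
      have := congrArg Complex.re hk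
      simp at this
      linarith [(Nat.cast_nonneg k : (0 : ℝ) ≤ k)]
    have h3 : AnalyticAt ℂ (fun z => h 1 - unitMellinExt (deriv h) (z + 1)) 0 :=
      analyticAt_const.sub h2
    refine (h3.regAt' (v := iteratedDeriv 0 h 0 / ((0).factorial : ℂ)) ?_).congr ?_ |> fun h => by
      simpa [HasResAt] using h
    · rw [zero_add, unitMellinExt_eq hh.deriv_infty (by simp), unitMellin_deriv_one hh]
      simp
    · filter_upwards [self_mem_nhdsWithin] with z hz
      rw [unitMellinExt_rec hh]
      have : z ≠ 0 := hz
      field_simp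
  | succ k ih =>
    obtain ⟨g, hg, hv, he⟩ := ih hh.deriv_infty
    have hne : (-((k + 1 : ℕ) : ℂ)) ≠ 0 := neg_ne_zero.2 (Nat.cast_ne_zero.2 (Nat.succ_ne_zero k))
    have hc : AnalyticAt ℂ (fun z : ℂ => z + 1) (-((k + 1 : ℕ) : ℂ)) := by fun_prop
    have hgc : AnalyticAt ℂ (fun z => g (z + 1)) (-((k + 1 : ℕ) : ℂ)) :=
      hg.fun_comp_of_eq hc (by push_cast; ring)
    refine ⟨fun z => ((z + ((k + 1 : ℕ) : ℂ)) * h 1 - g (z + 1)) / z, ?_, ?_, ?_⟩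
    · exact AnalyticAt.div (AnalyticAt.sub (by fun_prop) hgc) analyticAt_id hne
    · have : (-((k + 1 : ℕ) : ℂ) + 1) = -(k : ℂ) := by push_cast; ring
      simp only [this, hv, iteratedDeriv_succ', Nat.factorial_succ]
      have h1 : (k.factorial : ℂ) ≠ 0 := Nat.cast_ne_zero.2 (Nat.factorial_ne_zero k)
      have h2 : (k : ℂ) + 1 ≠ 0 := by exact_mod_cast Nat.succ_ne_zero k
      push_cast
      have h3 : -(k : ℂ) - 1 ≠ 0 := fun h => h2 (by linear_combination -h)
      have h4 : -((k : ℂ) + 1) ≠ 0 := neg_ne_zero.2 h2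
      field_simp
      ring
    · have ht : Tendsto (fun z : ℂ => z + 1) (𝓝[≠] (-((k + 1 : ℕ) : ℂ))) (𝓝[≠] (-(k : ℂ))) := by
        refine tendsto_nhdsWithin_iff.2 ⟨?_, ?_⟩
        · have : (-(k : ℂ)) = -((k + 1 : ℕ) : ℂ) + 1 := by push_cast; ring
          rw [this]
          exact hc.continuousAt.tendsto.mono_left nhdsWithin_le_nhds
        · filter_upwards [self_mem_nhdsWithin] with z hz h0
          exact hz (by
            have h0' : z + 1 = -(k : ℂ) := h0
            simp only [Set.mem_singleton_iff]; push_cast; linear_combination h0')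
      have hz0 : ∀ᶠ z in 𝓝[≠] (-((k + 1 : ℕ) : ℂ)), z ≠ 0 :=
        (eventually_ne_nhds hne).filter_mono nhdsWithin_le_nhds
      filter_upwards [ht.eventually he, hz0] with z hz hz0
      rw [unitMellinExt_rec hh, ← hz]
      push_cast
      field_simp
      ring

/-- For Re s > 1 the integral itself is bounded by sup |h|. Each step to the left divides by s,
whose modulus is at least 1 as soon as |Im s| ≥ 1. -/
theorem exists_bound_unitMellinExt {h : ℝ → ℂ} (hh : ContDiff ℝ ∞ h) (σ : ℝ) :
    ∃ C : ℝ, ∀ s : ℂ, σ ≤ s.re → 1 ≤ |s.im| → ‖unitMellinExt h s‖ ≤ C := by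
  obtain ⟨K, hK⟩ := exists_nat_gt (1 - σ)
  induction K generalizing h σ with
  | zero =>
    obtain ⟨C, hC, hb⟩ := exists_bound_unit hh.continuous
    refine ⟨C, fun s hs _ => ?_⟩
    have h1 : 1 < s.re := by simp at hK; linarith
    rw [unitMellinExt_eq hh (by linarith), unitMellin]
    have := intervalIntegral.norm_integral_le_of_norm_le_const (a := 0) (b := 1) (C := C)
      (f := fun x : ℝ => (x : ℂ) ^ (s - 1) * h x) fun x hx => by
        rw [Set.uIoc_of_le zero_le_one] at hx
        rw [norm_mul, Complex.norm_cpow_eq_rpow_re_of_pos hx.1]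
        have h2 : x ^ (s - 1).re ≤ 1 := Real.rpow_le_one hx.1.le hx.2 (by simp; linarith)
        calc _ ≤ 1 * C := by gcongr; exact hb x ⟨hx.1.le, hx.2⟩
          _ = C := one_mul C
    simpa using this
  | succ K ih =>
    obtain ⟨C, hC⟩ := ih hh.deriv_infty (σ + 1) (by push_cast at hK; linarith)
    refine ⟨‖h 1‖ + C, fun s hs him => ?_⟩
    have h1 : 1 ≤ ‖s‖ := him.trans (Complex.abs_im_le_norm s)
    rw [unitMellinExt_rec hh, norm_div]
    refine (div_le_self (norm_nonneg _) h1).trans ((norm_sub_le _ _).trans ?_)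
    gcongr
    exact hC _ (by simpa using hs) (by simpa using him)

theorem unitMellinExt_const_mul {h : ℝ → ℂ} (c s : ℂ) :
    unitMellinExt (fun x => c * h x) s = c * unitMellinExt h s := by
  have key : ∀ (K : ℕ) (h : ℝ → ℂ) (s : ℂ),
      unitMellinStep K (fun x => c * h x) s = c * unitMellinStep K h s := by
    intro K
    induction K with
    | zero =>
      intro h s
      simp only [unitMellinStep, unitMellin, ← intervalIntegral.integral_const_mul]
      congr 1; funext x; ring
    | succ K ih =>
      intro h s
      have : deriv (fun x => c * h x) = fun x => c * deriv h x := by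
        funext x; exact deriv_const_mul_field c
      simp only [unitMellinStep]
      rw [this, ih]; ring
  exact key _ h s

/-! ### Smooth functions with a power-type expansion at infinity -/

/-- `u(x) = x^{-μ} h(1/x)` for `x > 0`. -/
def InvRep (μ : ℂ) (u h : ℝ → ℂ) : Prop := ∀ x : ℝ, 0 < x → u x = (x : ℂ) ^ (-μ) * h x⁻¹

/-- Differentiation preserves the expansion at infinity and raises the exponent by one. This is why
each derivative of f decays by one further power. -/
theorem InvRep.deriv_rep {μ : ℂ} {u h : ℝ → ℂ} (hr : InvRep μ u h) (hh : ContDiff ℝ ∞ h) :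
    InvRep (μ + 1) (deriv u) (fun y => -μ * h y - y * deriv h y) := by
  intro x hx
  have hx0 : (x : ℂ) ≠ 0 := by exact_mod_cast hx.ne'
  have h1 : HasDerivAt (fun x : ℝ => (x : ℂ) ^ (-μ)) (-μ * (x : ℂ) ^ (-μ - 1)) x := by
    by_cases hμ : μ = 0
    · subst hμ
      simpa using hasDerivAt_const x (1 : ℂ)
    · exact hasDerivAt_ofReal_cpow_const hx.ne' (neg_ne_zero.2 hμ)
  have h2 : HasDerivAt (fun x : ℝ => h x⁻¹) ((-(x ^ 2)⁻¹) • deriv h x⁻¹) x :=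
    HasDerivAt.scomp (g₁ := h) x (hh.hasDerivAt_infty x⁻¹) (hasDerivAt_inv hx.ne')
  have h3 : u =ᶠ[𝓝 x] fun x : ℝ => (x : ℂ) ^ (-μ) * h x⁻¹ := by
    filter_upwards [lt_mem_nhds hx] with y hy using hr y hy
  rw [h3.deriv_eq, (h1.fun_mul h2).deriv, neg_add, ← sub_eq_add_neg, Complex.cpow_sub _ _ hx0,
    Complex.cpow_one, Complex.real_smul]
  push_cast
  field_simp
  ring

theorem InvRep.iteratedDeriv_rep {μ : ℂ} {u h : ℝ → ℂ} (hr : InvRep μ u h) (hh : ContDiff ℝ ∞ h)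
    (m : ℕ) : ∃ k : ℝ → ℂ, ContDiff ℝ ∞ k ∧ InvRep (μ + m) (iteratedDeriv m u) k := by
  induction m with
  | zero => exact ⟨h, hh, by simpa using hr⟩
  | succ m ih =>
    obtain ⟨k, hk, hkr⟩ := ih
    have h1 := hkr.deriv_rep hk
    rw [← iteratedDeriv_succ] at h1
    refine ⟨_, ?_, by rw [Nat.cast_succ, ← add_assoc]; exact h1⟩
    exact (contDiff_const.mul hk).sub (Complex.ofRealCLM.contDiff.mul hk.deriv_infty)

theorem InvRep.exists_bound {μ : ℂ} {u h : ℝ → ℂ} (hr : InvRep μ u h) (hh : Continuous h) :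
    ∃ C : ℝ, 0 ≤ C ∧ ∀ x : ℝ, 1 ≤ x → ‖u x‖ ≤ C * x ^ (-μ.re) := by
  obtain ⟨C, hC, hb⟩ := exists_bound_unit hh
  refine ⟨C, hC, fun x hx => ?_⟩
  have hx0 : 0 < x := one_pos.trans_le hx
  rw [hr x hx0, norm_mul, Complex.norm_cpow_eq_rpow_re_of_pos hx0, mul_comm, Complex.neg_re]
  gcongr
  exact hb _ ⟨by positivity, inv_le_one_of_one_le₀ hx⟩

/-- `∫_1^∞ x^{s-1} u(x) dx`. -/
def tailMellin (u : ℝ → ℂ) (s : ℂ) : ℂ := ∫ x in Set.Ioi (1 : ℝ), (x : ℂ) ^ (s - 1) * u x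

theorem continuousOn_cpow_Ioi {a : ℝ} (ha : 0 ≤ a) (s : ℂ) :
    ContinuousOn (fun x : ℝ => (x : ℂ) ^ s) (Set.Ioi a) := fun _ hx =>
  (Complex.continuousAt_ofReal_cpow_const _ _ (Or.inr (ha.trans_lt hx).ne')).continuousWithinAt

theorem InvRep.integrableOn_tail {μ : ℂ} {u h : ℝ → ℂ} (hr : InvRep μ u h) (hu : Continuous u)
    (hh : Continuous h) {s : ℂ} (hs : s.re < μ.re) :
    MeasureTheory.IntegrableOn (fun x : ℝ => (x : ℂ) ^ (s - 1) * u x) (Set.Ioi 1) := by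
  obtain ⟨C, hC, hb⟩ := hr.exists_bound hh
  refine ((integrableOn_Ioi_rpow_of_lt (a := s.re - 1 - μ.re) (by linarith) one_pos).const_mul C).mono'
    (((continuousOn_cpow_Ioi zero_le_one _).mul hu.continuousOn).aestronglyMeasurable
      measurableSet_Ioi) ?_
  filter_upwards [MeasureTheory.ae_restrict_mem measurableSet_Ioi] with x hx
  have hx0 : 0 < x := one_pos.trans hx
  rw [norm_mul, Complex.norm_cpow_eq_rpow_re_of_pos hx0]
  calc _ ≤ x ^ (s - 1).re * (C * x ^ (-μ.re)) := by gcongr; exact hb x (le_of_lt hx)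
    _ = C * (x ^ (s - 1).re * x ^ (-μ.re)) := by ring
    _ = _ := by rw [← Real.rpow_add hx0]; simp [sub_eq_add_neg]

/-- The substitution x ↦ 1/x moves the integral over (1, ∞) to (0, 1), where the smoothness of `h`
at 0 provides the continuation. -/
theorem InvRep.tailMellin_eq {μ : ℂ} {u h : ℝ → ℂ} (hr : InvRep μ u h) (s : ℂ) :
    tailMellin u s = unitMellin h (μ - s) := by
  rw [unitMellin_eq_mellin, ← neg_sub s μ, ← mellin_comp_inv, mellin, tailMellin]
  have h1 : Set.EqOn (fun t : ℝ => (t : ℂ) ^ (s - μ - 1) • (Set.Ioc (0 : ℝ) 1).indicator h t⁻¹)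
      ((Set.Ici (1 : ℝ)).indicator fun t : ℝ => (t : ℂ) ^ (s - 1) * u t) (Set.Ioi 0) := by
    intro t ht
    have ht' : 0 < t := ht
    have ht0 : (t : ℂ) ≠ 0 := by exact_mod_cast ht'.ne'
    by_cases h1 : 1 ≤ t
    · have h2 : t⁻¹ ∈ Set.Ioc (0 : ℝ) 1 := ⟨by positivity, inv_le_one_of_one_le₀ h1⟩
      simp only [Set.indicator_of_mem h2, Set.indicator_of_mem (Set.mem_Ici.2 h1), smul_eq_mul]
      rw [hr t ht', ← mul_assoc, ← Complex.cpow_add _ _ ht0]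
      congr 2; ring
    · have h2 : t⁻¹ ∉ Set.Ioc (0 : ℝ) 1 := fun h => h1 ((inv_le_one₀ ht').1 h.2)
      simp only [Set.indicator_of_notMem h2, Set.indicator_of_notMem (fun h => h1 (Set.mem_Ici.1 h)),
        smul_zero]
  rw [MeasureTheory.setIntegral_congr_fun measurableSet_Ioi h1,
    MeasureTheory.setIntegral_indicator measurableSet_Ici,
    Set.inter_eq_right.2 (Set.Ici_subset_Ioi.2 one_pos), MeasureTheory.integral_Ici_eq_integral_Ioi]

theorem InvRep.tailMellin_rec {μ : ℂ} {u h : ℝ → ℂ} (hr : InvRep μ u h) (hu : ContDiff ℝ ∞ u)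
    (hh : ContDiff ℝ ∞ h) {s : ℂ} (hs : s.re < μ.re) (hs0 : s ≠ 0) :
    tailMellin u s = (-u 1 - tailMellin (deriv u) (s + 1)) / s := by
  have i1 := hr.integrableOn_tail hu.continuous hh.continuous hs
  have i2 := (hr.deriv_rep hh).integrableOn_tail (s := s + 1) hu.deriv_infty.continuous
    ((contDiff_const.mul hh).sub (Complex.ofRealCLM.contDiff.mul hh.deriv_infty)).continuous
    (by simpa using hs)
  have := MeasureTheory.integral_Ioi_of_hasDerivAt_of_tendsto' (a := 1) (m := 0)
    (f := fun x : ℝ => (x : ℂ) ^ s * u x)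
    (f' := fun x : ℝ => s * ((x : ℂ) ^ (s - 1) * u x) + (x : ℂ) ^ (s + 1 - 1) * deriv u x)
    ?_ ((i1.const_mul s).add i2) ?_
  · rw [MeasureTheory.integral_add (i1.const_mul s) i2, MeasureTheory.integral_const_mul] at this
    rw [eq_div_iff hs0, tailMellin, tailMellin]
    simp at this
    simp only [add_sub_cancel_right]
    linear_combination this
  · intro x hx
    have hx0 : x ≠ 0 := (one_pos.trans_le hx).ne'
    refine ((hasDerivAt_ofReal_cpow_const hx0 hs0).mul (hu.hasDerivAt_infty x)).congr_deriv ?_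
    rw [add_sub_cancel_right]; ring
  · obtain ⟨C, hC, hb⟩ := hr.exists_bound hh.continuous
    have h0 : Tendsto (fun x : ℝ => C * x ^ (-(μ.re - s.re))) atTop (𝓝 0) := by
      simpa using (tendsto_rpow_neg_atTop (sub_pos.2 hs)).const_mul C
    refine squeeze_zero_norm' ?_ h0
    filter_upwards [eventually_ge_atTop 1] with x hx
    have hx0 : 0 < x := one_pos.trans_le hx
    rw [norm_mul, Complex.norm_cpow_eq_rpow_re_of_pos hx0]
    calc _ ≤ x ^ s.re * (C * x ^ (-μ.re)) := by gcongr; exact hb x hx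
      _ = C * (x ^ s.re * x ^ (-μ.re)) := by ring
      _ = _ := by rw [← Real.rpow_add hx0]; ring_nf

/-- The Mellin transform of `u`, continued by means of `m`-fold integration by parts, in terms of
the continuations of the integrals over `(0, 1)` and `(1, ∞)`. -/
theorem InvRep.mellin_formula {μ : ℂ} {u h : ℝ → ℂ} (hr : InvRep μ u h) (hu : ContDiff ℝ ∞ u)
    (hh : ContDiff ℝ ∞ h) (m : ℕ) {s : ℂ} (hm : -(m : ℝ) < s.re) (hs : s.re < μ.re)
    (hne : ∀ j : ℕ, j < m → s ≠ -(j : ℂ)) :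
    unitMellinExt u s + unitMellinExt h (μ - s) =
      (-1) ^ m / (∏ j ∈ Finset.range m, (s + (j : ℂ))) *
        ∫ x in Set.Ioi (0 : ℝ), (x : ℂ) ^ (s + (m : ℂ) - 1) * iteratedDeriv m u x := by
  -- Since Re s < Re μ, the second continuation is a convergent integral, equal to the tail itself.
  -- The induction can then integrate by parts on both pieces.
  rw [unitMellinExt_eq hh (by simpa using hs), ← hr.tailMellin_eq]
  induction m generalizing u h s μ with
  | zero =>
    have hs0 : 0 < s.re := by simpa using hm
    rw [unitMellinExt_eq hu hs0, unitMellin, tailMellin,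
      intervalIntegral.integral_of_le zero_le_one]
    have i1 := (intervalIntegrable_iff_integrableOn_Ioc_of_le zero_le_one).1
      (intervalIntegrable_cpow_mul hu.continuous hs0)
    have i2 := hr.integrableOn_tail hu.continuous hh.continuous hs
    rw [← MeasureTheory.setIntegral_union (Set.Ioc_disjoint_Ioi le_rfl) measurableSet_Ioi i1 i2,
      Set.Ioc_union_Ioi_eq_Ioi zero_le_one]
    simp
  | succ m ih =>
    have hs0 : s ≠ 0 := by simpa using hne 0 (Nat.succ_pos m)
    rw [hr.tailMellin_rec hu hh hs hs0, unitMellinExt_rec hu, ← add_div]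
    have := ih (hr.deriv_rep hh) hu.deriv_infty
      ((contDiff_const.mul hh).sub (Complex.ofRealCLM.contDiff.mul hh.deriv_infty)) (s := s + 1)
      (by push_cast at hm; simp; linarith) (by simpa using hs)
      (fun j hj h0 => hne (j + 1) (by omega) (by push_cast; linear_combination h0))
    rw [iteratedDeriv_succ', Finset.prod_range_succ']
    have e1 : ∀ j : ℕ, s + ((j + 1 : ℕ) : ℂ) = s + 1 + j := fun j => by push_cast; ring
    have e2 : s + ((m + 1 : ℕ) : ℂ) - 1 = s + 1 + m - 1 := by push_cast; ring
    rw [e2]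
    simp only [e1, Nat.cast_zero, add_zero]
    -- The boundary terms at the cut x = 1 cancel.
    have e3 : u 1 - unitMellinExt (deriv u) (s + 1) +
        (-u 1 - tailMellin (deriv u) (s + 1)) =
        -(unitMellinExt (deriv u) (s + 1) + tailMellin (deriv u) (s + 1)) := by ring
    rw [e3, this, pow_succ]
    ring

/-! ### Local zeta functions -/

theorem inftyTransform_of_ne (lam : ℂ) (ℓ : ℤ) (f : ℝ → ℂ) {x : ℝ} (hx : x ≠ 0) :
    inftyTransform lam ℓ f x = inftyRaw lam ℓ f x := by
  rw [inftyTransform, Function.update_of_ne hx]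

theorem I_zpow_ne_zero (ℓ : ℤ) : Complex.I ^ ℓ ≠ 0 := zpow_ne_zero _ Complex.I_ne_zero

theorem cpow_mul_cpow_inv {x : ℝ} (hx : 0 < x) (w : ℂ) :
    (x : ℂ) ^ w * ((x⁻¹ : ℝ) : ℂ) ^ w = 1 := by
  rw [← Complex.mul_cpow_ofReal_nonneg hx.le (inv_nonneg.2 hx.le)]
  have : (x : ℂ) ≠ 0 := by exact_mod_cast hx.ne'
  simp [this]

/-- `f_∞∞ = i^ℓ f`. -/
theorem inftyTransform_inftyTransform {lam : ℂ} {ℓ : ℤ} {f : ℝ → ℂ} (hf : Continuous f) :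
    inftyTransform lam ℓ (inftyTransform lam ℓ f) = fun x => Complex.I ^ ℓ * f x := by
  have key : ∀ x : ℝ, x ≠ 0 →
      inftyRaw lam ℓ (inftyTransform lam ℓ f) x = Complex.I ^ ℓ * f x := by
    intro x hx
    have h1 : (-1 / x) ≠ 0 := div_ne_zero (by norm_num) hx
    have h2 : -1 / (-1 / x) = x := by field_simp
    rw [inftyRaw, inftyTransform_of_ne _ _ _ h1, inftyRaw, h2]
    have h3 : |(-1 / x)| = |x|⁻¹ := by rw [abs_div]; simp
    have h4 := cpow_mul_cpow_inv (abs_pos.2 hx) (-2 * lam)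
    rw [h3]
    rcases lt_or_gt_of_ne hx with hneg | hpos
    · rw [if_neg (not_lt.2 hneg.le), if_pos (div_pos_of_neg_of_neg (by norm_num) hneg)]
      linear_combination Complex.I ^ ℓ * f x * h4
    · rw [if_pos hpos, if_neg (not_lt.2 (div_neg_of_neg_of_pos (by norm_num) hpos).le)]
      linear_combination Complex.I ^ ℓ * f x * h4
  funext x
  by_cases hx : x = 0
  · subst hx
    rw [inftyTransform, Function.update_self]
    have h1 : Tendsto (fun x => Complex.I ^ ℓ * f x) (𝓝[≠] 0) (𝓝 (Complex.I ^ ℓ * f 0)) :=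
      ((continuous_const.mul hf).tendsto 0).mono_left nhdsWithin_le_nhds
    refine (h1.congr' ?_).limUnder_eq
    filter_upwards [self_mem_nhdsWithin] with x hx using (key x hx).symm
  · rw [inftyTransform_of_ne _ _ _ hx, key x hx]

theorem inftyTransform_mem {lam : ℂ} {ℓ : ℤ} {f : ℝ → ℂ} (hf : f ∈ lineModel lam ℓ) :
    inftyTransform lam ℓ f ∈ lineModel lam ℓ := by
  refine ⟨hf.2, ?_⟩
  rw [inftyTransform_inftyTransform hf.1.continuous]
  exact contDiff_const.mul hf.1

/-- The constant relating `f(ε x)` to `f_∞(-ε / x)`. -/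
def signFactor (ℓ : ℤ) (ε : ℤˣ) : ℂ := if ε = 1 then Complex.I ^ (-ℓ) else 1

/-- An explicit meromorphic continuation of the local zeta function. -/
def localPhi (lam : ℂ) (ℓ : ℤ) (ε : ℤˣ) (f : ℝ → ℂ) (s : ℂ) : ℂ :=
  unitMellinExt (fun x => f (((ε : ℤ) : ℝ) * x)) s + signFactor ℓ ε *
    unitMellinExt (fun y => inftyTransform lam ℓ f (-((ε : ℤ) : ℝ) * y)) (2 * lam - s)

/-- The definition of f_∞, solved for f on the half-line of sign ε. For ε = 1 the argument -1/x is
negative, which is where `signFactor` picks up i^{-ℓ}. -/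
theorem invRep_of_lineModel (lam : ℂ) (ℓ : ℤ) (ε : ℤˣ) (f : ℝ → ℂ) :
    InvRep (2 * lam) (fun x => f (((ε : ℤ) : ℝ) * x))
      (fun y => signFactor ℓ ε * inftyTransform lam ℓ f (-((ε : ℤ) : ℝ) * y)) := by
  intro x hx
  have hx1 : 0 < x⁻¹ := inv_pos.2 hx
  have h4 := cpow_mul_cpow_inv hx (-2 * lam)
  have hI : Complex.I ^ (-ℓ) * Complex.I ^ ℓ = 1 := by
    rw [← zpow_add₀ Complex.I_ne_zero]; simp
  rw [show -(2 * lam) = -2 * lam by ring]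
  rcases Int.units_eq_one_or ε with rfl | rfl
  · have h1 : -(((1 : ℤˣ) : ℤ) : ℝ) * x⁻¹ ≠ 0 := by simp [hx.ne']
    simp only [signFactor, if_true]
    rw [inftyTransform_of_ne _ _ _ h1, inftyRaw]
    have h2 : ¬ (0 < -(((1 : ℤˣ) : ℤ) : ℝ) * x⁻¹) := by simp [hx.le]
    have h3 : |-(((1 : ℤˣ) : ℤ) : ℝ) * x⁻¹| = x⁻¹ := by simp [abs_of_pos hx]
    have h5 : -1 / (-(((1 : ℤˣ) : ℤ) : ℝ) * x⁻¹) = x := by simp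
    rw [if_neg h2, h3, h5]
    simp only [Units.val_one, Int.cast_one, one_mul]
    linear_combination -(f x) * h4 - (x : ℂ) ^ (-2 * lam) * ((x⁻¹ : ℝ) : ℂ) ^ (-2 * lam) * f x * hI
  · have h0 : (((-1 : ℤˣ) : ℤ) : ℝ) = -1 := by simp
    have h1 : -(((-1 : ℤˣ) : ℤ) : ℝ) * x⁻¹ ≠ 0 := by simp [hx.ne']
    have h6 : signFactor ℓ (-1) = 1 := if_neg (by decide)
    beta_reduce
    rw [h6, inftyTransform_of_ne _ _ _ h1, inftyRaw]
    have h2 : 0 < -(((-1 : ℤˣ) : ℤ) : ℝ) * x⁻¹ := by simp [hx]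
    have h3 : |-(((-1 : ℤˣ) : ℤ) : ℝ) * x⁻¹| = x⁻¹ := by simp [abs_of_pos hx]
    have h5 : -1 / (-(((-1 : ℤˣ) : ℤ) : ℝ) * x⁻¹) = -x := by simp
    rw [if_pos h2, h3, h5, h0, neg_one_mul]
    linear_combination -(f (-x)) * h4

section

variable {lam : ℂ} {ℓ : ℤ} {f : ℝ → ℂ}

theorem contDiff_comp_mul (hf : ContDiff ℝ ∞ f) (c : ℝ) : ContDiff ℝ ∞ (fun x => f (c * x)) :=
  hf.comp (contDiff_const.mul contDiff_id)

theorem iteratedDeriv_comp_mul_left (hf : ContDiff ℝ ∞ f) (c : ℝ) (n : ℕ) (x : ℝ) :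
    iteratedDeriv n (fun x => f (c * x)) x = (c : ℂ) ^ n * iteratedDeriv n f (c * x) := by
  rw [iteratedDeriv_comp_const_smul (contDiff_infty.1 hf n) c]
  simp

theorem localPhi_formula (hf : f ∈ lineModel lam ℓ) (ε : ℤˣ) (m : ℕ) {s : ℂ}
    (hm : -(m : ℝ) < s.re) (hs : s.re < 2 * lam.re) (hne : ∀ j : ℕ, j < m → s ≠ -(j : ℂ)) :
    localPhi lam ℓ ε f s = (-((ε : ℤ) : ℂ)) ^ m / (∏ j ∈ Finset.range m, (s + (j : ℂ))) *
      ∫ x in Set.Ioi (0 : ℝ), (x : ℂ) ^ (s + (m : ℂ) - 1) *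
        iteratedDeriv m f (((ε : ℤ) : ℝ) * x) := by
  have h1 := (invRep_of_lineModel lam ℓ ε f).mellin_formula (contDiff_comp_mul hf.1 _)
    (contDiff_const.mul (contDiff_comp_mul hf.2 _)) m hm (by simpa using hs) hne
  rw [unitMellinExt_const_mul] at h1
  rw [localPhi, h1]
  simp only [iteratedDeriv_comp_mul_left hf.1]
  have h2 : (-((ε : ℤ) : ℂ)) ^ m = (-1) ^ m * ((ε : ℤ) : ℂ) ^ m := by
    rw [← mul_pow]; ring
  have e : (fun x : ℝ => (x : ℂ) ^ (s + (m : ℂ) - 1) *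
      ((((ε : ℤ) : ℝ) : ℂ) ^ m * iteratedDeriv m f (((ε : ℤ) : ℝ) * x))) = fun x : ℝ =>
      ((ε : ℤ) : ℂ) ^ m * ((x : ℂ) ^ (s + (m : ℂ) - 1) *
        iteratedDeriv m f (((ε : ℤ) : ℝ) * x)) := by
    funext x; push_cast; ring
  rw [e, MeasureTheory.integral_const_mul, h2]
  ring

theorem analyticAt_localPhi (hf : f ∈ lineModel lam ℓ) (ε : ℤˣ) {s : ℂ}
    (h1 : ∀ k : ℕ, s ≠ -(k : ℂ)) (h2 : ∀ k : ℕ, s ≠ 2 * lam + k) :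
    AnalyticAt ℂ (localPhi lam ℓ ε f) s := by
  refine (analyticAt_unitMellinExt (contDiff_comp_mul hf.1 _) h1).add (analyticAt_const.mul ?_)
  refine (analyticAt_unitMellinExt (contDiff_comp_mul hf.2 _) (s := 2 * lam - s)
    fun k hk => h2 k (by linear_combination -hk)).fun_comp_of_eq (by fun_prop) rfl

theorem hasResAt_localPhi (hf : f ∈ lineModel lam ℓ) (ε : ℤˣ) (k : ℕ)
    (h2 : ∀ j : ℕ, -(k : ℂ) ≠ 2 * lam + j) :
    HasResAt (localPhi lam ℓ ε f) (-(k : ℂ))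
      (((ε : ℤ) : ℂ) ^ k * iteratedDeriv k f 0 / (k.factorial : ℂ)) := by
  have h3 : AnalyticAt ℂ (fun s => signFactor ℓ ε * unitMellinExt
      (fun y => inftyTransform lam ℓ f (-((ε : ℤ) : ℝ) * y)) (2 * lam - s)) (-(k : ℂ)) :=
    analyticAt_const.mul ((analyticAt_unitMellinExt (contDiff_comp_mul hf.2 _)
      (s := 2 * lam - -(k : ℂ)) fun j hj => h2 j (by linear_combination -hj)).fun_comp_of_eq
      (by fun_prop) rfl)
  have h4 := (hasResAt_unitMellinExt (contDiff_comp_mul hf.1 ((ε : ℤ) : ℝ)) k).add h3.regAt.hasResAt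
  refine h4.value_eq ?_
  rw [iteratedDeriv_comp_mul_left hf.1]
  simp

theorem meromorphicAt_localPhi (hf : f ∈ lineModel lam ℓ) (ε : ℤˣ) (s : ℂ) :
    MeromorphicAt (localPhi lam ℓ ε f) s := by
  have key : ∀ (h : ℝ → ℂ), ContDiff ℝ ∞ h → ∀ s, MeromorphicAt (unitMellinExt h) s := by
    intro h hh s
    by_cases hs : ∀ k : ℕ, s ≠ -(k : ℂ)
    · exact (analyticAt_unitMellinExt hh hs).meromorphicAt
    · push Not at hs
      obtain ⟨k, rfl⟩ := hs
      exact (hasResAt_unitMellinExt hh k).meromorphicAt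
  refine (key _ (contDiff_comp_mul hf.1 _) s).add ((MeromorphicAt.const _ _).mul ?_)
  have := (key _ (contDiff_comp_mul hf.2 (-((ε : ℤ) : ℝ))) (2 * lam - s))
  exact this.comp_analyticAt (f := unitMellinExt _) (g := fun z => 2 * lam - z) (by fun_prop)

theorem exists_bound_localPhi (hf : f ∈ lineModel lam ℓ) (ε : ℤˣ) (σ₁ σ₂ : ℝ) :
    ∃ C : ℝ, ∀ s : ℂ, σ₁ ≤ s.re → s.re ≤ σ₂ → 1 + |2 * lam.im| ≤ |s.im| →
      ‖localPhi lam ℓ ε f s‖ ≤ C := by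
  obtain ⟨C, hC⟩ := exists_bound_unitMellinExt (contDiff_comp_mul hf.1 ((ε : ℤ) : ℝ)) σ₁
  obtain ⟨D, hD⟩ := exists_bound_unitMellinExt (contDiff_comp_mul hf.2 (-((ε : ℤ) : ℝ)))
    (2 * lam.re - σ₂)
  refine ⟨C + ‖signFactor ℓ ε‖ * D, fun s h1 h2 h3 => ?_⟩
  refine (norm_add_le _ _).trans (add_le_add (hC s h1 ?_) ?_)
  · linarith [abs_nonneg (2 * lam.im)]
  · rw [norm_mul]
    gcongr
    refine hD _ (by simp; linarith) ?_
    have : |s.im| ≤ |2 * lam.im - s.im| + |2 * lam.im| := by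
      have := abs_sub_abs_le_abs_sub s.im (2 * lam.im)
      rw [abs_sub_comm] at this
      linarith
    simp
    linarith

/-- Inversion x ↦ -1/x interchanges the half-lines as well as the pieces (0, 1) and (1, ∞). In the
explicit continuation the two summands change places, by f_∞∞ = i^ℓ f. -/
theorem localPhi_inftyTransform_one (hf : f ∈ lineModel lam ℓ) (s : ℂ) :
    localPhi lam ℓ 1 (inftyTransform lam ℓ f) s = localPhi lam ℓ (-1) f (2 * lam - s) := by
  have h6 : signFactor ℓ (-1) = 1 := if_neg (by decide)
  have hI : Complex.I ^ (-ℓ) * Complex.I ^ ℓ = 1 := by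
    rw [← zpow_add₀ Complex.I_ne_zero]; simp
  simp only [localPhi, inftyTransform_inftyTransform hf.1.continuous, unitMellinExt_const_mul, h6]
  simp only [signFactor, if_true, Units.val_one, Units.val_neg, Int.cast_neg, Int.cast_one,
    neg_neg, sub_sub_cancel]
  linear_combination unitMellinExt (fun x => f (-1 * x)) (2 * lam - s) * hI

theorem localPhi_inftyTransform_neg (hf : f ∈ lineModel lam ℓ) (s : ℂ) :
    localPhi lam ℓ (-1) (inftyTransform lam ℓ f) s =
      Complex.I ^ ℓ * localPhi lam ℓ 1 f (2 * lam - s) := by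
  have h6 : signFactor ℓ (-1) = 1 := if_neg (by decide)
  have hI : Complex.I ^ (-ℓ) * Complex.I ^ ℓ = 1 := by
    rw [← zpow_add₀ Complex.I_ne_zero]; simp
  simp only [localPhi, inftyTransform_inftyTransform hf.1.continuous, unitMellinExt_const_mul, h6]
  simp only [signFactor, if_true, Units.val_one, Units.val_neg, Int.cast_neg, Int.cast_one,
    neg_neg, sub_sub_cancel]
  linear_combination -unitMellinExt (fun x => inftyTransform lam ℓ f (-1 * x)) s * hI

theorem isLocalZeta_exists (hf : f ∈ lineModel lam ℓ) (ε : ℤˣ) :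
    ∃ G, IsLocalZeta lam ε f G := by
  have hm : MeromorphicOn (localPhi lam ℓ ε f) Set.univ := fun s _ => meromorphicAt_localPhi hf ε s
  refine ⟨toMeromorphicNFOn (localPhi lam ℓ ε f) Set.univ,
    meromorphicNFOn_toMeromorphicNFOn _ _, fun m s h1 h2 h3 => ?_⟩
  rw [← localPhi_formula hf ε m h1 h2 h3, toMeromorphicNFOn_eq_toMeromorphicNFAt hm (Set.mem_univ s),
    toMeromorphicNFAt_eq_self.2 (analyticAt_localPhi hf ε (fun k hk => ?_)
      fun k hk => ?_).meromorphicNFAt]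
  · by_cases hkm : k < m
    · exact h3 k hkm hk
    · rw [hk] at h1
      simp at h1
      exact hkm h1
  · rw [hk] at h2
    simp at h2
    linarith [(Nat.cast_nonneg k : (0 : ℝ) ≤ k)]

/-- Identity theorem: the chosen continuation and `localPhi` agree on an open set, so their
difference has infinite order everywhere. Normal form upgrades agreement near s to equality at s. -/
theorem localZeta_eq (hf : f ∈ lineModel lam ℓ) (ε : ℤˣ) {s : ℂ}
    (hs : AnalyticAt ℂ (localPhi lam ℓ ε f) s) :
    localZeta lam ε f s = localPhi lam ℓ ε f s := by
  have hex := isLocalZeta_exists hf ε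
  rw [localZeta, dif_pos hex]
  obtain ⟨hG, hform⟩ := hex.choose_spec
  set G := hex.choose
  have hD : MeromorphicOn (fun z => G z - localPhi lam ℓ ε f z) Set.univ := fun z _ =>
    (hG.meromorphicOn z (Set.mem_univ z)).sub (meromorphicAt_localPhi hf ε z)
  obtain ⟨m, hm⟩ := exists_nat_gt (1 - 2 * lam.re)
  -- A point of the strip off the real axis, so that the excluded values -j do not interfere.
  set s₁ : ℂ := ⟨2 * lam.re - 1, 1⟩ with hs₁
  have hnear : ∀ᶠ z in 𝓝 s₁, G z - localPhi lam ℓ ε f z = 0 := by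
    have o1 : IsOpen {z : ℂ | -(m : ℝ) < z.re ∧ z.re < 2 * lam.re ∧ 0 < z.im} :=
      (isOpen_lt continuous_const Complex.continuous_re).inter
        ((isOpen_lt Complex.continuous_re continuous_const).inter
          (isOpen_lt continuous_const Complex.continuous_im))
    filter_upwards [o1.mem_nhds (show s₁ ∈ _ from ⟨by simp [hs₁]; linarith, by simp [hs₁],
      by simp [hs₁]⟩)] with z hz
    have h3 : ∀ j : ℕ, j < m → z ≠ -(j : ℂ) := fun j _ h => by
      have := hz.2.2
      rw [h] at this
      simp at this
    rw [hform m z hz.1 hz.2.1 h3, localPhi_formula hf ε m hz.1 hz.2.1 h3, sub_self]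
  have htop : meromorphicOrderAt (fun z => G z - localPhi lam ℓ ε f z) s = ⊤ := by
    by_contra h
    have h1 := hD.meromorphicOrderAt_ne_top_of_isPreconnected isPreconnected_univ
      (Set.mem_univ s) (Set.mem_univ s₁) h
    exact h1 (meromorphicOrderAt_eq_top_iff.2 (hnear.filter_mono nhdsWithin_le_nhds))
  have hGs : G =ᶠ[𝓝[≠] s] localPhi lam ℓ ε f :=
    (meromorphicOrderAt_eq_top_iff.1 htop).mono fun z hz => sub_eq_zero.1 hz
  exact (((hG (Set.mem_univ s)).eventuallyEq_nhdsNE_iff_eventuallyEq_nhds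
    hs.meromorphicNFAt).1 hGs).eq_of_nhds

/-- The hypothesis on λ says exactly that s = 1 is none of the possible poles 2λ + k. -/
theorem genFourier_zero (hf : f ∈ lineModel lam ℓ) (hlam : ∀ k : ℕ, lam ≠ 1 / 2 - (k : ℂ) / 2) :
    genFourier lam f 0 = localPhi lam ℓ 1 f 1 + localPhi lam ℓ (-1) f 1 := by
  have h1 : ∀ ε : ℤˣ, AnalyticAt ℂ (localPhi lam ℓ ε f) 1 := fun ε =>
    analyticAt_localPhi hf ε (fun k hk => by
      have := congrArg Complex.re hk
      simp at this
      linarith [(Nat.cast_nonneg k : (0 : ℝ) ≤ k)]) fun k hk => hlam k (by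
      linear_combination -hk / 2)
  rw [genFourier, if_pos rfl, localZeta_eq hf 1 (h1 1), localZeta_eq hf (-1) (h1 (-1))]

end

/-! ### Mellin transforms of Fourier integrals -/

/-- `∫ g(x) e^{2πixt} dx`. -/
def fourierInt (g : ℝ → ℂ) (t : ℝ) : ℂ :=
  ∫ x : ℝ, g x * Complex.exp (2 * (Real.pi : ℂ) * Complex.I * (x : ℂ) * (t : ℂ))

theorem norm_fourier_exp (x t : ℝ) :
    ‖Complex.exp (2 * (Real.pi : ℂ) * Complex.I * (x : ℂ) * (t : ℂ))‖ = 1 := by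
  have : 2 * (Real.pi : ℂ) * Complex.I * (x : ℂ) * (t : ℂ) =
      ((2 * Real.pi * x * t : ℝ) : ℂ) * Complex.I := by push_cast; ring
  rw [this, Complex.norm_exp_ofReal_mul_I]

theorem integrable_mul_fourier_exp {g : ℝ → ℂ} (hg : MeasureTheory.Integrable g) (t : ℝ) :
    MeasureTheory.Integrable fun x : ℝ =>
      g x * Complex.exp (2 * (Real.pi : ℂ) * Complex.I * (x : ℂ) * (t : ℂ)) := by
  refine hg.mul_bdd (c := 1) (by fun_prop) (Eventually.of_forall fun x => ?_)
  rw [norm_fourier_exp]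

theorem norm_fourierInt_le (g : ℝ → ℂ) (t : ℝ) : ‖fourierInt g t‖ ≤ ∫ x : ℝ, ‖g x‖ := by
  refine (MeasureTheory.norm_integral_le_integral_norm _).trans (le_of_eq ?_)
  congr 1; funext x
  rw [norm_mul, norm_fourier_exp, mul_one]

theorem continuous_fourierInt {g : ℝ → ℂ} (hg : MeasureTheory.Integrable g) :
    Continuous (fourierInt g) := by
  refine MeasureTheory.continuous_of_dominated (bound := fun x => ‖g x‖)
    (fun t => (integrable_mul_fourier_exp hg t).aestronglyMeasurable) (fun t => ?_) hg.norm ?_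
  · refine Eventually.of_forall fun x => ?_
    rw [norm_mul, norm_fourier_exp, mul_one]
  · exact Eventually.of_forall fun x => by fun_prop

theorem fourierInt_deriv {g g' : ℝ → ℂ} (hd : ∀ x, HasDerivAt g (g' x) x)
    (hg : MeasureTheory.Integrable g) (hg' : MeasureTheory.Integrable g') (t : ℝ) :
    fourierInt g' t = -(2 * (Real.pi : ℂ) * Complex.I * t) * fourierInt g t := by
  have he : ∀ x : ℝ, HasDerivAt (fun x : ℝ =>
      Complex.exp (2 * (Real.pi : ℂ) * Complex.I * (x : ℂ) * (t : ℂ)))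
      (Complex.exp (2 * (Real.pi : ℂ) * Complex.I * (x : ℂ) * (t : ℂ)) *
        (2 * (Real.pi : ℂ) * Complex.I * t)) x := fun x => by
    have h1 : HasDerivAt (fun x : ℝ => 2 * (Real.pi : ℂ) * Complex.I * (x : ℂ) * (t : ℂ))
        (2 * (Real.pi : ℂ) * Complex.I * t) x := by
      simpa using (((hasDerivAt_id x).ofReal_comp.const_mul
        (2 * (Real.pi : ℂ) * Complex.I)).mul_const (t : ℂ))
    exact h1.cexp
  have := MeasureTheory.integral_mul_deriv_eq_deriv_mul_of_integrable
    (u := g) (v := fun x : ℝ => Complex.exp (2 * (Real.pi : ℂ) * Complex.I * (x : ℂ) * (t : ℂ)))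
    (fun x _ => hd x) (fun x _ => he x) ?_ (integrable_mul_fourier_exp hg' t)
    (integrable_mul_fourier_exp hg t)
  · rw [fourierInt, fourierInt, ← MeasureTheory.integral_const_mul]
    rw [eq_neg_iff_add_eq_zero, add_comm, ← eq_neg_iff_add_eq_zero] at this
    rw [this, ← MeasureTheory.integral_neg]
    congr 1; funext x; ring
  · refine ((integrable_mul_fourier_exp hg t).mul_const (2 * (Real.pi : ℂ) * Complex.I * t)).congr
      (Eventually.of_forall fun x => ?_)
    simp only [Pi.mul_apply]; ring

/-- Decay of order `|x|^{-2-j}` of the `j`-th derivative. -/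
def SymbolDecay (g : ℝ → ℂ) : Prop :=
  ContDiff ℝ ∞ g ∧ ∀ j : ℕ, ∃ C : ℝ, ∀ x : ℝ, ‖iteratedDeriv j g x‖ ≤ C / (1 + |x|) ^ (2 + j)

namespace SymbolDecay

variable {g : ℝ → ℂ}

theorem hasDerivAt (hg : SymbolDecay g) (x : ℝ) : HasDerivAt g (deriv g x) x :=
  hg.1.hasDerivAt_infty x

theorem bound (hg : SymbolDecay g) : ∃ C : ℝ, 0 ≤ C ∧ ∀ x, ‖g x‖ ≤ C / (1 + |x|) ^ 2 := by
  obtain ⟨C, hC⟩ := hg.2 0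
  refine ⟨C, ?_, fun x => by simpa using hC x⟩
  simpa using (norm_nonneg _).trans (hC 0)

theorem bound_deriv (hg : SymbolDecay g) :
    ∃ C : ℝ, 0 ≤ C ∧ ∀ x, ‖deriv g x‖ ≤ C / (1 + |x|) ^ 3 := by
  obtain ⟨C, hC⟩ := hg.2 1
  refine ⟨C, ?_, fun x => by simpa [iteratedDeriv_one] using hC x⟩
  simpa using (norm_nonneg _).trans (hC 0)

theorem integrable (hg : SymbolDecay g) : MeasureTheory.Integrable g := by
  obtain ⟨C, -, hC⟩ := hg.bound
  exact integrable_of_le_inv_sq hg.1.continuous hC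

theorem integrable_deriv (hg : SymbolDecay g) : MeasureTheory.Integrable (deriv g) := by
  obtain ⟨C, hC0, hC⟩ := hg.bound_deriv
  refine integrable_of_le_inv_sq hg.1.deriv_infty.continuous (C := C) fun x => (hC x).trans ?_
  have : (1 : ℝ) ≤ 1 + |x| := by linarith [abs_nonneg x]
  gcongr
  norm_num

theorem comp_neg (hg : SymbolDecay g) : SymbolDecay (fun x => g (-x)) := by
  refine ⟨hg.1.comp contDiff_neg, fun j => ?_⟩
  obtain ⟨C, hC⟩ := hg.2 j
  refine ⟨C, fun x => ?_⟩
  rw [iteratedDeriv_comp_neg, norm_smul]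
  simpa using hC (-x)

/-- The factor x costs one power and the derivative gains it back, so the class is stable under x
d/dx. On half-line moments this operator is multiplication by w - 1. -/
theorem euler (hg : SymbolDecay g) : SymbolDecay (fun x => x * deriv g x) := by
  have hsm : ContDiff ℝ ∞ (fun x : ℝ => (x : ℂ) * deriv g x) :=
    Complex.ofRealCLM.contDiff.mul hg.1.deriv_infty
  have key : ∀ j : ℕ, iteratedDeriv j (fun x : ℝ => (x : ℂ) * deriv g x) =
      fun x : ℝ => (x : ℂ) * iteratedDeriv (j + 1) g x + j * iteratedDeriv j g x := by
    intro j
    induction j with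
    | zero => simp [iteratedDeriv_one]
    | succ j ih =>
      rw [iteratedDeriv_succ, ih]
      funext x
      have hd : ∀ k : ℕ, HasDerivAt (iteratedDeriv k g) (iteratedDeriv (k + 1) g x) x := fun k => by
        rw [iteratedDeriv_succ]
        exact ((hg.1.differentiable_iteratedDeriv k (by exact_mod_cast ENat.natCast_lt_top k)) x).hasDerivAt
      have h1 := ((hasDerivAt_id x).ofReal_comp.mul (hd (j + 1))).add ((hd j).const_mul (j : ℂ))
      refine h1.deriv.trans ?_
      simp
      ring
  refine ⟨hsm, fun j => ?_⟩
  obtain ⟨C, hC⟩ := hg.2 (j + 1)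
  obtain ⟨D, hD⟩ := hg.2 j
  refine ⟨C + j * D, fun x => ?_⟩
  rw [key]
  have hx : |x| ≤ 1 + |x| := by linarith
  have hpos : 0 < 1 + |x| := by positivity
  calc _ ≤ |x| * (C / (1 + |x|) ^ (2 + (j + 1))) + j * (D / (1 + |x|) ^ (2 + j)) := by
        refine (norm_add_le _ _).trans (add_le_add ?_ ?_)
        · rw [norm_mul, Complex.norm_real, Real.norm_eq_abs]; gcongr; exact hC x
        · rw [norm_mul, Complex.norm_natCast]; gcongr; exact hD x
    _ ≤ (1 + |x|) * (C / (1 + |x|) ^ (2 + (j + 1))) + j * (D / (1 + |x|) ^ (2 + j)) := by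
        have := (norm_nonneg _).trans (hC x)
        gcongr
    _ = _ := by rw [← add_assoc, pow_succ]; field_simp

end SymbolDecay

/-- `∫_0^∞ x^{-w} g(x) dx`. -/
def halfMoment (g : ℝ → ℂ) (w : ℂ) : ℂ := ∫ x in Set.Ioi (0 : ℝ), (x : ℂ) ^ (-w) * g x

section

variable {g : ℝ → ℂ} {w : ℂ}

theorem integrableOn_rpow_mul_decay {r : ℝ} (h1 : r < 1) (h0 : 0 ≤ r) :
    MeasureTheory.IntegrableOn (fun x : ℝ => x ^ (-r) * (1 / (1 + |x|) ^ 2)) (Set.Ioi 0) := by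
  rw [← Set.Ioc_union_Ioi_eq_Ioi zero_le_one]
  have hm : ∀ S ⊆ Set.Ioi (0 : ℝ), MeasurableSet S → MeasureTheory.AEStronglyMeasurable
      (fun x : ℝ => x ^ (-r) * (1 / (1 + |x|) ^ 2)) (MeasureTheory.volume.restrict S) :=
    fun S hS hSm => by
      refine ContinuousOn.aestronglyMeasurable (fun x hx => ?_) hSm
      refine ((Real.continuousAt_rpow_const _ _ (Or.inl (Set.mem_Ioi.1 (hS hx)).ne')).mul
        (Continuous.continuousAt ?_)).continuousWithinAt
      exact continuous_const.div (by fun_prop) fun x => by positivity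
  refine MeasureTheory.IntegrableOn.union ?_ ?_
  · have i1 : MeasureTheory.IntegrableOn (fun x : ℝ => x ^ (-r)) (Set.Ioc 0 1) :=
      (intervalIntegrable_iff_integrableOn_Ioc_of_le zero_le_one).1
        (intervalIntegral.intervalIntegrable_rpow' (by linarith))
    refine i1.mono' (hm _ Set.Ioc_subset_Ioi_self measurableSet_Ioc) ?_
    filter_upwards [MeasureTheory.ae_restrict_mem measurableSet_Ioc] with x hx
    have hx0 : 0 < x := hx.1
    rw [Real.norm_of_nonneg (by positivity)]
    refine mul_le_of_le_one_right (by positivity) ?_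
    rw [div_le_one (by positivity)]
    exact one_le_pow₀ (by linarith [abs_nonneg x])
  · have i2 := integrable_inv_one_add_abs_sq.integrableOn (s := Set.Ioi (1 : ℝ))
    refine i2.mono' (hm _ (Set.Ioi_subset_Ioi zero_le_one) measurableSet_Ioi) ?_
    filter_upwards [MeasureTheory.ae_restrict_mem measurableSet_Ioi] with x hx
    have hx1 : 1 < x := hx
    have hx0 : 0 < x := by linarith
    rw [Real.norm_of_nonneg (by positivity), ← one_div]
    refine mul_le_of_le_one_left (by positivity) ?_
    exact Real.rpow_le_one_of_one_le_of_nonpos hx1.le (by linarith)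

theorem SymbolDecay.integrableOn_halfMoment (hg : SymbolDecay g) (h0 : 0 < w.re) (h1 : w.re < 1) :
    MeasureTheory.IntegrableOn (fun x : ℝ => (x : ℂ) ^ (-w) * g x) (Set.Ioi 0) := by
  obtain ⟨C, hC0, hC⟩ := hg.bound
  refine ((integrableOn_rpow_mul_decay h1 h0.le).const_mul C).mono'
    (((continuousOn_cpow_Ioi le_rfl _).mul hg.1.continuous.continuousOn).aestronglyMeasurable
      measurableSet_Ioi) ?_
  filter_upwards [MeasureTheory.ae_restrict_mem measurableSet_Ioi] with x hx
  have hx0 : 0 < x := hx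
  rw [norm_mul, Complex.norm_cpow_eq_rpow_re_of_pos hx0, Complex.neg_re]
  calc _ ≤ x ^ (-w.re) * (C / (1 + |x|) ^ 2) := by gcongr; exact hC x
    _ = _ := by ring

theorem SymbolDecay.halfMoment_euler (hg : SymbolDecay g) (h0 : 0 < w.re) (h1 : w.re < 1) :
    halfMoment (fun x => x * deriv g x) w = (w - 1) * halfMoment g w := by
  have i1 := hg.integrableOn_halfMoment h0 h1
  have i2 := hg.euler.integrableOn_halfMoment h0 h1
  obtain ⟨C, hC0, hC⟩ := hg.bound
  have hre : 0 < (1 - w).re := by simp; linarith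
  have hne : 1 - w ≠ 0 := fun h => by rw [h] at hre; simp at hre
  have := MeasureTheory.integral_Ioi_of_hasDerivAt_of_tendsto (a := 0) (m := 0)
    (f := fun x : ℝ => (x : ℂ) ^ (1 - w) * g x)
    (f' := fun x : ℝ => (1 - w) * ((x : ℂ) ^ (-w) * g x) + (x : ℂ) ^ (-w) * (x * deriv g x))
    ((Complex.continuous_ofReal_cpow_const hre).mul hg.1.continuous).continuousWithinAt
    ?_ ((i1.const_mul (1 - w)).add i2) ?_
  · rw [MeasureTheory.integral_add (i1.const_mul _) i2, MeasureTheory.integral_const_mul] at this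
    simp only [Complex.ofReal_zero, Complex.zero_cpow hne, zero_mul, sub_zero] at this
    rw [halfMoment, halfMoment]
    linear_combination this
  · intro x hx
    have hx0 : x ≠ 0 := (Set.mem_Ioi.1 hx).ne'
    have hx' : (x : ℂ) ≠ 0 := by exact_mod_cast hx0
    refine ((hasDerivAt_ofReal_cpow_const hx0 hne).mul (hg.hasDerivAt x)).congr_deriv ?_
    have e1 : (x : ℂ) ^ (1 - w) = (x : ℂ) ^ (-w) * x := by
      rw [show 1 - w = -w + 1 by ring, Complex.cpow_add _ _ hx', Complex.cpow_one]
    rw [e1, show 1 - w - 1 = -w by ring]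
    ring
  · have h2 : Tendsto (fun x : ℝ => C * x ^ (-(1 + w.re))) atTop (𝓝 0) := by
      simpa using (tendsto_rpow_neg_atTop (by linarith : 0 < 1 + w.re)).const_mul C
    refine squeeze_zero_norm' ?_ h2
    filter_upwards [eventually_gt_atTop 0] with x hx
    rw [norm_mul, Complex.norm_cpow_eq_rpow_re_of_pos hx]
    have h3 : C / (1 + |x|) ^ 2 ≤ C * x ^ (-2 : ℝ) := by
      rw [Real.rpow_neg hx.le, Real.rpow_two, div_eq_mul_inv]
      gcongr
      rw [abs_of_pos hx]; linarith
    calc _ ≤ x ^ (1 - w).re * (C * x ^ (-2 : ℝ)) := by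
          gcongr; exact (hC x).trans h3
      _ = C * (x ^ (1 - w).re * x ^ (-2 : ℝ)) := by ring
      _ = _ := by rw [← Real.rpow_add hx]; simp; left; ring_nf

/-- The bound does not involve δ and serves as the dominating function as δ → 0+. The argument of
the base contributes at most e^{π|Im w|}. -/
theorem norm_one_div_cpow_le {x δ b : ℝ} (hx : 0 < x) (hb : b = 2 * Real.pi ∨ b = -(2 * Real.pi))
    (h0 : 0 < w.re) : ‖(1 / ((δ : ℂ) - b * Complex.I * x)) ^ w‖ ≤
      Real.exp (Real.pi * |w.im|) * x ^ (-w.re) := by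
  have hpi := Real.pi_gt_three
  have hb' : 1 ≤ |b| := by
    rcases hb with rfl | rfl
    · rw [abs_of_pos (by positivity)]; linarith
    · rw [abs_neg, abs_of_pos (by positivity)]; linarith
  set z : ℂ := (δ : ℂ) - b * Complex.I * x with hz
  have h1 : x ≤ ‖z‖ := by
    have h2 := Complex.abs_im_le_norm z
    have h3 : |z.im| = |b| * x := by simp [hz, abs_mul, abs_of_pos hx]
    nlinarith
  have h4 : ‖1 / z‖ ≤ x⁻¹ := by rw [norm_div, norm_one, one_div]; gcongr
  refine (Complex.norm_cpow_le _ _).trans ?_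
  rw [div_eq_mul_inv, ← Real.exp_neg, mul_comm, Real.rpow_neg hx.le, ← Real.inv_rpow hx.le]
  gcongr
  calc -((1 / z).arg * w.im) ≤ |(1 / z).arg * w.im| := neg_le_abs _
    _ = |(1 / z).arg| * |w.im| := abs_mul _ _
    _ ≤ _ := by gcongr; exact Complex.abs_arg_le_pi _

/-- The base is a positive multiple of εi, whose logarithm is επi/2. This is the source of the
exponentials in γ. -/
theorem one_div_cpow_eq {x : ℝ} (hx : 0 < x) (ε : ℤˣ) (w : ℂ) :
    (1 / (-(((2 * Real.pi * ((ε : ℤ) : ℝ) : ℝ) : ℂ)) * Complex.I * x)) ^ w =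
      (2 * (Real.pi : ℂ)) ^ (-w) * Complex.exp (((ε : ℤ) : ℂ) * (Real.pi * w * Complex.I / 2)) *
        (x : ℂ) ^ (-w) := by
  have hpi := Real.pi_pos
  have hpos : 0 < (2 * Real.pi * x)⁻¹ := by positivity
  have e1 : (1 / (-(((2 * Real.pi * ((ε : ℤ) : ℝ) : ℝ) : ℂ)) * Complex.I * x)) =
      (((2 * Real.pi * x)⁻¹ : ℝ) : ℂ) * (((ε : ℤ) : ℂ) * Complex.I) := by
    have hx' : (x : ℂ) ≠ 0 := by exact_mod_cast hx.ne'
    have hpi' : (Real.pi : ℂ) ≠ 0 := by exact_mod_cast hpi.ne'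
    rcases Int.units_eq_one_or ε with rfl | rfl <;> push_cast <;> field_simp <;> simp
  have hεI : ((ε : ℤ) : ℂ) * Complex.I ≠ 0 := by
    rcases Int.units_eq_one_or ε with rfl | rfl <;> simp
  have hlog : Complex.log (((ε : ℤ) : ℂ) * Complex.I) = ((ε : ℤ) : ℂ) * (Real.pi / 2 * Complex.I) := by
    rcases Int.units_eq_one_or ε with rfl | rfl
    · simp [Complex.log_I]
    · simp [Complex.log_neg_I]
  have h2pi : (2 * (Real.pi : ℂ)) ≠ 0 := by
    have : (Real.pi : ℂ) ≠ 0 := by exact_mod_cast hpi.ne'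
    simp
  have hx' : (x : ℂ) ≠ 0 := by exact_mod_cast hx.ne'
  rw [e1, Complex.cpow_def_of_ne_zero (mul_ne_zero (by exact_mod_cast hpos.ne') hεI),
    Complex.log_ofReal_mul hpos hεI, hlog, Real.log_inv, Real.log_mul (by positivity) hx.ne',
    Complex.cpow_def_of_ne_zero h2pi, Complex.cpow_def_of_ne_zero hx', ← Complex.exp_add,
    ← Complex.exp_add]
  have h3 : Complex.log (2 * (Real.pi : ℂ)) = ((Real.log (2 * Real.pi) : ℝ) : ℂ) := by
    rw [Complex.ofReal_log (by positivity)]; push_cast; rfl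
  rw [h3, ← Complex.ofReal_log hx.le]
  congr 1
  push_cast
  ring

theorem SymbolDecay.tendsto_regularized (hg : SymbolDecay g) (ε : ℤˣ) (h0 : 0 < w.re)
    (h1 : w.re < 1) :
    Tendsto (fun δ : ℝ => ∫ x in Set.Ioi (0 : ℝ), g x *
      (1 / ((δ : ℂ) - ((2 * Real.pi * ((ε : ℤ) : ℝ) : ℝ) : ℂ) * Complex.I * x)) ^ w) (𝓝[>] 0)
      (𝓝 ((2 * (Real.pi : ℂ)) ^ (-w) * Complex.exp (((ε : ℤ) : ℂ) * (Real.pi * w * Complex.I / 2)) *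
        halfMoment g w)) := by
  obtain ⟨C, hC0, hC⟩ := hg.bound
  have hb : (2 * Real.pi * ((ε : ℤ) : ℝ)) = 2 * Real.pi ∨
      (2 * Real.pi * ((ε : ℤ) : ℝ)) = -(2 * Real.pi) := by
    rcases Int.units_eq_one_or ε with rfl | rfl <;> simp
  have hb0 : (2 * Real.pi * ((ε : ℤ) : ℝ)) ≠ 0 := by
    rcases hb with h | h <;> rw [h] <;> simp [Real.pi_ne_zero]
  have him : ∀ (δ : ℝ) (x : ℝ), 0 < x → ((δ : ℂ) -
      ((2 * Real.pi * ((ε : ℤ) : ℝ) : ℝ) : ℂ) * Complex.I * x).im ≠ 0 := fun δ x hx => by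
    have : ((δ : ℂ) - ((2 * Real.pi * ((ε : ℤ) : ℝ) : ℝ) : ℂ) * Complex.I * x).im =
        -((2 * Real.pi * ((ε : ℤ) : ℝ)) * x) := by
      simp only [Complex.sub_im, Complex.ofReal_im, Complex.mul_im, Complex.ofReal_re,
        Complex.mul_re, Complex.I_re, Complex.I_im]
      ring
    rw [this]
    exact neg_ne_zero.2 (mul_ne_zero hb0 hx.ne')
  have hne : ∀ (δ : ℝ) (x : ℝ), 0 < x → (δ : ℂ) -
      ((2 * Real.pi * ((ε : ℤ) : ℝ) : ℝ) : ℂ) * Complex.I * x ≠ 0 := fun δ x hx h =>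
    him δ x hx (by rw [h]; rfl)
  have hslit : ∀ (δ x : ℝ), 0 < x → 1 / ((δ : ℂ) -
      ((2 * Real.pi * ((ε : ℤ) : ℝ) : ℝ) : ℂ) * Complex.I * x) ∈ Complex.slitPlane := by
    intro δ x hx
    refine Or.inr ?_
    rw [one_div, Complex.inv_im]
    refine div_ne_zero (neg_ne_zero.2 (him δ x hx)) (Complex.normSq_eq_zero.not.2 fun h => ?_)
    exact him δ x hx (by rw [h]; rfl)
  have hconst : (2 * (Real.pi : ℂ)) ^ (-w) *
      Complex.exp (((ε : ℤ) : ℂ) * (Real.pi * w * Complex.I / 2)) * halfMoment g w =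
      ∫ x in Set.Ioi (0 : ℝ), g x *
        (1 / (((0 : ℝ) : ℂ) - ((2 * Real.pi * ((ε : ℤ) : ℝ) : ℝ) : ℂ) * Complex.I * x)) ^ w := by
    rw [halfMoment, ← MeasureTheory.integral_const_mul]
    refine MeasureTheory.setIntegral_congr_fun measurableSet_Ioi fun x hx => ?_
    simp only [Complex.ofReal_zero, zero_sub]
    rw [← neg_mul, ← neg_mul, one_div_cpow_eq hx]
    ring
  rw [hconst]
  refine MeasureTheory.tendsto_integral_filter_of_dominated_convergence
    (fun x => C * Real.exp (Real.pi * |w.im|) * (x ^ (-w.re) * (1 / (1 + |x|) ^ 2))) ?_ ?_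
    ((integrableOn_rpow_mul_decay h1 h0.le).const_mul _) ?_
  · filter_upwards [self_mem_nhdsWithin] with δ hδ
    refine ContinuousOn.aestronglyMeasurable (fun x hx => ?_) measurableSet_Ioi
    refine ContinuousAt.continuousWithinAt (hg.1.continuous.continuousAt.mul ?_)
    refine ContinuousAt.cpow (ContinuousAt.div continuousAt_const (by fun_prop)
      (hne δ x hx)) continuousAt_const (hslit δ x hx)
  · filter_upwards [self_mem_nhdsWithin] with δ hδ
    filter_upwards [MeasureTheory.ae_restrict_mem measurableSet_Ioi] with x hx
    have hx0 : 0 < x := hx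
    rw [norm_mul]
    calc _ ≤ C / (1 + |x|) ^ 2 * (Real.exp (Real.pi * |w.im|) * x ^ (-w.re)) := by
          gcongr
          · exact hC x
          · exact norm_one_div_cpow_le hx0 hb h0
      _ = _ := by ring
  · filter_upwards [MeasureTheory.ae_restrict_mem measurableSet_Ioi] with x hx
    refine Tendsto.const_mul _ ?_
    refine Tendsto.mono_left ?_ nhdsWithin_le_nhds
    have : ContinuousAt (fun δ : ℝ => (1 / ((δ : ℂ) -
        ((2 * Real.pi * ((ε : ℤ) : ℝ) : ℝ) : ℂ) * Complex.I * x)) ^ w) 0 :=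
      ContinuousAt.cpow (ContinuousAt.div continuousAt_const (by fun_prop)
        (hne 0 x hx)) continuousAt_const (hslit 0 x hx)
    exact this

end

/-! ### Mellin transform of a Fourier integral by exponential regularization -/

section

variable {g : ℝ → ℂ} {w : ℂ}

theorem SymbolDecay.fourierInt_isBigO_top (hg : SymbolDecay g) :
    fourierInt g =O[atTop] fun t : ℝ => t ^ (-(1 : ℝ)) := by
  refine Asymptotics.IsBigO.of_bound ((∫ x : ℝ, ‖deriv g x‖)) ?_
  filter_upwards [eventually_gt_atTop 0] with t ht
  have h1 := fourierInt_deriv (fun x => hg.hasDerivAt x) hg.integrable hg.integrable_deriv t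
  have h2 := norm_fourierInt_le (deriv g) t
  rw [h1, norm_mul] at h2
  have h3 : ‖-(2 * (Real.pi : ℂ) * Complex.I * t)‖ = 2 * Real.pi * t := by
    simp [abs_of_pos ht, abs_of_pos Real.pi_pos]
  rw [h3] at h2
  rw [Real.rpow_neg_one, Real.norm_of_nonneg (by positivity), ← div_eq_mul_inv, le_div_iff₀ ht]
  nlinarith [Real.pi_gt_three, norm_nonneg (fourierInt g t), mul_nonneg ht.le (norm_nonneg (fourierInt g t))]

theorem fourierInt_isBigO_zero (g : ℝ → ℂ) :
    fourierInt g =O[𝓝[>] 0] fun t : ℝ => t ^ (-(0 : ℝ)) := by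
  refine Asymptotics.IsBigO.of_bound ((∫ x : ℝ, ‖g x‖)) (Eventually.of_forall fun t => ?_)
  simpa using norm_fourierInt_le g t

theorem SymbolDecay.mellinConvergent_fourierInt (hg : SymbolDecay g) (h0 : 0 < w.re)
    (h1 : w.re < 1) : MellinConvergent (fourierInt g) w :=
  mellinConvergent_of_isBigO_rpow
    ((continuous_fourierInt hg.integrable).locallyIntegrable.locallyIntegrableOn _)
    hg.fourierInt_isBigO_top h1 (fourierInt_isBigO_zero g) h0

theorem SymbolDecay.differentiableAt_mellin_fourierInt (hg : SymbolDecay g) (h0 : 0 < w.re)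
    (h1 : w.re < 1) : DifferentiableAt ℂ (mellin (fourierInt g)) w :=
  mellin_differentiableAt_of_isBigO_rpow
    ((continuous_fourierInt hg.integrable).locallyIntegrable.locallyIntegrableOn _)
    hg.fourierInt_isBigO_top h1 (fourierInt_isBigO_zero g) h0

theorem integrableOn_cpow_mul_exp_neg {δ : ℝ} (hδ : 0 < δ) (h0 : 0 < w.re) :
    MeasureTheory.IntegrableOn (fun t : ℝ => (t : ℂ) ^ (w - 1) * Complex.exp (-(δ * t)))
      (Set.Ioi 0) := by
  have := mellinConvergent_of_isBigO_rpow_exp (a := δ) (b := 0) (s := w) hδ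
    (f := fun t : ℝ => Complex.exp (-(δ * t)))
    ((by fun_prop : Continuous fun t : ℝ => Complex.exp (-((δ : ℂ) * t))).locallyIntegrable.locallyIntegrableOn _)
    (Asymptotics.IsBigO.of_bound 1 (Eventually.of_forall fun t => by
      rw [Complex.norm_exp]; simp))
    (Asymptotics.IsBigO.of_bound 1 (by
      filter_upwards [self_mem_nhdsWithin] with t ht
      have ht' : 0 < t := ht
      rw [Complex.norm_exp]; simp
      positivity)) h0
  simpa [MellinConvergent] using this

theorem norm_cpow_mul_exp_neg {t : ℝ} (ht : 0 < t) (w r : ℂ) :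
    ‖(t : ℂ) ^ w * Complex.exp (-(r * t))‖ = t ^ w.re * Real.exp (-(r.re * t)) := by
  rw [norm_mul, Complex.norm_cpow_eq_rpow_re_of_pos ht, Complex.norm_exp]
  simp

theorem aestronglyMeasurable_cpow_mul_exp_neg (w r : ℂ) :
    MeasureTheory.AEStronglyMeasurable (fun t : ℝ => (t : ℂ) ^ w * Complex.exp (-(r * t)))
      (MeasureTheory.volume.restrict (Set.Ioi 0)) :=
  ((continuousOn_cpow_Ioi le_rfl _).mul (by fun_prop)).aestronglyMeasurable measurableSet_Ioi

theorem differentiableAt_gammaIntegral (h0 : 0 < w.re) {r : ℂ} (hr : 0 < r.re) :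
    DifferentiableAt ℂ (fun r : ℂ => ∫ t in Set.Ioi (0 : ℝ),
      (t : ℂ) ^ (w - 1) * Complex.exp (-(r * t))) r := by
  have hball : ∀ z ∈ Metric.ball r (r.re / 2), r.re / 2 ≤ z.re := fun z hz => by
    have h1 := Complex.abs_re_le_norm (z - r)
    rw [Metric.mem_ball, dist_eq_norm] at hz
    have h2 := neg_abs_le (z - r).re
    simp only [Complex.sub_re] at h1 h2
    linarith
  refine (hasDerivAt_integral_of_dominated_loc_of_deriv_le
    (μ := MeasureTheory.volume.restrict (Set.Ioi (0 : ℝ)))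
    (F := fun (z : ℂ) (t : ℝ) => (t : ℂ) ^ (w - 1) * Complex.exp (-(z * t)))
    (F' := fun (z : ℂ) (t : ℝ) => (t : ℂ) ^ w * Complex.exp (-(z * t)) * (-1))
    (bound := fun t : ℝ => ‖(t : ℂ) ^ (w + 1 - 1) * Complex.exp (-(((r.re / 2 : ℝ) : ℂ) * t))‖)
    (Metric.ball_mem_nhds r (half_pos hr))
    (Eventually.of_forall fun z => aestronglyMeasurable_cpow_mul_exp_neg _ _)
    ?_ ((aestronglyMeasurable_cpow_mul_exp_neg _ _).mul_const _) ?_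
    (integrableOn_cpow_mul_exp_neg (w := w + 1) (half_pos hr) (by simp; linarith)).norm ?_).2.differentiableAt
  · refine MeasureTheory.Integrable.mono (integrableOn_cpow_mul_exp_neg hr h0) (aestronglyMeasurable_cpow_mul_exp_neg _ _) ?_
    filter_upwards [MeasureTheory.ae_restrict_mem measurableSet_Ioi] with t ht
    rw [norm_cpow_mul_exp_neg ht, norm_cpow_mul_exp_neg ht, Complex.ofReal_re]
  · filter_upwards [MeasureTheory.ae_restrict_mem measurableSet_Ioi] with t ht z hz
    have ht' : 0 < t := ht
    have := hball z hz
    rw [norm_mul, norm_cpow_mul_exp_neg ht, norm_cpow_mul_exp_neg ht, Complex.ofReal_re]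
    simp only [norm_neg, norm_one, mul_one, add_sub_cancel_right]
    gcongr
  · filter_upwards [MeasureTheory.ae_restrict_mem measurableSet_Ioi] with t ht z _
    have ht' : (t : ℂ) ≠ 0 := by exact_mod_cast (Set.mem_Ioi.1 ht).ne'
    have h1 : HasDerivAt (fun z : ℂ => -(z * (t : ℂ))) (-(1 * (t : ℂ))) z :=
      ((hasDerivAt_id z).mul_const (t : ℂ)).neg
    refine (h1.cexp.const_mul ((t : ℂ) ^ (w - 1))).congr_deriv ?_
    have h2 : (t : ℂ) ^ w = (t : ℂ) ^ (w - 1) * t := by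
      rw [Complex.cpow_sub _ _ ht', Complex.cpow_one]; field_simp
    rw [h2]; ring

/-- Both sides are analytic in r on the right half-plane and agree for real r > 1, a set that
accumulates at 1. -/
theorem integral_cpow_mul_exp_neg_Ioi (h0 : 0 < w.re) {r : ℂ} (hr : 0 < r.re) :
    ∫ t in Set.Ioi (0 : ℝ), (t : ℂ) ^ (w - 1) * Complex.exp (-(r * t)) =
      (1 / r) ^ w * Complex.Gamma w := by
  have ho : IsOpen {z : ℂ | 0 < z.re} := isOpen_lt continuous_const Complex.continuous_re
  have hconv : Convex ℝ {z : ℂ | 0 < z.re} := convex_halfSpace_re_gt 0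
  have ha : AnalyticOnNhd ℂ (fun r : ℂ => ∫ t in Set.Ioi (0 : ℝ),
      (t : ℂ) ^ (w - 1) * Complex.exp (-(r * t))) {z : ℂ | 0 < z.re} :=
    DifferentiableOn.analyticOnNhd (fun z hz =>
      (differentiableAt_gammaIntegral h0 hz).differentiableWithinAt) ho
  have hb : AnalyticOnNhd ℂ (fun r : ℂ => (1 / r) ^ w * Complex.Gamma w) {z : ℂ | 0 < z.re} := by
    refine DifferentiableOn.analyticOnNhd (fun z hz => DifferentiableAt.differentiableWithinAt ?_) ho
    have hz0 : z ≠ 0 := fun h => by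
      have hz' : 0 < z.re := hz
      rw [h] at hz'; simp at hz'
    refine DifferentiableAt.mul_const (DifferentiableAt.cpow_const
      ((differentiableAt_const _).div differentiableAt_id hz0) (Or.inl ?_)) _
    change 0 < (1 / z).re
    rw [one_div, Complex.inv_re]
    exact div_pos hz (Complex.normSq_pos.2 hz0)
  refine ha.eqOn_of_preconnected_of_frequently_eq hb hconv.isPreconnected
    (z₀ := 1) (by simp) ?_ hr
  have ht : Tendsto (fun x : ℝ => (x : ℂ)) (𝓝[>] 1) (𝓝[≠] 1) := by
    refine tendsto_nhdsWithin_iff.2 ⟨?_, ?_⟩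
    · have := (Complex.continuous_ofReal.tendsto 1).mono_left (nhdsWithin_le_nhds (s := Set.Ioi 1))
      simpa using this
    · filter_upwards [self_mem_nhdsWithin] with x hx h
      have h' : (x : ℂ) = 1 := h
      have hx' : (1 : ℝ) < x := hx
      rw [Complex.ofReal_eq_one] at h'
      linarith
  refine ht.frequently (Eventually.frequently ?_)
  filter_upwards [self_mem_nhdsWithin] with x hx
  exact Complex.integral_cpow_mul_exp_neg_mul_Ioi h0 (one_pos.trans hx)

/-- The factor e^{-δt} makes the double integral absolutely convergent, so Fubini applies. The inner
integral is a Gamma integral with parameter δ - 2πix, and the outer one is split by the sign of x.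
-/
theorem SymbolDecay.regularized_mellin (hg : SymbolDecay g) (h0 : 0 < w.re)
    {δ : ℝ} (hδ : 0 < δ) :
    ∫ t in Set.Ioi (0 : ℝ), (t : ℂ) ^ (w - 1) * Complex.exp (-(δ * t)) * fourierInt g t =
      Complex.Gamma w * ((∫ x in Set.Ioi (0 : ℝ), g x *
        (1 / ((δ : ℂ) - ((2 * Real.pi * (((1 : ℤˣ) : ℤ) : ℝ) : ℝ) : ℂ) * Complex.I * x)) ^ w) +
        ∫ x in Set.Ioi (0 : ℝ), g (-x) *
        (1 / ((δ : ℂ) - ((2 * Real.pi * (((-1 : ℤˣ) : ℤ) : ℝ) : ℝ) : ℂ) * Complex.I * x)) ^ w) := by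
  have hint := integrableOn_cpow_mul_exp_neg hδ h0
  have hprod : MeasureTheory.Integrable (Function.uncurry fun (t : ℝ) (x : ℝ) =>
      (t : ℂ) ^ (w - 1) * Complex.exp (-(δ * t)) *
        (g x * Complex.exp (2 * (Real.pi : ℂ) * Complex.I * (x : ℂ) * (t : ℂ))))
      ((MeasureTheory.volume.restrict (Set.Ioi (0 : ℝ))).prod MeasureTheory.volume) := by
    have h2 := (hint.mul_prod hg.integrable).mul_bdd (c := 1)
      (g := fun z : ℝ × ℝ => Complex.exp (2 * (Real.pi : ℂ) * Complex.I * (z.2 : ℂ) * (z.1 : ℂ)))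
      (by fun_prop) (Eventually.of_forall fun z => (norm_fourier_exp z.2 z.1).le)
    refine h2.congr (Eventually.of_forall fun z => ?_)
    simp only [Function.uncurry]
    ring
  set G : ℝ → ℂ := fun x => g x * (1 / ((δ : ℂ) - 2 * Real.pi * Complex.I * x)) ^ w with hG
  have hinner : ∀ x : ℝ, ∫ t in Set.Ioi (0 : ℝ), (t : ℂ) ^ (w - 1) * Complex.exp (-(δ * t)) *
        (g x * Complex.exp (2 * (Real.pi : ℂ) * Complex.I * (x : ℂ) * (t : ℂ))) =
      Complex.Gamma w * G x := by
    intro x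
    have h2 := integral_cpow_mul_exp_neg_Ioi (w := w)
      (r := (δ : ℂ) - 2 * Real.pi * Complex.I * x) h0 (by simpa using hδ)
    have h3 : ∀ t : ℝ, (t : ℂ) ^ (w - 1) * Complex.exp (-(δ * t)) *
        (g x * Complex.exp (2 * (Real.pi : ℂ) * Complex.I * (x : ℂ) * (t : ℂ))) =
        g x * ((t : ℂ) ^ (w - 1) *
          Complex.exp (-(((δ : ℂ) - 2 * Real.pi * Complex.I * x) * t))) := fun t => by
      have : -(((δ : ℂ) - 2 * Real.pi * Complex.I * x) * t) =
        -(δ * t) + 2 * (Real.pi : ℂ) * Complex.I * (x : ℂ) * (t : ℂ) := by ring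
      rw [this, Complex.exp_add]; ring
    simp only [h3]
    rw [MeasureTheory.integral_const_mul, h2, hG]
    ring
  have hGint : MeasureTheory.Integrable G := by
    have hz : ∀ x : ℝ, δ ≤ ‖(δ : ℂ) - 2 * Real.pi * Complex.I * x‖ := fun x => by
      have := Complex.abs_re_le_norm ((δ : ℂ) - 2 * Real.pi * Complex.I * x)
      simp at this
      rwa [abs_of_pos hδ] at this
    have hcont : Continuous fun x : ℝ => (1 / ((δ : ℂ) - 2 * Real.pi * Complex.I * x)) ^ w := by
      refine Continuous.cpow (Continuous.div continuous_const (by fun_prop) fun x h => ?_)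
        continuous_const fun x => Or.inl ?_
      · have := hz x
        rw [h, norm_zero] at this
        linarith
      · rw [one_div, Complex.inv_re]
        refine div_pos (by simpa using hδ) (Complex.normSq_pos.2 fun h => ?_)
        have := hz x
        rw [h, norm_zero] at this
        linarith
    refine hg.integrable.mul_bdd (c := (δ⁻¹) ^ w.re * Real.exp (Real.pi * |w.im|))
      hcont.aestronglyMeasurable (Eventually.of_forall fun x => ?_)
    refine (Complex.norm_cpow_le _ _).trans ?_
    rw [div_eq_mul_inv, ← Real.exp_neg]
    gcongr
    · rw [norm_div, norm_one, one_div]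
      have := hz x
      gcongr
    · set z := 1 / ((δ : ℂ) - 2 * Real.pi * Complex.I * x)
      calc -(z.arg * w.im) ≤ |z.arg * w.im| := neg_le_abs _
        _ = |z.arg| * |w.im| := abs_mul _ _
        _ ≤ _ := by gcongr; exact Complex.abs_arg_le_pi _
  calc _ = ∫ t in Set.Ioi (0 : ℝ), ∫ x : ℝ, (t : ℂ) ^ (w - 1) * Complex.exp (-(δ * t)) *
        (g x * Complex.exp (2 * (Real.pi : ℂ) * Complex.I * (x : ℂ) * (t : ℂ))) := by
        simp only [MeasureTheory.integral_const_mul, fourierInt]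
    _ = ∫ x : ℝ, ∫ t in Set.Ioi (0 : ℝ), (t : ℂ) ^ (w - 1) * Complex.exp (-(δ * t)) *
        (g x * Complex.exp (2 * (Real.pi : ℂ) * Complex.I * (x : ℂ) * (t : ℂ))) :=
        MeasureTheory.integral_integral_swap hprod
    _ = Complex.Gamma w * ∫ x : ℝ, G x := by
        simp only [hinner, MeasureTheory.integral_const_mul]
    _ = _ := by
        congr 1
        rw [← MeasureTheory.integral_add_compl measurableSet_Ioi hGint, Set.compl_Ioi]
        have h4 := integral_comp_neg_Ioi 0 G
        rw [neg_zero] at h4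
        rw [← h4]
        congr 1
        · refine MeasureTheory.setIntegral_congr_fun measurableSet_Ioi fun x _ => ?_
          simp [hG]
        · refine MeasureTheory.setIntegral_congr_fun measurableSet_Ioi fun x _ => ?_
          simp [hG]

/-- The Mellin transform of a Fourier integral (the local functional equation). -/
theorem SymbolDecay.mellin_fourierInt (hg : SymbolDecay g) (h0 : 0 < w.re) (h1 : w.re < 1) :
    mellin (fourierInt g) w = Complex.Gamma w * (2 * (Real.pi : ℂ)) ^ (-w) *
      (Complex.exp (Real.pi * w * Complex.I / 2) * halfMoment g w +
        Complex.exp (-(Real.pi * w * Complex.I / 2)) * halfMoment (fun x => g (-x)) w) := by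
  have hconv := hg.mellinConvergent_fourierInt h0 h1
  -- Let δ → 0+ in the regularized identity. On this side the integrand without the damping factor
  -- dominates; the other side is `SymbolDecay.tendsto_regularized`, once for each sign.
  have hL : Tendsto (fun δ : ℝ => ∫ t in Set.Ioi (0 : ℝ), (t : ℂ) ^ (w - 1) *
      Complex.exp (-(δ * t)) * fourierInt g t) (𝓝[>] 0) (𝓝 (mellin (fourierInt g) w)) := by
    refine MeasureTheory.tendsto_integral_filter_of_dominated_convergence
      (fun t => ‖(t : ℂ) ^ (w - 1) • fourierInt g t‖) ?_ ?_ hconv.norm ?_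
    · refine Eventually.of_forall fun δ => ?_
      refine ContinuousOn.aestronglyMeasurable ?_ measurableSet_Ioi
      exact ((continuousOn_cpow_Ioi le_rfl _).mul (by fun_prop)).mul
        (continuous_fourierInt hg.integrable).continuousOn
    · filter_upwards [self_mem_nhdsWithin] with δ hδ
      filter_upwards [MeasureTheory.ae_restrict_mem measurableSet_Ioi] with t ht
      have hδ' : 0 < δ := hδ
      have ht' : 0 < t := ht
      have : ‖Complex.exp (-(δ * t))‖ ≤ 1 := by
        rw [Complex.norm_exp]; simp; positivity
      rw [norm_mul, norm_mul, norm_smul]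
      gcongr
      exact mul_le_of_le_one_right (norm_nonneg _) this
    · refine Eventually.of_forall fun t => ?_
      have : ContinuousAt (fun δ : ℝ => (t : ℂ) ^ (w - 1) * Complex.exp (-((δ : ℂ) * t)) *
        fourierInt g t) 0 := by fun_prop
      have h2 := this.tendsto.mono_left (nhdsWithin_le_nhds (s := Set.Ioi 0))
      simpa using h2
  have hR := (((hg.tendsto_regularized 1 h0 h1).add
    (hg.comp_neg.tendsto_regularized (-1) h0 h1)).const_mul (Complex.Gamma w))
  have heq := tendsto_nhds_unique (hL.congr' (by
    filter_upwards [self_mem_nhdsWithin] with δ hδ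
    exact hg.regularized_mellin h0 hδ)) hR
  rw [heq]
  simp
  ring

/-- Decay of the Mellin transform along the line `Re w = 1/2`. -/
theorem SymbolDecay.exists_bound_mellin (hg : SymbolDecay g) :
    ∃ C : ℝ, ∀ t : ℝ, ‖mellin (fourierInt g) ((1 / 2 : ℝ) + t * Complex.I)‖ ≤
      C / (1 + |t|) ^ 2 := by
  have hcomm : ∀ k : ℝ → ℂ, SymbolDecay k →
      (fun x : ℝ => ((-x : ℝ) : ℂ) * deriv k (-x)) =
      fun x : ℝ => (x : ℂ) * deriv (fun x => k (-x)) x := fun k _ => by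
    funext x
    rw [deriv_comp_neg]
    push_cast
    ring
  have hstep : ∀ k : ℝ → ℂ, SymbolDecay k → ∀ w : ℂ, 0 < w.re → w.re < 1 →
      mellin (fourierInt fun x => x * deriv k x) w = (w - 1) * mellin (fourierInt k) w := by
    intro k hk w h0 h1
    rw [hk.euler.mellin_fourierInt h0 h1, hk.mellin_fourierInt h0 h1, hk.halfMoment_euler h0 h1,
      hcomm k hk, hk.comp_neg.halfMoment_euler h0 h1]
    ring
  obtain ⟨C, hC, hb⟩ := exists_one_add_abs_le (σ := 1 / 2) (p := 1) (by norm_num)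
  -- Two applications of x d/dx multiply the transform by (w - 1)². The transform of `h` is bounded
  -- on the line, and |w - 1| grows like 1 + |t|.
  set h : ℝ → ℂ := fun x => x * deriv (fun x => x * deriv g x) x with hh
  have hdec : SymbolDecay h := hg.euler.euler
  refine ⟨C ^ 2 * ∫ t in Set.Ioi (0 : ℝ), t ^ (-(1 / 2) : ℝ) * ‖fourierInt h t‖, fun t => ?_⟩
  set w : ℂ := ((1 / 2 : ℝ) : ℂ) + t * Complex.I with hw
  have hre : w.re = 1 / 2 := by simp [hw]
  have e1 := hstep _ hg.euler w (by rw [hre]; norm_num) (by rw [hre]; norm_num)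
  rw [hstep _ hg w (by rw [hre]; norm_num) (by rw [hre]; norm_num)] at e1
  have h2 : ‖mellin (fourierInt h) w‖ ≤
      ∫ t in Set.Ioi (0 : ℝ), t ^ (-(1 / 2) : ℝ) * ‖fourierInt h t‖ := by
    refine (MeasureTheory.norm_integral_le_integral_norm _).trans (le_of_eq ?_)
    refine MeasureTheory.setIntegral_congr_fun measurableSet_Ioi fun x hx => ?_
    simp only [norm_smul]
    rw [Complex.norm_cpow_eq_rpow_re_of_pos hx]
    simp only [Complex.sub_re, hre, Complex.one_re]
    norm_num
  rw [e1, norm_mul, norm_mul] at h2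
  have h3 := hb t
  rw [← hw] at h3
  have h4 : (1 + |t|) ^ 2 ≤ (C * ‖w - 1‖) ^ 2 := by gcongr
  rw [le_div_iff₀ (by positivity)]
  calc ‖mellin (fourierInt g) w‖ * (1 + |t|) ^ 2
      ≤ ‖mellin (fourierInt g) w‖ * (C * ‖w - 1‖) ^ 2 := by gcongr
    _ = C ^ 2 * (‖w - 1‖ * (‖w - 1‖ * ‖mellin (fourierInt g) w‖)) := by ring
    _ ≤ _ := by gcongr

end

/-! ### The Mellin transform of the generalized Fourier transform -/

/-- `(2π)^{-s} Γ(s) (e^{επis/2} Φ_+(f; 1-s) + e^{-επis/2} Φ_-(f; 1-s))`. -/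
def mellinPhi (lam : ℂ) (ℓ : ℤ) (ε : ℤˣ) (f : ℝ → ℂ) (s : ℂ) : ℂ :=
  (2 * (Real.pi : ℂ)) ^ (-s) * Complex.Gamma s *
    (Complex.exp (((ε : ℤ) : ℂ) * (Real.pi * s * Complex.I / 2)) * localPhi lam ℓ 1 f (1 - s) +
      Complex.exp (-(((ε : ℤ) : ℂ) * (Real.pi * s * Complex.I / 2))) *
        localPhi lam ℓ (-1) f (1 - s))

section

variable {lam : ℂ} {ℓ : ℤ} {f : ℝ → ℂ}

/-- For |x| ≥ 1 the decay comes from the expansion at infinity on the two half-lines; compactness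
covers [-1, 1]. -/
theorem lineModel_bound (hf : f ∈ lineModel lam ℓ) (j : ℕ) (hj : 0 ≤ 2 * lam.re + j) :
    ∃ C : ℝ, 0 ≤ C ∧ ∀ x : ℝ,
      ‖iteratedDeriv j f x‖ ≤ C * (1 + |x|) ^ (-(2 * lam.re + j)) := by
  have key : ∀ ε : ℤˣ, ∃ C : ℝ, 0 ≤ C ∧ ∀ x : ℝ, 1 ≤ x →
      ‖iteratedDeriv j f (((ε : ℤ) : ℝ) * x)‖ ≤ C * x ^ (-(2 * lam.re + j)) := by
    intro ε
    obtain ⟨k, hk, hr⟩ := (invRep_of_lineModel lam ℓ ε f).iteratedDeriv_rep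
      (contDiff_const.mul (contDiff_comp_mul hf.2 _)) j
    obtain ⟨C, hC, hb⟩ := hr.exists_bound hk.continuous
    refine ⟨C, hC, fun x hx => ?_⟩
    have := hb x hx
    rw [iteratedDeriv_comp_mul_left hf.1, norm_mul, norm_pow] at this
    have h1 : ‖((((ε : ℤ) : ℝ) : ℂ))‖ = 1 := by
      rcases Int.units_eq_one_or ε with rfl | rfl <;> simp
    rw [h1, one_pow, one_mul] at this
    simpa using this
  obtain ⟨C₁, hC₁, hb₁⟩ := key 1
  obtain ⟨C₂, hC₂, hb₂⟩ := key (-1)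
  obtain ⟨C₃, hC₃⟩ := isCompact_Icc.exists_bound_of_continuousOn (s := Set.Icc (-1 : ℝ) 1)
    (hf.1.continuous_iteratedDeriv j (by exact_mod_cast (ENat.natCast_lt_top j).le)).continuousOn
  have hC₃0 : 0 ≤ C₃ := (norm_nonneg _).trans (hC₃ 0 (by simp))
  set b := 2 * lam.re + j with hb
  -- The factor 2^b comes from 1 + |x| ≤ 2 max(1, |x|), and uses b ≥ 0.
  refine ⟨2 ^ b * (C₁ + C₂ + C₃), by positivity, fun x => ?_⟩
  have hpos : 0 < 1 + |x| := by positivity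
  have hmono : ∀ y : ℝ, 0 < y → (1 + |x|) ≤ 2 * y → y ^ (-b) ≤ 2 ^ b * (1 + |x|) ^ (-b) := by
    intro y hy hxy
    rw [Real.rpow_neg hy.le, Real.rpow_neg hpos.le, ← div_eq_mul_inv, inv_eq_one_div,
      div_le_div_iff₀ (by positivity) (by positivity), one_mul, ← Real.mul_rpow (by norm_num) hy.le]
    exact Real.rpow_le_rpow hpos.le hxy hj
  have h2b : 0 ≤ 2 ^ b * (1 + |x|) ^ (-b) := by positivity
  rcases le_or_gt |x| 1 with hx | hx
  · have h1 := hmono 1 one_pos (by linarith)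
    rw [Real.one_rpow] at h1
    calc _ ≤ C₃ := hC₃ x (abs_le.1 hx)
      _ ≤ C₃ * (2 ^ b * (1 + |x|) ^ (-b)) := le_mul_of_one_le_right hC₃0 h1
      _ ≤ (C₁ + C₂ + C₃) * (2 ^ b * (1 + |x|) ^ (-b)) := by gcongr; linarith
      _ = _ := by ring
  · have h1 := hmono |x| (by linarith) (by linarith)
    rcases le_total 0 x with h0 | h0
    · have h2 := hb₁ x (by rw [abs_of_nonneg h0] at hx; exact hx.le)
      simp only [Units.val_one, Int.cast_one, one_mul] at h2
      rw [abs_of_nonneg h0] at h1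
      rw [abs_of_nonneg h0] at h2b ⊢
      calc _ ≤ C₁ * x ^ (-b) := h2
        _ ≤ C₁ * (2 ^ b * (1 + x) ^ (-b)) := by gcongr
        _ ≤ (C₁ + C₂ + C₃) * (2 ^ b * (1 + x) ^ (-b)) := by gcongr; linarith
        _ = _ := by ring
    · have h2 := hb₂ (-x) (by rw [abs_of_nonpos h0] at hx; exact hx.le)
      simp only [Units.val_one, Units.val_neg, Int.cast_neg, Int.cast_one, neg_mul_neg, one_mul] at h2
      rw [abs_of_nonpos h0] at h1
      rw [abs_of_nonpos h0] at h2b ⊢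
      calc _ ≤ C₂ * (-x) ^ (-b) := h2
        _ ≤ C₂ * (2 ^ b * (1 + -x) ^ (-b)) := by gcongr
        _ ≤ (C₁ + C₂ + C₃) * (2 ^ b * (1 + -x) ^ (-b)) := by gcongr; linarith
        _ = _ := by ring

theorem lt_of_fourierOrder_le {m : ℕ} (hm : fourierOrder lam ≤ m) : 1 < 2 * lam.re + m := by
  have h1 := Nat.le_ceil (1 - 2 * lam.re)
  have h2 : ((fourierOrder lam : ℕ) : ℝ) ≤ m := by exact_mod_cast hm
  rw [fourierOrder] at h2
  push_cast at h2
  linarith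

theorem integrable_iteratedDeriv (hf : f ∈ lineModel lam ℓ) {j : ℕ} (hj : fourierOrder lam ≤ j) :
    MeasureTheory.Integrable (iteratedDeriv j f) := by
  have h1 := lt_of_fourierOrder_le hj
  obtain ⟨C, hC, hb⟩ := lineModel_bound hf j (by linarith)
  refine ((integrable_one_add_norm (E := ℝ) (r := 2 * lam.re + j) (by simpa using h1)).const_mul C).mono'
    (hf.1.continuous_iteratedDeriv j
      (by exact_mod_cast (ENat.natCast_lt_top j).le)).aestronglyMeasurable
    (Eventually.of_forall fun x => by simpa using hb x)

theorem hasDerivAt_iteratedDeriv (hf : ContDiff ℝ ∞ f) (j : ℕ) (x : ℝ) :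
    HasDerivAt (iteratedDeriv j f) (iteratedDeriv (j + 1) f x) x := by
  rw [iteratedDeriv_succ]
  exact ((hf.differentiable_iteratedDeriv j
    (by exact_mod_cast ENat.natCast_lt_top j)) x).hasDerivAt

/-- One integration by parts for each increase of m. The freedom in m lets the line Re s = m + 1/2
be moved as far right as the Dirichlet series require. -/
theorem genFourier_eq (hf : f ∈ lineModel lam ℓ) {m : ℕ} (hm : fourierOrder lam ≤ m) {t : ℝ}
    (ht : t ≠ 0) : genFourier lam f t =
      (-1 / (2 * (Real.pi : ℂ) * Complex.I * (t : ℂ))) ^ m * fourierInt (iteratedDeriv m f) t := by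
  induction m, hm using Nat.le_induction with
  | base => rw [genFourier, if_neg ht, fourierInt]
  | succ m hm ih =>
    rw [ih, fourierInt_deriv (fun x => hasDerivAt_iteratedDeriv hf.1 m x)
      (integrable_iteratedDeriv hf hm) (integrable_iteratedDeriv hf (hm.trans (Nat.le_succ m))),
      pow_succ]
    have h1 : (2 * (Real.pi : ℂ) * Complex.I * (t : ℂ)) ≠ 0 := by
      simp [Real.pi_ne_zero, ht]
    have h2 : -1 / (2 * (Real.pi : ℂ) * Complex.I * (t : ℂ)) *
        (-(2 * (Real.pi : ℂ) * Complex.I * (t : ℂ))) = 1 := by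
      rw [div_mul_eq_mul_div, neg_mul_neg, one_mul, div_self h1]
    generalize fourierInt (iteratedDeriv m f) t = F
    linear_combination (-(-1 / (2 * (Real.pi : ℂ) * Complex.I * (t : ℂ))) ^ m * F) * h2

theorem contDiff_iteratedDeriv (hf : ContDiff ℝ ∞ f) (m : ℕ) :
    ContDiff ℝ ∞ (iteratedDeriv m f) := by
  induction m with
  | zero => simpa using hf
  | succ m ih =>
    rw [iteratedDeriv_succ]
    exact ih.deriv_infty

theorem symbolDecay_iteratedDeriv (hf : f ∈ lineModel lam ℓ) {m : ℕ} (hm : 2 ≤ 2 * lam.re + m) :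
    SymbolDecay (iteratedDeriv m f) := by
  have hit : ∀ j : ℕ, iteratedDeriv j (iteratedDeriv m f) = iteratedDeriv (m + j) f := fun j => by
    rw [iteratedDeriv_eq_iterate, iteratedDeriv_eq_iterate, iteratedDeriv_eq_iterate, add_comm,
      Function.iterate_add_apply]
  refine ⟨contDiff_iteratedDeriv hf.1 m, fun j => ?_⟩
  · obtain ⟨C, hC, hb⟩ := lineModel_bound hf (m + j) (by push_cast; nlinarith [(Nat.cast_nonneg j : (0 : ℝ) ≤ j)])
    refine ⟨C, fun x => ?_⟩
    rw [hit]
    refine (hb x).trans ?_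
    have h1 : (1 : ℝ) ≤ 1 + |x| := by linarith [abs_nonneg x]
    rw [div_eq_mul_inv, ← Real.rpow_natCast, ← Real.rpow_neg (by linarith)]
    have h2 : ((2 + j : ℕ) : ℝ) ≤ 2 * lam.re + ((m + j : ℕ) : ℝ) := by push_cast; linarith
    gcongr

theorem SymbolDecay.comp_unit {g : ℝ → ℂ} (hg : SymbolDecay g) (ε : ℤˣ) :
    SymbolDecay (fun x => g (((ε : ℤ) : ℝ) * x)) := by
  rcases Int.units_eq_one_or ε with rfl | rfl
  · simpa using hg
  · simpa using hg.comp_neg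

theorem fourierInt_comp_unit (g : ℝ → ℂ) (ε : ℤˣ) (t : ℝ) :
    fourierInt (fun x => g (((ε : ℤ) : ℝ) * x)) t = fourierInt g (((ε : ℤ) : ℝ) * t) := by
  rcases Int.units_eq_one_or ε with rfl | rfl
  · simp
  · rw [fourierInt, fourierInt, ← MeasureTheory.integral_neg_eq_self]
    congr 1
    funext x
    simp

theorem genFourier_mul_unit (hf : f ∈ lineModel lam ℓ) {m : ℕ} (hm : fourierOrder lam ≤ m)
    (ε : ℤˣ) {t : ℝ} (ht : 0 < t) : genFourier lam f (((ε : ℤ) : ℝ) * t) =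
      (-((ε : ℤ) : ℂ) / (2 * (Real.pi : ℂ) * Complex.I)) ^ m * ((t : ℂ) ^ (-(m : ℂ)) *
        fourierInt (fun x => iteratedDeriv m f (((ε : ℤ) : ℝ) * x)) t) := by
  have hε : (((ε : ℤ) : ℝ) * t) ≠ 0 := by
    rcases Int.units_eq_one_or ε with rfl | rfl <;> simp [ht.ne']
  rw [genFourier_eq hf hm hε, ← fourierInt_comp_unit, ← mul_assoc]
  congr 1
  rw [Complex.cpow_neg, Complex.cpow_natCast, ← inv_pow, ← mul_pow]
  congr 1
  have ht' : (t : ℂ) ≠ 0 := by exact_mod_cast ht.ne'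
  have hpi : (Real.pi : ℂ) ≠ 0 := by exact_mod_cast Real.pi_ne_zero
  rcases Int.units_eq_one_or ε with rfl | rfl <;> push_cast <;> field_simp

theorem mellin_genFourier_eq (hf : f ∈ lineModel lam ℓ) {m : ℕ} (hm : fourierOrder lam ≤ m)
    (ε : ℤˣ) (w : ℂ) :
    mellin (fun t => genFourier lam f (((ε : ℤ) : ℝ) * t)) (w + m) =
      (-((ε : ℤ) : ℂ) / (2 * (Real.pi : ℂ) * Complex.I)) ^ m *
        mellin (fourierInt fun x => iteratedDeriv m f (((ε : ℤ) : ℝ) * x)) w := by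
  rw [mellin, mellin, ← MeasureTheory.integral_const_mul]
  refine MeasureTheory.setIntegral_congr_fun measurableSet_Ioi fun t ht => ?_
  have ht' : (t : ℂ) ≠ 0 := by exact_mod_cast (Set.mem_Ioi.1 ht).ne'
  simp only [smul_eq_mul]
  rw [genFourier_mul_unit hf hm ε ht, show w - 1 = (w + m - 1) + -(m : ℂ) by ring,
    Complex.cpow_add _ _ ht']
  ring

theorem mellinConvergent_genFourier (hf : f ∈ lineModel lam ℓ) {m : ℕ} (hm : fourierOrder lam ≤ m)
    (hm2 : 2 ≤ 2 * lam.re + m) (ε : ℤˣ) {w : ℂ} (h0 : 0 < w.re) (h1 : w.re < 1) :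
    MellinConvergent (fun t => genFourier lam f (((ε : ℤ) : ℝ) * t)) (w + m) := by
  have h2 := ((symbolDecay_iteratedDeriv hf hm2).comp_unit ε).mellinConvergent_fourierInt h0 h1
  refine MeasureTheory.IntegrableOn.congr_fun (MeasureTheory.Integrable.const_mul h2
    ((-((ε : ℤ) : ℂ) / (2 * (Real.pi : ℂ) * Complex.I)) ^ m)) (fun t ht => ?_) measurableSet_Ioi
  have ht' : (t : ℂ) ≠ 0 := by exact_mod_cast (Set.mem_Ioi.1 ht).ne'
  simp only [smul_eq_mul]
  rw [genFourier_mul_unit hf hm ε ht, show w - 1 = (w + m - 1) + -(m : ℂ) by ring,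
    Complex.cpow_add _ _ ht']
  ring

theorem Gamma_add_natCast {w : ℂ} (hw : 0 < w.re) (m : ℕ) :
    Complex.Gamma (w + m) = Complex.Gamma w * ∏ j ∈ Finset.range m, (w + (j : ℂ)) := by
  induction m with
  | zero => simp
  | succ m ih =>
    have h0 : w + m ≠ 0 := fun h => by
      have := congrArg Complex.re h
      simp at this
      linarith [(Nat.cast_nonneg m : (0 : ℝ) ≤ m)]
    rw [Nat.cast_succ, ← add_assoc, Complex.Gamma_add_one _ h0, ih, Finset.prod_range_succ]
    ring

/-- At s = w + m the m-fold formula for Φ(1 - s) contains the exponent -w, and its denominator is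
(-1)^m w(w+1)⋯(w+m-1), that is, (-1)^m Γ(w+m)/Γ(w). -/
theorem Gamma_mul_localPhi (hf : f ∈ lineModel lam ℓ) {m : ℕ} (hm : fourierOrder lam ≤ m) (ε : ℤˣ)
    {w : ℂ} (h0 : 0 < w.re) (h1 : w.re < 1) :
    Complex.Gamma (w + m) * localPhi lam ℓ ε f (1 - (w + m)) =
      ((ε : ℤ) : ℂ) ^ m * Complex.Gamma w *
        halfMoment (fun x => iteratedDeriv m f (((ε : ℤ) : ℝ) * x)) w := by
  have hlt := lt_of_fourierOrder_le hm
  have hprod : ∏ j ∈ Finset.range m, (1 - (w + m) + (j : ℂ)) =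
      (-1) ^ m * ∏ j ∈ Finset.range m, (w + (j : ℂ)) := by
    have h : (-1 : ℂ) ^ m = ∏ _j ∈ Finset.range m, (-1 : ℂ) := by simp
    rw [← Finset.prod_range_reflect (fun j : ℕ => w + (j : ℂ)) m, h, ← Finset.prod_mul_distrib]
    refine Finset.prod_congr rfl fun j hj => ?_
    have hj' : j + 1 ≤ m := Finset.mem_range.1 hj
    rw [Nat.sub_sub, add_comm 1 j, Nat.cast_sub hj']
    push_cast
    ring
  have hne : ∏ j ∈ Finset.range m, (w + (j : ℂ)) ≠ 0 := by
    refine Finset.prod_ne_zero_iff.2 fun j _ h => ?_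
    have := congrArg Complex.re h
    simp at this
    linarith [(Nat.cast_nonneg j : (0 : ℝ) ≤ j)]
  rw [localPhi_formula hf ε m (by simp; linarith) (by simp; linarith) (fun j hj h => ?_), hprod,
    Gamma_add_natCast h0, halfMoment]
  · have e1 : 1 - (w + m) + m - 1 = -w := by ring
    have e2 : (-((ε : ℤ) : ℂ)) ^ m = (-1) ^ m * ((ε : ℤ) : ℂ) ^ m := by rw [← mul_pow]; ring
    have e3 : ((-1 : ℂ) ^ m) ≠ 0 := pow_ne_zero _ (by norm_num)
    rw [e1, e2]
    field_simp
  · have := congrArg Complex.re h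
    simp at this
    have hj' : (j : ℝ) + 1 ≤ m := by exact_mod_cast hj
    linarith

/-- The local functional equation for the m-th derivative, divided by the m-th power of the
frequency. Shifting w to w + m multiplies the exponentials by i^m and (-i)^m, and these match the
powers of -ε/(2πi) and the signs of Φ_±. -/
theorem mellin_genFourier (hf : f ∈ lineModel lam ℓ) {m : ℕ} (hm : fourierOrder lam ≤ m)
    (hm2 : 2 ≤ 2 * lam.re + m) (ε : ℤˣ) {w : ℂ} (h0 : 0 < w.re) (h1 : w.re < 1) :
    mellin (fun t => genFourier lam f (((ε : ℤ) : ℝ) * t)) (w + m) =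
      mellinPhi lam ℓ ε f (w + m) := by
  rw [mellin_genFourier_eq hf hm,
    ((symbolDecay_iteratedDeriv hf hm2).comp_unit ε).mellin_fourierInt h0 h1]
  have hp := Gamma_mul_localPhi hf hm 1 h0 h1
  have hn := Gamma_mul_localPhi hf hm (-1) h0 h1
  have h2pi : (2 * (Real.pi : ℂ)) ≠ 0 := by simp [Real.pi_ne_zero]
  have e1 : (2 * (Real.pi : ℂ)) ^ (-(w + m)) = (2 * (Real.pi : ℂ)) ^ (-w) *
      ((2 * (Real.pi : ℂ)) ^ m)⁻¹ := by
    rw [neg_add, Complex.cpow_add _ _ h2pi, Complex.cpow_neg _ (m : ℂ), Complex.cpow_natCast]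
  have hI : Complex.exp (Real.pi * m * Complex.I / 2) = Complex.I ^ m := by
    rw [show (Real.pi : ℂ) * m * Complex.I / 2 = m * (Real.pi / 2 * Complex.I) by ring,
      Complex.exp_nat_mul, Complex.exp_pi_div_two_mul_I]
  have hI' : Complex.exp (-(Real.pi * m * Complex.I / 2)) = (-Complex.I) ^ m := by
    rw [Complex.exp_neg, hI, ← inv_pow, Complex.inv_I]
  have e2 : Complex.exp (Real.pi * (w + m) * Complex.I / 2) =
      Complex.exp (Real.pi * w * Complex.I / 2) * Complex.I ^ m := by
    rw [← hI, ← Complex.exp_add]; congr 1; ring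
  have e3 : Complex.exp (-(Real.pi * (w + m) * Complex.I / 2)) =
      Complex.exp (-(Real.pi * w * Complex.I / 2)) * (-Complex.I) ^ m := by
    rw [← hI', ← Complex.exp_add]; congr 1; ring
  have hII : ∀ c : ℂ, (c / (2 * (Real.pi : ℂ) * Complex.I)) ^ m =
      (-c * Complex.I) ^ m * ((2 * (Real.pi : ℂ)) ^ m)⁻¹ := fun c => by
    rw [← inv_pow, ← mul_pow]; congr 1
    have hpi : (Real.pi : ℂ) ≠ 0 := by exact_mod_cast Real.pi_ne_zero
    field_simp
    rw [Complex.I_sq]; ring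
  rw [mellinPhi, mul_assoc ((2 * (Real.pi : ℂ)) ^ (-(w + m))), mul_add (Complex.Gamma (w + m)),
    mul_left_comm _ _ (localPhi lam ℓ 1 f _), mul_left_comm _ _ (localPhi lam ℓ (-1) f _), hp, hn,
    e1, hII]
  have hneg : (-Complex.I) ^ m = (-1) ^ m * Complex.I ^ m := by rw [← mul_pow]; ring
  have hsq : ((-1 : ℂ) ^ m) * (-1) ^ m = 1 := by rw [← mul_pow]; simp
  rcases Int.units_eq_one_or ε with rfl | rfl
  · simp only [Units.val_one, Units.val_neg, Int.cast_neg, Int.cast_one, one_mul, neg_mul,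
      neg_neg, one_pow, e2, e3, hneg]
    linear_combination (-(2 * (Real.pi : ℂ)) ^ (-w) * ((2 * (Real.pi : ℂ)) ^ m)⁻¹ *
      Complex.Gamma w * Complex.exp (-(Real.pi * w * Complex.I / 2)) * Complex.I ^ m *
      halfMoment (fun x => iteratedDeriv m f (-x)) w) * hsq
  · simp only [Units.val_one, Units.val_neg, Int.cast_neg, Int.cast_one, one_mul, neg_mul,
      neg_neg, one_pow, e2, e3, hneg]
    ring

end

/-! ### Mellin inversion on the line Re s = m + 1/2 -/

section

variable {lam : ℂ} {ℓ : ℤ} {f : ℝ → ℂ}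

theorem exists_bound_mellinPhi (hf : f ∈ lineModel lam ℓ) {m : ℕ} (hm : fourierOrder lam ≤ m)
    (hm2 : 2 ≤ 2 * lam.re + m) (ε : ℤˣ) :
    ∃ C : ℝ, ∀ y : ℝ, ‖mellinPhi lam ℓ ε f (((m + 1 / 2 : ℝ) : ℂ) + y * Complex.I)‖ ≤
      C / (1 + |y|) ^ 2 := by
  obtain ⟨C, hC⟩ := ((symbolDecay_iteratedDeriv hf hm2).comp_unit ε).exists_bound_mellin
  refine ⟨‖(-((ε : ℤ) : ℂ) / (2 * (Real.pi : ℂ) * Complex.I)) ^ m‖ * C, fun y => ?_⟩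
  have h : (((m + 1 / 2 : ℝ) : ℂ) + y * Complex.I) =
      (((1 / 2 : ℝ) : ℂ) + y * Complex.I) + m := by push_cast; ring
  rw [h, ← mellin_genFourier hf hm hm2 ε (by simp) (by simp; norm_num), mellin_genFourier_eq hf hm,
    norm_mul, mul_div_assoc]
  gcongr
  exact hC y

theorem continuous_mellinPhi (hf : f ∈ lineModel lam ℓ) {m : ℕ} (hm : fourierOrder lam ≤ m)
    (hm2 : 2 ≤ 2 * lam.re + m) (ε : ℤˣ) :
    Continuous fun y : ℝ => mellinPhi lam ℓ ε f (((m + 1 / 2 : ℝ) : ℂ) + y * Complex.I) := by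
  have h : ∀ y : ℝ, (((m + 1 / 2 : ℝ) : ℂ) + y * Complex.I) =
      (((1 / 2 : ℝ) : ℂ) + y * Complex.I) + m := fun y => by push_cast; ring
  simp_rw [h]
  simp_rw [fun y : ℝ => (mellin_genFourier hf hm hm2 ε (w := ((1 / 2 : ℝ) : ℂ) + y * Complex.I)
    (by simp) (by simp; norm_num)).symm, mellin_genFourier_eq hf hm]
  refine continuous_const.mul (continuous_iff_continuousAt.2 fun y => ?_)
  have h1 := ((symbolDecay_iteratedDeriv hf hm2).comp_unit ε).differentiableAt_mellin_fourierInt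
    (w := ((1 / 2 : ℝ) : ℂ) + y * Complex.I) (by simp) (by simp; norm_num)
  exact ContinuousAt.comp (f := fun y : ℝ => ((1 / 2 : ℝ) : ℂ) + y * Complex.I)
    h1.continuousAt (by fun_prop)

theorem continuousAt_genFourier (hf : f ∈ lineModel lam ℓ) {t : ℝ} (ht : t ≠ 0) :
    ContinuousAt (genFourier lam f) t := by
  have h1 : ContinuousAt (fun t : ℝ => (-1 / (2 * (Real.pi : ℂ) * Complex.I * (t : ℂ))) ^
      fourierOrder lam * fourierInt (iteratedDeriv (fourierOrder lam) f) t) t := by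
    refine ContinuousAt.mul (ContinuousAt.pow (ContinuousAt.div (by fun_prop) (by fun_prop) ?_) _)
      (continuous_fourierInt (integrable_iteratedDeriv hf le_rfl)).continuousAt
    simp [Real.pi_ne_zero, ht]
  refine h1.congr ?_
  filter_upwards [isOpen_ne.mem_nhds ht] with s hs
  exact (genFourier_eq hf le_rfl hs).symm

/-- Mellin inversion on the translate by m of the line Re w = 1/2. It holds pointwise, since 𝓕f is
continuous away from 0. -/
theorem genFourier_eq_integral (hf : f ∈ lineModel lam ℓ) {m : ℕ} (hm : fourierOrder lam ≤ m)
    (hm2 : 2 ≤ 2 * lam.re + m) (ε : ℤˣ) {x : ℝ} (hx : 0 < x) :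
    genFourier lam f (((ε : ℤ) : ℝ) * x) = (1 / (2 * (Real.pi : ℂ))) *
      ∫ y : ℝ, (x : ℂ) ^ (-(((m + 1 / 2 : ℝ) : ℂ) + y * Complex.I)) *
        mellinPhi lam ℓ ε f (((m + 1 / 2 : ℝ) : ℂ) + y * Complex.I) := by
  have hw : (((m + 1 / 2 : ℝ) : ℂ)) = ((1 / 2 : ℝ) : ℂ) + m := by push_cast; ring
  have hM : ∀ y : ℝ, mellin (fun t => genFourier lam f (((ε : ℤ) : ℝ) * t))
      (((m + 1 / 2 : ℝ) : ℂ) + y * Complex.I) =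
      mellinPhi lam ℓ ε f (((m + 1 / 2 : ℝ) : ℂ) + y * Complex.I) := fun y => by
    rw [show (((m + 1 / 2 : ℝ) : ℂ) + y * Complex.I) =
      (((1 / 2 : ℝ) : ℂ) + y * Complex.I) + m by push_cast; ring]
    exact mellin_genFourier hf hm hm2 ε (by simp) (by simp; norm_num)
  have hc : MellinConvergent (fun t => genFourier lam f (((ε : ℤ) : ℝ) * t))
      ((m + 1 / 2 : ℝ) : ℂ) := by
    rw [hw]
    exact mellinConvergent_genFourier hf hm hm2 ε (by simp) (by simp; norm_num)
  obtain ⟨C, hC⟩ := exists_bound_mellinPhi hf hm hm2 ε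
  have hv : Complex.VerticalIntegrable
      (mellin (fun t => genFourier lam f (((ε : ℤ) : ℝ) * t))) (m + 1 / 2 : ℝ) := by
    have := integrable_of_le_inv_sq (continuous_mellinPhi hf hm hm2 ε) hC
    refine this.congr (Eventually.of_forall fun y => ?_)
    exact (hM y).symm
  have hε : (((ε : ℤ) : ℝ) * x) ≠ 0 := by
    rcases Int.units_eq_one_or ε with rfl | rfl <;> simp [hx.ne']
  have hinv := mellinInv_mellin_eq (m + 1 / 2 : ℝ) (fun t => genFourier lam f (((ε : ℤ) : ℝ) * t))
    hx hc hv (ContinuousAt.comp (g := genFourier lam f) (continuousAt_genFourier hf hε)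
      (by fun_prop))
  rw [← hinv, mellinInv]
  simp only [hM, smul_eq_mul, Complex.real_smul]
  push_cast
  rfl

end

/-! ### From Dirichlet series to sums over the integers -/

section

variable {lam : ℂ} {ℓ : ℤ} {f : ℝ → ℂ}

theorem term_succ_mul_cpow (a : ℕ → ℂ) (s : ℂ) (M n : ℕ) :
    a (n + 1) * ((((n + 1 : ℕ) : ℝ) / (M : ℝ) : ℝ) : ℂ) ^ (-s) =
      (M : ℂ) ^ s * LSeries.term a s (n + 1) := by
  have h1 : ((((n + 1 : ℕ) : ℝ) / (M : ℝ) : ℝ) : ℂ) ^ (-s) =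
      ((n + 1 : ℕ) : ℂ) ^ (-s) / (M : ℂ) ^ (-s) := by
    have := Complex.div_cpow_ofReal_nonneg (a := ((n + 1 : ℕ) : ℝ)) (b := (M : ℝ))
      (Nat.cast_nonneg _) (Nat.cast_nonneg _) (-s)
    push_cast at this ⊢
    exact this
  rw [h1, LSeries.term_of_ne_zero (Nat.succ_ne_zero n), Complex.cpow_neg, Complex.cpow_neg]
  field_simp

/-- On a vertical line the modulus of a Dirichlet term does not depend on y. Absolute convergence at
the abscissa and integrability of `mellinPhi` therefore justify integrating term by term. -/
theorem hasSum_genFourier (hf : f ∈ lineModel lam ℓ) {m : ℕ} (hm : fourierOrder lam ≤ m)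
    (hm2 : 2 ≤ 2 * lam.re + m) (ε : ℤˣ) {M : ℕ} (hM : 0 < M) (a : ℕ → ℂ)
    (hs : LSeriesSummable a ((m + 1 / 2 : ℝ) : ℂ)) :
    HasSum (fun n : ℕ => a (n + 1) *
        genFourier lam f (((ε : ℤ) : ℝ) * (((n + 1 : ℕ) : ℝ) / (M : ℝ))))
      (1 / (2 * (Real.pi : ℂ)) * ∫ y : ℝ,
        (M : ℂ) ^ (((m + 1 / 2 : ℝ) : ℂ) + y * Complex.I) *
          LSeries a (((m + 1 / 2 : ℝ) : ℂ) + y * Complex.I) *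
          mellinPhi lam ℓ ε f (((m + 1 / 2 : ℝ) : ℂ) + y * Complex.I)) := by
  have hMR : (0 : ℝ) < M := by exact_mod_cast hM
  set σ : ℝ := m + 1 / 2 with hσ
  set s : ℝ → ℂ := fun y => (σ : ℂ) + y * Complex.I with hsdef
  have hre : ∀ y, (s y).re = σ := fun y => by simp [hsdef]
  obtain ⟨C, hC⟩ := exists_bound_mellinPhi hf hm hm2 ε
  have hint : MeasureTheory.Integrable fun y => mellinPhi lam ℓ ε f (s y) :=
    integrable_of_le_inv_sq (continuous_mellinPhi hf hm hm2 ε) hC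
  have hx : ∀ n : ℕ, 0 < (((n + 1 : ℕ) : ℝ) / (M : ℝ)) := fun n => by positivity
  set F : ℕ → ℝ → ℂ := fun n y => (M : ℂ) ^ (s y) * LSeries.term a (s y) (n + 1) *
    mellinPhi lam ℓ ε f (s y) with hF
  have hFx : ∀ n y, F n y = a (n + 1) * (((((n + 1 : ℕ) : ℝ) / (M : ℝ) : ℝ) : ℂ) ^ (-(s y)) *
      mellinPhi lam ℓ ε f (s y)) := fun n y => by
    rw [← mul_assoc, term_succ_mul_cpow]
  have hnorm : ∀ n y, ‖F n y‖ = (M : ℝ) ^ σ * ‖LSeries.term a (σ : ℂ) (n + 1)‖ *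
      ‖mellinPhi lam ℓ ε f (s y)‖ := fun n y => by
    have h1 : ‖(M : ℂ) ^ (s y)‖ = (M : ℝ) ^ σ := by
      rw [Complex.norm_natCast_cpow_of_pos hM, hre]
    have h2 : ‖LSeries.term a (s y) (n + 1)‖ = ‖LSeries.term a (σ : ℂ) (n + 1)‖ := by
      rw [LSeries.norm_term_eq, LSeries.norm_term_eq, hre, Complex.ofReal_re]
    rw [hF]
    simp only [norm_mul, h1, h2]
  have hcont : ∀ n, Continuous (F n) := fun n => by
    simp_rw [funext (hFx n)]
    refine continuous_const.mul (Continuous.mul ?_ (continuous_mellinPhi hf hm hm2 ε))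
    refine Continuous.const_cpow (by fun_prop) (Or.inl ?_)
    exact_mod_cast (hx n).ne'
  have hFint : ∀ n, MeasureTheory.Integrable (F n) := fun n =>
    (hint.norm.const_mul ((M : ℝ) ^ σ * ‖LSeries.term a (σ : ℂ) (n + 1)‖)).mono'
      (hcont n).aestronglyMeasurable (Eventually.of_forall fun y => (hnorm n y).le)
  have hsum : Summable fun n => ∫ y, ‖F n y‖ := by
    simp_rw [hnorm, MeasureTheory.integral_const_mul]
    refine Summable.mul_right _ (Summable.mul_left _ ?_)
    exact (summable_nat_add_iff 1).2 (Summable.norm hs)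
  have key := (MeasureTheory.hasSum_integral_of_summable_integral_norm hFint hsum).mul_left
    (1 / (2 * (Real.pi : ℂ)))
  have hts : ∀ y, ∑' n, F n y = (M : ℂ) ^ (s y) * LSeries a (s y) * mellinPhi lam ℓ ε f (s y) := by
    intro y
    have h1 : LSeriesSummable a (s y) := hs.of_re_le_re (by simp [hre])
    rw [hF]
    simp only
    rw [tsum_mul_right, tsum_mul_left, LSeries, h1.tsum_eq_zero_add, LSeries.term_zero, zero_add]
  simp only [hts] at key
  have hfun : (fun n => 1 / (2 * (Real.pi : ℂ)) * ∫ y, F n y) = fun n => a (n + 1) *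
      genFourier lam f (((ε : ℤ) : ℝ) * (((n + 1 : ℕ) : ℝ) / (M : ℝ))) := by
    funext n
    have h2 : ∫ y, F n y = _ := MeasureTheory.integral_congr_ae (Eventually.of_forall (hFx n))
    rw [h2, MeasureTheory.integral_const_mul, genFourier_eq_integral hf hm hm2 ε (hx n)]
    ring
  rwa [hfun] at key

end

/-- `(2π)^{-s} Γ(s) (e^{επis/2} ξ_+(s) + e^{-επis/2} ξ_-(s))`. -/
def gammaL (ξ : ℤˣ → ℂ → ℂ) (ε : ℤˣ) (s : ℂ) : ℂ :=
  (2 * (Real.pi : ℂ)) ^ (-s) * Complex.Gamma s *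
    (Complex.exp (((ε : ℤ) : ℂ) * (Real.pi * s * Complex.I / 2)) * ξ 1 s +
      Complex.exp (-(((ε : ℤ) : ℂ) * (Real.pi * s * Complex.I / 2))) * ξ (-1) s)

/-- The integrand of the contour integral that represents `∑ α(n) 𝓕 f(n)`. -/
def pairing (lam : ℂ) (ℓ : ℤ) (ξ : ℤˣ → ℂ → ℂ) (f : ℝ → ℂ) (s : ℂ) : ℂ :=
  mellinPhi lam ℓ 1 f s * ξ 1 s + mellinPhi lam ℓ (-1) f s * ξ (-1) s

/-- Both sides group the bilinear form Φᵀ γ(s) ξ; the symmetry of γ allows either grouping. The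
first one comes from the Fourier sums, the second is the one to which [A3] applies. -/
theorem pairing_eq (lam : ℂ) (ℓ : ℤ) (ξ : ℤˣ → ℂ → ℂ) (f : ℝ → ℂ) (s : ℂ) :
    pairing lam ℓ ξ f s = localPhi lam ℓ 1 f (1 - s) * gammaL ξ 1 s +
      localPhi lam ℓ (-1) f (1 - s) * gammaL ξ (-1) s := by
  simp only [pairing, mellinPhi, gammaL, Units.val_one, Units.val_neg, Int.cast_neg, Int.cast_one,
    one_mul, neg_mul, neg_neg]
  ring

section

variable {lam : ℂ} {ℓ : ℤ} {f : ℝ → ℂ} {ξ : ℤˣ → ℂ → ℂ} {α : ℤ → ℂ}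

theorem norm_LSeries_le (a : ℕ → ℂ) {s : ℂ} {σ : ℝ} (hs : LSeriesSummable a (σ : ℂ))
    (h : s.re = σ) : ‖LSeries a s‖ ≤ ∑' n, ‖LSeries.term a (σ : ℂ) n‖ := by
  have h2 : ∀ n, ‖LSeries.term a s n‖ = ‖LSeries.term a (σ : ℂ) n‖ := fun n => by
    rw [LSeries.norm_term_eq, LSeries.norm_term_eq, h, Complex.ofReal_re]
  simp_rw [← h2]
  exact norm_tsum_le_tsum_norm (Summable.norm (hs.of_re_le_re (by simp [h])))

theorem exists_bound_pairing_line (hf : f ∈ lineModel lam ℓ) {m : ℕ} (hm : fourierOrder lam ≤ m)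
    (hm2 : 2 ≤ 2 * lam.re + m)
    (hs : ∀ ε : ℤˣ, LSeriesSummable (fun n : ℕ => α ((ε : ℤ) * (n : ℤ))) ((m + 1 / 2 : ℝ) : ℂ))
    (hξ : ∀ (ε : ℤˣ) (s : ℂ), s.re = m + 1 / 2 →
      ξ ε s = LSeries (fun n : ℕ => α ((ε : ℤ) * (n : ℤ))) s) :
    ∃ C : ℝ, ∀ s : ℂ, s.re = m + 1 / 2 → ‖pairing lam ℓ ξ f s‖ ≤ C / (1 + |s.im|) ^ 2 := by
  have key : ∀ ε : ℤˣ, ∃ C : ℝ, ∀ s : ℂ, s.re = m + 1 / 2 →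
      ‖mellinPhi lam ℓ ε f s * ξ ε s‖ ≤ C / (1 + |s.im|) ^ 2 := fun ε => by
    obtain ⟨C, hC⟩ := exists_bound_mellinPhi hf hm hm2 ε
    refine ⟨C * ∑' n, ‖LSeries.term (fun n : ℕ => α ((ε : ℤ) * (n : ℤ)))
      ((m + 1 / 2 : ℝ) : ℂ) n‖, fun s h => ?_⟩
    have h1 := hC s.im
    rw [← h, Complex.re_add_im] at h1
    rw [norm_mul, hξ ε s h, mul_div_right_comm]
    exact mul_le_mul h1 (norm_LSeries_le _ (hs ε) h) (norm_nonneg _) ((norm_nonneg _).trans h1)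
  obtain ⟨C, hC⟩ := key 1
  obtain ⟨D, hD⟩ := key (-1)
  exact ⟨C + D, fun s h => (norm_add_le _ _).trans (by rw [add_div]; exact add_le_add (hC s h) (hD s h))⟩

theorem hasSum_int_genFourier (hf : f ∈ lineModel lam ℓ) {m : ℕ} (hm : fourierOrder lam ≤ m)
    (hm2 : 2 ≤ 2 * lam.re + m) {M : ℕ} (hM : 0 < M)
    (hs : ∀ ε : ℤˣ, LSeriesSummable (fun n : ℕ => α ((ε : ℤ) * (n : ℤ))) ((m + 1 / 2 : ℝ) : ℂ))
    (hξ : ∀ (ε : ℤˣ) (s : ℂ), s.re = m + 1 / 2 →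
      ξ ε s = LSeries (fun n : ℕ => α ((ε : ℤ) * (n : ℤ))) s)
    (hc : ∀ (ε : ℤˣ) (s : ℂ), s.re = m + 1 / 2 → ContinuousAt (ξ ε) s) (a₀ : ℂ) :
    HasSum (fun n : ℤ => Function.update α 0 a₀ n * genFourier lam f ((n : ℝ) / (M : ℝ)))
      (a₀ * genFourier lam f 0 + 1 / (2 * (Real.pi : ℂ)) * ∫ y : ℝ,
        (M : ℂ) ^ (((m + 1 / 2 : ℝ) : ℂ) + y * Complex.I) *
          pairing lam ℓ ξ f (((m + 1 / 2 : ℝ) : ℂ) + y * Complex.I)) := by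
  have hre : ∀ y : ℝ, (((m + 1 / 2 : ℝ) : ℂ) + y * Complex.I).re = m + 1 / 2 := fun y => by simp
  have hMc : (M : ℂ) ≠ 0 := by exact_mod_cast hM.ne'
  have hint : ∀ ε : ℤˣ, MeasureTheory.Integrable fun y : ℝ =>
      (M : ℂ) ^ (((m + 1 / 2 : ℝ) : ℂ) + y * Complex.I) *
        ξ ε (((m + 1 / 2 : ℝ) : ℂ) + y * Complex.I) *
        mellinPhi lam ℓ ε f (((m + 1 / 2 : ℝ) : ℂ) + y * Complex.I) := fun ε => by
    obtain ⟨C, hC⟩ := exists_bound_mellinPhi hf hm hm2 ε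
    refine MeasureTheory.Integrable.bdd_mul (c := (M : ℝ) ^ (m + 1 / 2 : ℝ) *
      ∑' n, ‖LSeries.term (fun n : ℕ => α ((ε : ℤ) * (n : ℤ))) ((m + 1 / 2 : ℝ) : ℂ) n‖)
      (integrable_of_le_inv_sq (continuous_mellinPhi hf hm hm2 ε) hC)
      (Continuous.aestronglyMeasurable (Continuous.mul ?_ ?_)) (Eventually.of_forall fun y => ?_)
    · exact Continuous.const_cpow (by fun_prop) (Or.inl hMc)
    · exact continuous_iff_continuousAt.2 fun y => ContinuousAt.comp
        (f := fun y : ℝ => ((m + 1 / 2 : ℝ) : ℂ) + y * Complex.I) (hc ε _ (hre y)) (by fun_prop)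
    · rw [norm_mul, Complex.norm_natCast_cpow_of_pos hM, hre, hξ ε _ (hre y)]
      gcongr
      exact norm_LSeries_le _ (hs ε) (hre y)
  have hone : ∀ ε : ℤˣ, HasSum (fun n : ℕ => α ((ε : ℤ) * ((n + 1 : ℕ) : ℤ)) *
        genFourier lam f (((ε : ℤ) : ℝ) * (((n + 1 : ℕ) : ℝ) / (M : ℝ))))
      (1 / (2 * (Real.pi : ℂ)) * ∫ y : ℝ, (M : ℂ) ^ (((m + 1 / 2 : ℝ) : ℂ) + y * Complex.I) *
        ξ ε (((m + 1 / 2 : ℝ) : ℂ) + y * Complex.I) *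
        mellinPhi lam ℓ ε f (((m + 1 / 2 : ℝ) : ℂ) + y * Complex.I)) := fun ε => by
    have := hasSum_genFourier hf hm hm2 ε hM (fun n : ℕ => α ((ε : ℤ) * (n : ℤ))) (hs ε)
    simpa only [hξ ε _ (hre _)] using this
  have hpos := hone 1
  have hneg := hone (-1)
  set F : ℤ → ℂ := fun n => Function.update α 0 a₀ n * genFourier lam f ((n : ℝ) / (M : ℝ))
  have hF0 : F 0 = a₀ * genFourier lam f 0 := by simp [F]
  have hFpos : (fun n : ℕ => α (((1 : ℤˣ) : ℤ) * ((n + 1 : ℕ) : ℤ)) *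
      genFourier lam f ((((1 : ℤˣ) : ℤ) : ℝ) * (((n + 1 : ℕ) : ℝ) / (M : ℝ)))) =
      fun n : ℕ => F ((n + 1 : ℕ) : ℤ) := by
    funext n
    have h0 : ((n + 1 : ℕ) : ℤ) ≠ 0 := by positivity
    simp only [F]
    rw [Function.update_of_ne h0]
    push_cast
    simp
  have hFneg : (fun n : ℕ => α (((-1 : ℤˣ) : ℤ) * ((n + 1 : ℕ) : ℤ)) *
      genFourier lam f ((((-1 : ℤˣ) : ℤ) : ℝ) * (((n + 1 : ℕ) : ℝ) / (M : ℝ)))) =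
      fun n : ℕ => F (-((n : ℤ) + 1)) := by
    funext n
    have h0 : -((n : ℤ) + 1) ≠ 0 := by omega
    simp only [F]
    rw [Function.update_of_ne h0]
    push_cast
    congr 2 <;> ring
  rw [hFpos] at hpos
  rw [hFneg] at hneg
  have key := ((hasSum_nat_add_iff (f := fun n : ℕ => F n) 1).1 hpos).of_nat_of_neg_add_one hneg
  rw [Finset.sum_range_one, Nat.cast_zero, hF0, add_right_comm, ← mul_add,
    ← MeasureTheory.integral_add (hint 1) (hint (-1)), add_comm] at key
  simpa only [pairing, mul_add, mul_assoc, mul_comm, mul_left_comm] using key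

end

/-! ### Poles of the integrand -/

theorem RegAt.regAt_mul_hasResAt {F G : ℂ → ℂ} {p v r : ℂ} (h : RegAt F p v)
    (h' : HasResAt G p r) : HasResAt (fun s => F s * G s) p (v * r) :=
  HasResAt.regAt_mul h h'

/-- A zero of the analytic factor cancels the simple pole; the derivative at the zero times the
residue is the value left over. -/
theorem HasResAt.regAt_of_zero {D F : ℂ → ℂ} {p d r : ℂ} (hD : AnalyticAt ℂ D p) (h0 : D p = 0)
    (hd : HasDerivAt D d p) (h : HasResAt F p r) : RegAt (fun s => D s * F s) p (d * r) := by
  obtain ⟨P, hP⟩ := hD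
  have h1 : RegAt (dslope D p) p d :=
    AnalyticAt.regAt' ⟨_, hP.has_fpower_series_dslope_fslope⟩ (by rw [dslope_same, hd.deriv])
  refine (RegAt.mul h1 h).congr ?_
  filter_upwards [self_mem_nhdsWithin] with s hs
  have hs' : s - p ≠ 0 := sub_ne_zero.2 hs
  rw [dslope_of_ne _ hs, slope_def_field, h0, sub_zero]
  field_simp

theorem analyticAt_Gamma {s : ℂ} (hs : ∀ k : ℕ, s ≠ -(k : ℂ)) : AnalyticAt ℂ Complex.Gamma s := by
  have h := (Complex.differentiable_one_div_Gamma.analyticAt s).inv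
    (inv_ne_zero (Complex.Gamma_ne_zero hs))
  refine h.congr (Eventually.of_forall fun z => ?_)
  simp

theorem hasResAt_Gamma_zero : HasResAt Complex.Gamma 0 1 := by
  have h1 : AnalyticAt ℂ (fun s => Complex.Gamma (s + 1)) 0 :=
    (analyticAt_Gamma (s := 1) fun k hk => by
      have := congrArg Complex.re hk
      simp at this
      linarith [(Nat.cast_nonneg k : (0 : ℝ) ≤ k)]).fun_comp_of_eq (by fun_prop) (by simp)
  refine (h1.regAt' (by simp)).congr ?_
  filter_upwards [self_mem_nhdsWithin] with s hs
  rw [Complex.Gamma_add_one _ hs, sub_zero]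

theorem exists_hasResAt_Gamma (k : ℕ) : ∃ r, HasResAt Complex.Gamma (-(k : ℂ)) r := by
  induction k with
  | zero => exact ⟨1, by simpa using hasResAt_Gamma_zero⟩
  | succ k ih =>
    obtain ⟨r, hr⟩ := ih
    have h1 : HasResAt (fun s => Complex.Gamma (0 - s)) (k : ℂ) (-r) :=
      HasResAt.comp_sub (by simpa using hr)
    -- Two reflections compose to the translation s ↦ s + 1, which the recursion Γ(s) = Γ(s+1)/s
    -- needs.
    have h2 : HasResAt (fun s => Complex.Gamma (0 - (-1 - s))) (-((k + 1 : ℕ) : ℂ)) (- -r) :=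
      HasResAt.comp_sub (F := fun s => Complex.Gamma (0 - s)) (by
        rwa [show (-1 : ℂ) - -((k + 1 : ℕ) : ℂ) = k by push_cast; ring])
    have hk : (-((k + 1 : ℕ) : ℂ)) ≠ 0 := neg_ne_zero.2 (by exact_mod_cast Nat.succ_ne_zero k)
    have h3 : AnalyticAt ℂ (fun s : ℂ => s⁻¹) (-((k + 1 : ℕ) : ℂ)) := analyticAt_id.inv hk
    refine ⟨_, (h2.mul_regAt h3.regAt).congr ?_⟩
    filter_upwards [eventually_nhdsWithin_of_eventually_nhds (isOpen_ne.mem_nhds hk)] with s hs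
    rw [show (0 : ℂ) - (-1 - s) = s + 1 by ring, Complex.Gamma_add_one _ hs]
    have : s ≠ 0 := hs
    field_simp

/-- The poles of `ξ_±`, with the symmetry of the residues at `1`. -/
structure PoleData (lam : ℂ) (ξ : ℤˣ → ℂ → ℂ) : Prop where
  analyticAt : ∀ ε s, s ≠ 1 → s ≠ 2 - 2 * lam → AnalyticAt ℂ (ξ ε) s
  one : ∀ ε, HasResAt (ξ ε) 1 (simpleResidue (ξ 1) 1)
  reflected : ∀ ε, HasResAt (ξ ε) (2 - 2 * lam) (simpleResidue (ξ ε) (2 - 2 * lam))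

theorem differentiable_two_pi_cpow : Differentiable ℂ fun s : ℂ => (2 * (Real.pi : ℂ)) ^ (-s) :=
  fun s => (differentiable_neg s).const_cpow (Or.inl (by simp [Real.pi_ne_zero]))

theorem analyticAt_gammaFactor {s : ℂ} (hs : ∀ k : ℕ, s ≠ -(k : ℂ)) :
    AnalyticAt ℂ (fun s : ℂ => (2 * (Real.pi : ℂ)) ^ (-s) * Complex.Gamma s) s :=
  (differentiable_two_pi_cpow.analyticAt s).mul (analyticAt_Gamma hs)

/-- `e^{επis/2} ξ_+(s) + e^{-επis/2} ξ_-(s)`. -/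
def expPart (ξ : ℤˣ → ℂ → ℂ) (ε : ℤˣ) (s : ℂ) : ℂ :=
  Complex.exp (((ε : ℤ) : ℂ) * (Real.pi * s * Complex.I / 2)) * ξ 1 s +
    Complex.exp (-(((ε : ℤ) : ℂ) * (Real.pi * s * Complex.I / 2))) * ξ (-1) s

theorem analyticAt_exp_unit (ε : ℤˣ) (s : ℂ) :
    AnalyticAt ℂ (fun s : ℂ => Complex.exp (((ε : ℤ) : ℂ) * (Real.pi * s * Complex.I / 2))) s := by
  fun_prop

theorem analyticAt_exp_neg_unit (ε : ℤˣ) (s : ℂ) :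
    AnalyticAt ℂ (fun s : ℂ => Complex.exp (-(((ε : ℤ) : ℂ) * (Real.pi * s * Complex.I / 2)))) s := by
  fun_prop

theorem exp_pi_nat (n : ℕ) : Complex.exp (Real.pi * n * Complex.I / 2) = Complex.I ^ n := by
  rw [show (Real.pi : ℂ) * n * Complex.I / 2 = n * (Real.pi / 2 * Complex.I) by ring,
    Complex.exp_nat_mul, Complex.exp_pi_div_two_mul_I]

theorem exp_neg_pi_nat (n : ℕ) :
    Complex.exp (-(Real.pi * n * Complex.I / 2)) = (-Complex.I) ^ n := by
  rw [Complex.exp_neg, exp_pi_nat, ← inv_pow, Complex.inv_I]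

theorem exp_unit_nat (ε : ℤˣ) (n : ℕ) :
    Complex.exp (((ε : ℤ) : ℂ) * (Real.pi * n * Complex.I / 2)) =
      (((ε : ℤ) : ℂ) * Complex.I) ^ n := by
  rcases Int.units_eq_one_or ε with rfl | rfl
  · simpa using exp_pi_nat n
  · simpa using exp_neg_pi_nat n

theorem exp_neg_unit_nat (ε : ℤˣ) (n : ℕ) :
    Complex.exp (-(((ε : ℤ) : ℂ) * (Real.pi * n * Complex.I / 2))) =
      (-(((ε : ℤ) : ℂ) * Complex.I)) ^ n := by
  have := exp_unit_nat (-ε) n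
  simpa using this

section

variable {lam : ℂ} {ξ : ℤˣ → ℂ → ℂ}

theorem HasResAt.expPart {p : ℂ} {r : ℤˣ → ℂ} (h : ∀ ε, HasResAt (ξ ε) p (r ε)) (ε : ℤˣ) :
    HasResAt (expPart ξ ε) p
      (Complex.exp (((ε : ℤ) : ℂ) * (Real.pi * p * Complex.I / 2)) * r 1 +
        Complex.exp (-(((ε : ℤ) : ℂ) * (Real.pi * p * Complex.I / 2))) * r (-1)) :=
  ((analyticAt_exp_unit ε p).regAt.regAt_mul_hasResAt (h 1)).add
    ((analyticAt_exp_neg_unit ε p).regAt.regAt_mul_hasResAt (h (-1)))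

theorem analyticAt_expPart {s : ℂ} (h : ∀ ε, AnalyticAt ℂ (ξ ε) s) (ε : ℤˣ) :
    AnalyticAt ℂ (expPart ξ ε) s :=
  ((analyticAt_exp_unit ε s).mul (h 1)).add ((analyticAt_exp_neg_unit ε s).mul (h (-1)))

theorem analyticAt_gammaL {s : ℂ} (h : ∀ ε, AnalyticAt ℂ (ξ ε) s) (hs : ∀ k : ℕ, s ≠ -(k : ℂ))
    (ε : ℤˣ) : AnalyticAt ℂ (gammaL ξ ε) s :=
  (analyticAt_gammaFactor hs).mul (analyticAt_expPart h ε)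

theorem one_ne_neg_nat (k : ℕ) : (1 : ℂ) ≠ -(k : ℂ) := fun hk => by
  have := congrArg Complex.re hk
  simp at this
  linarith [(Nat.cast_nonneg k : (0 : ℝ) ≤ k)]

theorem expPart_add (s : ℂ) : expPart ξ 1 s + expPart ξ (-1) s =
    (Complex.exp (Real.pi * s * Complex.I / 2) + Complex.exp (-(Real.pi * s * Complex.I / 2))) *
      (ξ 1 s + ξ (-1) s) := by
  simp only [expPart, Units.val_one, Units.val_neg, Int.cast_neg, Int.cast_one, one_mul, neg_mul,
    neg_neg]
  ring

theorem expPart_sub (s : ℂ) : expPart ξ 1 s - expPart ξ (-1) s =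
    (Complex.exp (Real.pi * s * Complex.I / 2) - Complex.exp (-(Real.pi * s * Complex.I / 2))) *
      (ξ 1 s - ξ (-1) s) := by
  simp only [expPart, Units.val_one, Units.val_neg, Int.cast_neg, Int.cast_one, one_mul, neg_mul,
    neg_neg]
  ring

theorem hasDerivAt_exp_pi (c s : ℂ) : HasDerivAt (fun s : ℂ => Complex.exp (c * s * Complex.I / 2))
    (Complex.exp (c * s * Complex.I / 2) * (c * Complex.I / 2)) s := by
  have h : HasDerivAt (fun s : ℂ => c * s * Complex.I / 2) (c * 1 * Complex.I / 2) s :=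
    (((hasDerivAt_id s).const_mul c).mul_const _).div_const _
  rw [mul_one] at h
  exact h.cexp

theorem hasDerivAt_exp_neg_pi (c s : ℂ) :
    HasDerivAt (fun s : ℂ => Complex.exp (-(c * s * Complex.I / 2)))
    (-(Complex.exp (-(c * s * Complex.I / 2)) * (c * Complex.I / 2))) s := by
  have h := hasDerivAt_exp_pi (-c) s
  have e : ∀ s : ℂ, -c * s * Complex.I / 2 = -(c * s * Complex.I / 2) := fun s => by ring
  simp only [e] at h
  convert h using 1
  ring

/-- The poles of `ξ_±` at `s = 1` cancel in `gammaL`. -/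
theorem PoleData.regAt_gammaL_one (hp : PoleData lam ξ) : ∃ v : ℤˣ → ℂ,
    (∀ ε, RegAt (gammaL ξ ε) 1 (v ε)) ∧ v 1 + v (-1) = -simpleResidue (ξ 1) 1 := by
  set r := simpleResidue (ξ 1) 1 with hr
  -- At s = 1 the two exponentials are εi and -εi, so the equal residues of ξ_± cancel.
  have hB : ∀ ε, ∃ w, RegAt (expPart ξ ε) 1 w := fun ε => by
    refine RegAt.exists_of_value_zero ((HasResAt.expPart hp.one ε).value_eq ?_)
    have h1 := exp_unit_nat ε 1
    have h2 := exp_neg_unit_nat ε 1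
    rw [Nat.cast_one] at h1 h2
    rw [h1, h2]
    ring
  choose w hw using hB
  have hc := (analyticAt_gammaFactor one_ne_neg_nat).regAt
  refine ⟨_, fun ε => hc.mul (hw ε), ?_⟩
  have e1 := exp_pi_nat 1
  have e2 := exp_neg_pi_nat 1
  rw [Nat.cast_one, pow_one] at e1 e2
  -- The individual values at 1 are not determined by the residues, but the sum carries the factor
  -- 2cos(πs/2), which vanishes at 1 with derivative -π. Division by 2π then leaves minus the
  -- residue.
  have hsum : RegAt (fun s => expPart ξ 1 s + expPart ξ (-1) s) 1 (-Real.pi * (r + r)) := by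
    simp_rw [expPart_add]
    refine HasResAt.regAt_of_zero (by fun_prop) ?_ ?_ ((hp.one 1).add (hp.one (-1)))
    · rw [e1, e2]; ring
    · refine ((hasDerivAt_exp_pi Real.pi 1).add (hasDerivAt_exp_neg_pi Real.pi 1)).congr_deriv ?_
      rw [e1, e2]
      linear_combination (Real.pi : ℂ) * Complex.I_sq
  have hval := ((hw 1).add (hw (-1))).unique hsum
  have hpi : (Real.pi : ℂ) ≠ 0 := by exact_mod_cast Real.pi_ne_zero
  rw [← mul_add, hval, Complex.Gamma_one, Complex.cpow_neg_one]
  field_simp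
  ring

/-- At the integer s = 1 + k the exponentials are i^{k+1} and (-i)^{k+1}, so the rows of γ are
proportional with ratio -(-1)^k. No property of ξ enters. -/
theorem gammaL_one_add_nat (ξ : ℤˣ → ℂ → ℂ) (k : ℕ) :
    gammaL ξ 1 (1 + k) + (-1) ^ k * gammaL ξ (-1) (1 + k) = 0 := by
  have h1 := exp_pi_nat (k + 1)
  have h2 := exp_neg_pi_nat (k + 1)
  rw [show (((k + 1 : ℕ) : ℂ)) = 1 + k by push_cast; ring] at h1 h2
  have h3 : (-Complex.I) ^ (k + 1) = (-1) ^ (k + 1) * Complex.I ^ (k + 1) := by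
    rw [← mul_pow]; ring
  have h4 : ((-1 : ℂ) ^ k) * (-1) ^ k = 1 := by rw [← mul_pow]; simp
  simp only [gammaL, Units.val_one, Units.val_neg, Int.cast_neg, Int.cast_one, one_mul, neg_mul,
    neg_neg, h1, h2, h3, pow_succ (-1 : ℂ)]
  linear_combination (-(2 * (Real.pi : ℂ)) ^ (-(1 + (k : ℂ))) * Complex.Gamma (1 + k) *
    Complex.I ^ (k + 1) * ξ 1 (1 + k)) * h4

theorem PoleData.hasResAt_gammaL_zero (hp : PoleData lam ξ) (h : lam ≠ 1) (ε : ℤˣ) :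
    HasResAt (gammaL ξ ε) 0 (evenPart ξ 0) := by
  have h1 : ∀ ε, AnalyticAt ℂ (ξ ε) 0 := fun ε => hp.analyticAt ε 0 (by norm_num) fun h0 =>
    h (by linear_combination h0 / 2)
  have h2 := (((differentiable_two_pi_cpow.analyticAt 0).regAt.regAt_mul_hasResAt
    hasResAt_Gamma_zero)).mul_regAt (analyticAt_expPart h1 ε).regAt
  refine h2.value_eq ?_
  simp [expPart, evenPart]

/-- The vanishing condition kills the bracket of exponentials at -k, and with it the residue of the
simple pole of Γ, whose value is not needed. -/
theorem PoleData.hasResAt_gammaL_neg (hp : PoleData lam ξ) {k : ℕ} (h : -(k : ℂ) ≠ 2 - 2 * lam)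
    (h0 : ξ 1 (-(k : ℂ)) + (-1) ^ k * ξ (-1) (-(k : ℂ)) = 0) (ε : ℤˣ) :
    HasResAt (gammaL ξ ε) (-(k : ℂ)) 0 := by
  have h1 : ∀ ε, AnalyticAt ℂ (ξ ε) (-(k : ℂ)) := fun ε =>
    hp.analyticAt ε _ (one_ne_neg_nat k).symm h
  obtain ⟨r, hr⟩ := exists_hasResAt_Gamma k
  have h2 := (((differentiable_two_pi_cpow.analyticAt (-(k : ℂ))).regAt.regAt_mul_hasResAt
    hr)).mul_regAt (analyticAt_expPart h1 ε).regAt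
  refine h2.value_eq ?_
  have e1 : ((ε : ℤ) : ℂ) * (Real.pi * -(k : ℂ) * Complex.I / 2) =
      -(((ε : ℤ) : ℂ) * (Real.pi * k * Complex.I / 2)) := by ring
  have e2 : (-(((ε : ℤ) : ℂ) * Complex.I)) ^ k = (-1) ^ k * (((ε : ℤ) : ℂ) * Complex.I) ^ k := by
    rw [← mul_pow]; ring
  have e3 : ((-1 : ℂ) ^ k) * (-1) ^ k = 1 := by rw [← mul_pow]; simp
  have : expPart ξ ε (-(k : ℂ)) = 0 := by
    rw [expPart, e1, neg_neg, exp_unit_nat, exp_neg_unit_nat, e2]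
    linear_combination ((-1) ^ k * (((ε : ℤ) : ℂ) * Complex.I) ^ k) * h0 -
      (((ε : ℤ) : ℂ) * Complex.I) ^ k * ξ (-1) (-(k : ℂ)) * e3
  rw [this, mul_zero]

/-- For `λ = 1` the double pole at `s = 0` is simple. -/
theorem PoleData.hasResAt_gammaL_zero' (hp : PoleData lam ξ) (h : lam = 1)
    (hres : simpleResidue (evenPart ξ) (2 - 2 * lam) = 0) : ∃ A : ℤˣ → ℂ,
    (∀ ε, HasResAt (gammaL ξ ε) 0 (A ε)) ∧
      A 1 - A (-1) = 2 * Real.pi * Complex.I * simpleResidue (ξ 1) 0 ∧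
      ((∀ ε, AnalyticAt ℂ (ξ ε) 0) → A 1 + A (-1) = 2 * evenPart ξ 0) := by
  have h20 : 2 - 2 * lam = 0 := by rw [h]; norm_num
  have hrfl := hp.reflected
  rw [h20] at hrfl hres
  have hsum : simpleResidue (ξ 1) 0 + simpleResidue (ξ (-1)) 0 = 0 :=
    (((hrfl 1).add (hrfl (-1))).simpleResidue_eq).symm.trans hres
  -- Both exponentials equal 1 at s = 0 and the residues of ξ_± are opposite, so the bracket is
  -- regular and only the simple pole of Γ remains.
  have hB : ∀ ε, ∃ w, RegAt (expPart ξ ε) 0 w := fun ε => by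
    refine RegAt.exists_of_value_zero ((HasResAt.expPart hrfl ε).value_eq ?_)
    simpa using hsum
  choose w hw using hB
  refine ⟨w, fun ε => ?_, ?_, fun han => ?_⟩
  · exact (((differentiable_two_pi_cpow.analyticAt 0).regAt.regAt_mul_hasResAt
      hasResAt_Gamma_zero).mul_regAt (hw ε)).value_eq (by simp)
  · have hd : RegAt (fun s => expPart ξ 1 s + -1 * expPart ξ (-1) s) 0
        ((Real.pi * Complex.I) * (simpleResidue (ξ 1) 0 + -1 * simpleResidue (ξ (-1)) 0)) := by
      have e : ∀ s, expPart ξ 1 s + -1 * expPart ξ (-1) s =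
          (Complex.exp (Real.pi * s * Complex.I / 2) -
            Complex.exp (-(Real.pi * s * Complex.I / 2))) * (ξ 1 s + -1 * ξ (-1) s) := fun s => by
        linear_combination expPart_sub (ξ := ξ) s
      simp_rw [e]
      refine HasResAt.regAt_of_zero (by fun_prop) (by simp) ?_
        ((hrfl 1).add ((hrfl (-1)).const_mul (-1)))
      refine ((hasDerivAt_exp_pi Real.pi 0).sub (hasDerivAt_exp_neg_pi Real.pi 0)).congr_deriv ?_
      simp
    have hval := ((hw 1).add ((hw (-1)).const_mul (-1))).unique hd
    linear_combination hval - (Real.pi * Complex.I) * hsum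
  · have h1 := (hw 1).unique (analyticAt_expPart han 1).regAt
    have h2 := (hw (-1)).unique (analyticAt_expPart han (-1)).regAt
    rw [h1, h2, expPart_add, evenPart, mul_zero, zero_mul, zero_div, neg_zero, Complex.exp_zero]
    ring

end

section

variable {lam : ℂ} {ℓ : ℤ} {f : ℝ → ℂ} {ξ : ℤˣ → ℂ → ℂ}

theorem pairing_eq_fun (lam : ℂ) (ℓ : ℤ) (ξ : ℤˣ → ℂ → ℂ) (f : ℝ → ℂ) :
    pairing lam ℓ ξ f = fun s => localPhi lam ℓ 1 f (1 - s) * gammaL ξ 1 s +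
      localPhi lam ℓ (-1) f (1 - s) * gammaL ξ (-1) s :=
  funext (pairing_eq lam ℓ ξ f)

theorem analyticAt_localPhi_one_sub (hf : f ∈ lineModel lam ℓ) (ε : ℤˣ) {s : ℂ}
    (h1 : ∀ k : ℕ, s ≠ 1 + k) (h4 : ∀ k : ℕ, s ≠ 2 - 2 * lam - 1 - k) :
    AnalyticAt ℂ (fun s => localPhi lam ℓ ε f (1 - s)) s :=
  (analyticAt_localPhi hf ε (s := 1 - s) (fun k hk => h1 k (by linear_combination -hk))
    fun k hk => h4 k (by linear_combination -hk)).fun_comp_of_eq (by fun_prop) rfl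

theorem PoleData.analyticAt_pairing (hp : PoleData lam ξ) (hf : f ∈ lineModel lam ℓ) {s : ℂ}
    (h1 : ∀ k : ℕ, s ≠ 1 + k) (h2 : ∀ k : ℕ, s ≠ -(k : ℂ)) (h3 : s ≠ 2 - 2 * lam)
    (h4 : ∀ k : ℕ, s ≠ 2 - 2 * lam - 1 - k) : AnalyticAt ℂ (pairing lam ℓ ξ f) s := by
  have hξ : ∀ ε, AnalyticAt ℂ (ξ ε) s := fun ε => hp.analyticAt ε s (by simpa using h1 0) h3
  rw [pairing_eq_fun]
  exact ((analyticAt_localPhi_one_sub hf 1 h1 h4).mul (analyticAt_gammaL hξ h2 1)).add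
    ((analyticAt_localPhi_one_sub hf (-1) h1 h4).mul (analyticAt_gammaL hξ h2 (-1)))

theorem hasResAt_localPhi_one_sub (hlam : ∀ k : ℕ, lam ≠ 1 / 2 - (k : ℂ) / 2)
    (hf : f ∈ lineModel lam ℓ) (ε : ℤˣ) (k : ℕ) :
    HasResAt (fun s => localPhi lam ℓ ε f (1 - s)) (1 + k)
      (-(((ε : ℤ) : ℂ) ^ k * iteratedDeriv k f 0 / (k.factorial : ℂ))) := by
  refine HasResAt.comp_sub ?_
  rw [show (1 : ℂ) - (1 + k) = -k by ring]
  refine hasResAt_localPhi hf ε k fun j hj => hlam (k + j + 1) ?_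
  push_cast
  linear_combination -hj / 2

/-- Φ_+(f; 1-s) and Φ_-(f; 1-s) have the same residue -f(0) at s = 1, so only the sum of the two
values of `gammaL` matters, and that is known. -/
theorem PoleData.hasResAt_pairing_one (hp : PoleData lam ξ)
    (hlam : ∀ k : ℕ, lam ≠ 1 / 2 - (k : ℂ) / 2) (hf : f ∈ lineModel lam ℓ) :
    HasResAt (pairing lam ℓ ξ f) 1 (f 0 * simpleResidue (ξ 1) 1) := by
  obtain ⟨v, hv, hsum⟩ := hp.regAt_gammaL_one
  have h := fun ε => hasResAt_localPhi_one_sub hlam hf ε 0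
  simp only [Nat.cast_zero, add_zero, pow_zero, one_mul, iteratedDeriv_zero, Nat.factorial_zero,
    Nat.cast_one, div_one] at h
  rw [pairing_eq_fun]
  refine (((h 1).mul_regAt (hv 1)).add ((h (-1)).mul_regAt (hv (-1)))).value_eq ?_
  linear_combination (-f 0) * hsum

/-- The residues of Φ_±(f; 1-s) at 1 + k differ by the sign (-1)^k, which is the combination
annihilated by `gammaL_one_add_nat`. The hypothesis on λ keeps 1 + k away from the pole 2 - 2λ. -/
theorem PoleData.hasResAt_pairing_one_add (hp : PoleData lam ξ)
    (hlam : ∀ k : ℕ, lam ≠ 1 / 2 - (k : ℂ) / 2) (hf : f ∈ lineModel lam ℓ) {k : ℕ} (hk : k ≠ 0) :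
    HasResAt (pairing lam ℓ ξ f) (1 + k) 0 := by
  have hξ : ∀ ε, AnalyticAt ℂ (ξ ε) (1 + k) := fun ε => hp.analyticAt ε _
    (by simpa using hk) fun h => hlam k (by linear_combination h / 2)
  have hs : ∀ j : ℕ, (1 + k : ℂ) ≠ -(j : ℂ) := fun j hj => one_ne_neg_nat (k + j) (by
    push_cast; linear_combination hj)
  have h := hasResAt_localPhi_one_sub hlam hf
  rw [pairing_eq_fun]
  refine (((h 1 k).mul_regAt (analyticAt_gammaL hξ hs 1).regAt).add
    ((h (-1) k).mul_regAt (analyticAt_gammaL hξ hs (-1)).regAt)).value_eq ?_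
  have := gammaL_one_add_nat ξ k
  simp only [Units.val_one, Units.val_neg, Int.cast_neg, Int.cast_one, one_pow, one_mul]
  linear_combination (-(iteratedDeriv k f 0 / (k.factorial : ℂ))) * this

theorem hasResAt_pairing_of_gammaL (hf : f ∈ lineModel lam ℓ) {s : ℂ} (h1 : ∀ k : ℕ, s ≠ 1 + k)
    (h4 : ∀ k : ℕ, s ≠ 2 - 2 * lam - 1 - k) {A : ℤˣ → ℂ}
    (hA : ∀ ε, HasResAt (gammaL ξ ε) s (A ε)) :
    HasResAt (pairing lam ℓ ξ f) s (localPhi lam ℓ 1 f (1 - s) * A 1 +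
      localPhi lam ℓ (-1) f (1 - s) * A (-1)) := by
  rw [pairing_eq_fun]
  exact ((analyticAt_localPhi_one_sub hf 1 h1 h4).regAt.regAt_mul_hasResAt (hA 1)).add
    ((analyticAt_localPhi_one_sub hf (-1) h1 h4).regAt.regAt_mul_hasResAt (hA (-1)))

theorem zero_ne_one_add_nat (k : ℕ) : (0 : ℂ) ≠ 1 + k := fun h =>
  one_ne_neg_nat k (by linear_combination -h)

/-- The residue of Γ at 0 is multiplied by Φ_+(f; 1) + Φ_-(f; 1), the regularized value of 𝓕f at 0.
-/
theorem PoleData.hasResAt_pairing_zero (hp : PoleData lam ξ)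
    (hlam : ∀ k : ℕ, lam ≠ 1 / 2 - (k : ℂ) / 2) (h1 : lam ≠ 1) (hf : f ∈ lineModel lam ℓ) :
    HasResAt (pairing lam ℓ ξ f) 0 (genFourier lam f 0 * evenPart ξ 0) := by
  refine (hasResAt_pairing_of_gammaL hf zero_ne_one_add_nat
    (fun k hk => hlam k (by linear_combination hk / 2)) (hp.hasResAt_gammaL_zero h1)).value_eq ?_
  rw [genFourier_zero hf hlam, sub_zero]
  ring

/-! ### The functional equation -/

theorem eventually_nhdsNE_of_codiscrete {P : ℂ → Prop} (h : ∀ᶠ s in codiscrete ℂ, P s) (p : ℂ) :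
    ∀ᶠ s in 𝓝[≠] p, P s := by
  have := mem_codiscreteWithin_iff_forall_mem_nhdsNE.1 h p (Set.mem_univ p)
  rw [Set.compl_univ, Set.union_empty] at this
  exact this

variable {N : ℕ} {ξα ξβ : ℤˣ → ℂ → ℂ}

theorem ConditionA3.eventually_gammaL (h : ConditionA3 lam ℓ N ξα ξβ) (p : ℂ) : ∀ᶠ s in 𝓝[≠] p,
    gammaL ξα 1 s = (N : ℂ) ^ (2 - 2 * lam - s) * (Complex.I ^ ℓ *
      gammaL ξβ (-1) (2 - 2 * lam - s)) ∧
    gammaL ξα (-1) s = (N : ℂ) ^ (2 - 2 * lam - s) * gammaL ξβ 1 (2 - 2 * lam - s) := by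
  filter_upwards [eventually_nhdsNE_of_codiscrete h p] with s hs
  have h0 := congrFun hs 0
  have h1 := congrFun hs 1
  simp [gammaMatrix, completedL, sigmaMatrix, Matrix.mulVec, dotProduct, Fin.sum_univ_two] at h0 h1
  simp only [gammaL, Units.val_one, Units.val_neg, Int.cast_neg, Int.cast_one, one_mul,
    neg_mul, neg_neg, neg_sub]
  constructor
  · linear_combination h0
  · linear_combination h1

/-- The swap by Σ(ℓ) in [A3] is the swap of Φ_+ and Φ_- under f ↦ f_∞, with the same factor i^ℓ. -/
theorem ConditionA3.eventually_pairing (h : ConditionA3 lam ℓ N ξα ξβ) (hf : f ∈ lineModel lam ℓ) (p : ℂ) :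
    ∀ᶠ s in 𝓝[≠] p, pairing lam ℓ ξα f s = (N : ℂ) ^ (2 - 2 * lam - s) *
      pairing lam ℓ ξβ (inftyTransform lam ℓ f) (2 - 2 * lam - s) := by
  filter_upwards [h.eventually_gammaL p] with s hs
  rw [pairing_eq, pairing_eq, hs.1, hs.2, localPhi_inftyTransform_one hf,
    localPhi_inftyTransform_neg hf,
    show 2 * lam - (1 - (2 - 2 * lam - s)) = 1 - s by ring]
  ring

theorem differentiable_natCast_cpow (hN : 0 < N) (κ : ℂ) :
    Differentiable ℂ fun s : ℂ => (N : ℂ) ^ (κ - s) := fun s =>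
  ((differentiableAt_const κ).sub differentiableAt_id).const_cpow
    (Or.inl (by exact_mod_cast hN.ne'))

theorem ConditionA3.hasResAt_pairing (h : ConditionA3 lam ℓ N ξα ξβ) (hN : 0 < N)
    (hf : f ∈ lineModel lam ℓ) {p r : ℂ}
    (hr : HasResAt (pairing lam ℓ ξβ (inftyTransform lam ℓ f)) (2 - 2 * lam - p) r) :
    HasResAt (pairing lam ℓ ξα f) p (-((N : ℂ) ^ (2 - 2 * lam - p) * r)) :=
  ((((differentiable_natCast_cpow hN _).analyticAt p).regAt.regAt_mul_hasResAt
    (HasResAt.comp_sub hr)).congr (h.eventually_pairing hf p)).value_eq (by ring)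

/-! ### Consequences of the analytic conditions -/

theorem EntireOfFiniteOrder.analyticAt {F : ℂ → ℂ} (h : EntireOfFiniteOrder lam F) {s : ℂ}
    (h1 : s ≠ 1) (h2 : s ≠ 2 - 2 * lam) : AnalyticAt ℂ F s := by
  obtain ⟨E, hE, hEF, -⟩ := h
  have ha : AnalyticAt ℂ (fun s => E s / ((s - 1) * (s - 2 + 2 * lam))) s :=
    (hE.analyticAt s).div (by fun_prop) (mul_ne_zero (sub_ne_zero.2 h1) fun h0 => h2 (by
      linear_combination h0))
  refine ha.congr ?_
  filter_upwards [isOpen_ne.mem_nhds h1, isOpen_ne.mem_nhds h2] with z hz1 hz2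
  have e1 : z - 1 ≠ 0 := sub_ne_zero.2 hz1
  have e2 : z - 2 + 2 * lam ≠ 0 := fun h0 => hz2 (by linear_combination h0)
  rw [hEF z hz1 hz2]
  field_simp

/-- For λ ≠ 1/2 the points 1 and 2 - 2λ are distinct, so each of the two linear factors accounts for
a simple pole at most. -/
theorem EntireOfFiniteOrder.exists_hasResAt {F : ℂ → ℂ} (h : EntireOfFiniteOrder lam F)
    (hl : lam ≠ 1 / 2) :
    HasResAt F 1 (simpleResidue F 1) ∧
      HasResAt F (2 - 2 * lam) (simpleResidue F (2 - 2 * lam)) := by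
  obtain ⟨E, hE, hEF, -⟩ := h
  have hne : (1 : ℂ) ≠ 2 - 2 * lam := fun h0 => hl (by linear_combination h0 / 2)
  have h1 : ∃ r, HasResAt F 1 r := by
    have ha : AnalyticAt ℂ (fun s => E s / (s - 2 + 2 * lam)) 1 :=
      (hE.analyticAt 1).div (by fun_prop) fun h0 => hne (by linear_combination h0)
    refine ⟨_, ha.regAt.congr ?_⟩
    filter_upwards [self_mem_nhdsWithin,
      eventually_nhdsWithin_of_eventually_nhds (isOpen_ne.mem_nhds hne)] with z hz1 hz2
    have e2 : z - 2 + 2 * lam ≠ 0 := fun h0 => hz2 (by linear_combination h0)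
    rw [hEF z hz1 hz2]
    field_simp
  have h2 : ∃ r, HasResAt F (2 - 2 * lam) r := by
    have ha : AnalyticAt ℂ (fun s => E s / (s - 1)) (2 - 2 * lam) :=
      (hE.analyticAt _).div (by fun_prop) (sub_ne_zero.2 hne.symm)
    refine ⟨_, ha.regAt.congr ?_⟩
    filter_upwards [self_mem_nhdsWithin,
      eventually_nhdsWithin_of_eventually_nhds (isOpen_ne.mem_nhds hne.symm)] with z hz2 hz1
    have e1 : z - 1 ≠ 0 := sub_ne_zero.2 hz1
    rw [hEF z hz1 hz2]
    field_simp
    ring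
  obtain ⟨r, hr⟩ := h1
  obtain ⟨r', hr'⟩ := h2
  exact ⟨hr.simpleResidue_eq.symm ▸ hr, hr'.simpleResidue_eq.symm ▸ hr'⟩

theorem poleData_of_entireOfFiniteOrder (hl : lam ≠ 1 / 2) (h : ∀ ε, EntireOfFiniteOrder lam (ξ ε))
    (h2 : simpleResidue (ξ 1) 1 = simpleResidue (ξ (-1)) 1) : PoleData lam ξ where
  analyticAt ε _ hs1 hs2 := (h ε).analyticAt hs1 hs2
  one ε := by
    have := ((h ε).exists_hasResAt hl).1
    rcases Int.units_eq_one_or ε with rfl | rfl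
    · exact this
    · rwa [h2]
  reflected ε := ((h ε).exists_hasResAt hl).2

theorem PoleData.simpleResidue_evenPart_one (hp : PoleData lam ξ) :
    simpleResidue (evenPart ξ) 1 = 2 * simpleResidue (ξ 1) 1 :=
  (((hp.one 1).add (hp.one (-1))).simpleResidue_eq).trans (by ring)

end

/-! ### Growth of the integrand -/

theorem norm_Gamma_le_Gamma_re {s : ℂ} (hs : 0 < s.re) : ‖Complex.Gamma s‖ ≤ Real.Gamma s.re := by
  rw [Complex.Gamma_eq_integral hs, Real.Gamma_eq_integral hs, Complex.GammaIntegral]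
  refine (MeasureTheory.norm_integral_le_integral_norm _).trans (le_of_eq ?_)
  refine MeasureTheory.setIntegral_congr_fun measurableSet_Ioi fun x hx => ?_
  rw [norm_mul, Complex.norm_cpow_eq_rpow_re_of_pos hx, Complex.norm_real,
    Real.norm_of_nonneg (Real.exp_pos _).le]
  simp

theorem norm_Gamma_le_add_nat {s : ℂ} (hs : 1 ≤ |s.im|) (k : ℕ) :
    ‖Complex.Gamma s‖ ≤ ‖Complex.Gamma (s + k)‖ := by
  induction k with
  | zero => simp
  | succ k ih =>
    have h1 : 1 ≤ ‖s + k‖ := hs.trans (by simpa using Complex.abs_im_le_norm (s + k))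
    have h0 : s + k ≠ 0 := fun h => by rw [h, norm_zero] at h1; linarith
    rw [Nat.cast_succ, ← add_assoc, Complex.Gamma_add_one _ h0, norm_mul]
    exact ih.trans (le_mul_of_one_le_left (norm_nonneg _) h1)

/-- No Stirling estimate is needed: |Γ(s)| ≤ |Γ(s+k)| when |Im s| ≥ 1, and |Γ(s+k)| ≤ Γ(Re s + k) to
the right of 0. -/
theorem exists_bound_Gamma (a b : ℝ) :
    ∃ C : ℝ, ∀ s : ℂ, a ≤ s.re → s.re ≤ b → 1 ≤ |s.im| → ‖Complex.Gamma s‖ ≤ C := by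
  obtain ⟨k, hk⟩ := exists_nat_gt (-a)
  have hc : ContinuousOn Real.Gamma (Set.Icc (a + k) (b + k)) := fun x hx =>
    (Real.differentiableAt_Gamma fun m hm => by
      have h1 := hx.1
      rw [hm] at h1
      linarith [(Nat.cast_nonneg m : (0 : ℝ) ≤ m)]).continuousAt.continuousWithinAt
  obtain ⟨C, hC⟩ := isCompact_Icc.exists_bound_of_continuousOn hc
  refine ⟨C, fun s h1 h2 h3 => (norm_Gamma_le_add_nat h3 k).trans ?_⟩
  have hre : (s + k).re = s.re + k := by simp
  refine (norm_Gamma_le_Gamma_re (by rw [hre]; linarith)).trans ?_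
  rw [hre]
  exact (le_abs_self _).trans (hC _ ⟨by linarith, by linarith⟩)

section

variable {lam : ℂ} {ℓ : ℤ} {f : ℝ → ℂ} {ξ : ℤˣ → ℂ → ℂ} {a b : ℝ}

theorem MildGrowth.two_pi_cpow : MildGrowth a b fun s => (2 * (Real.pi : ℂ)) ^ (-s) := by
  refine MildGrowth.of_bounded (C := (2 * Real.pi) ^ (-a)) (T := 0) fun s h1 _ _ => ?_
  have h2 : (1 : ℝ) ≤ 2 * Real.pi := by linarith [Real.pi_gt_three]
  rw [show (2 * (Real.pi : ℂ)) = ((2 * Real.pi : ℝ) : ℂ) by push_cast; ring,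
    Complex.norm_cpow_eq_rpow_re_of_pos (by linarith)]
  exact Real.rpow_le_rpow_of_exponent_le h2 (by simpa using h1)

theorem MildGrowth.Gamma : MildGrowth a b Complex.Gamma := by
  obtain ⟨C, hC⟩ := exists_bound_Gamma a b
  exact MildGrowth.of_bounded hC

theorem MildGrowth.exp_mul_I (c : ℝ) : MildGrowth a b fun s => Complex.exp (c * s * Complex.I) := by
  refine MildGrowth.of_exp_rpow (A := 1) (B := |c|) (ρ := 1) (T := 0) (abs_nonneg c)
    fun s _ _ _ => ?_
  rw [one_mul, Real.rpow_one, Complex.norm_exp, ← abs_mul]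
  refine Real.exp_le_exp.2 ?_
  have : ((c : ℂ) * s * Complex.I).re = -(c * s.im) := by simp
  rw [this]
  exact neg_le_abs _

theorem MildGrowth.localPhi_one_sub (hf : f ∈ lineModel lam ℓ) (ε : ℤˣ) :
    MildGrowth a b fun s => localPhi lam ℓ ε f (1 - s) := by
  obtain ⟨C, hC⟩ := exists_bound_localPhi hf ε (1 - b) (1 - a)
  refine MildGrowth.of_bounded (C := C) (T := 1 + |2 * lam.im|) fun s h1 h2 h3 => hC _ ?_ ?_ ?_
  · rw [Complex.sub_re, Complex.one_re]; linarith
  · rw [Complex.sub_re, Complex.one_re]; linarith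
  · simpa using h3

theorem MildGrowth.mellinPhi (hf : f ∈ lineModel lam ℓ) (ε : ℤˣ) :
    MildGrowth a b (mellinPhi lam ℓ ε f) := by
  have h1 := MildGrowth.exp_mul_I (a := a) (b := b) (((ε : ℤ) : ℝ) * Real.pi / 2)
  have h2 := MildGrowth.exp_mul_I (a := a) (b := b) (-(((ε : ℤ) : ℝ) * Real.pi / 2))
  refine ((MildGrowth.two_pi_cpow.mul MildGrowth.Gamma).mul
    ((h1.mul (MildGrowth.localPhi_one_sub hf 1)).add
      (h2.mul (MildGrowth.localPhi_one_sub hf (-1))))).congr (T := 0) fun s _ _ _ => ?_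
  have e1 : ((ε : ℤ) : ℂ) * (Real.pi * s * Complex.I / 2) =
      ((((ε : ℤ) : ℝ) * Real.pi / 2 : ℝ) : ℂ) * s * Complex.I := by push_cast; ring
  rw [_root_.mellinPhi, e1, ← neg_mul, ← neg_mul, ← Complex.ofReal_neg]

theorem EntireOfFiniteOrder.mildGrowth {F : ℂ → ℂ} (h : EntireOfFiniteOrder lam F) (hab : a < b) :
    MildGrowth a b F := by
  obtain ⟨E, -, hEF, hE⟩ := h
  obtain ⟨A, B, ρ, hA, hB, -, hbd⟩ := hE a b hab
  refine MildGrowth.of_exp_rpow (A := A) (B := B) (ρ := ρ) (T := 1 + |2 * lam.im|) hB.le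
    fun s h1 h2 h3 => ?_
  have hn1 : 1 ≤ ‖s - 1‖ := by
    refine le_trans ?_ (Complex.abs_im_le_norm _)
    simp only [Complex.sub_im, Complex.one_im, sub_zero]
    linarith [abs_nonneg (2 * lam.im)]
  have hn2 : 1 ≤ ‖s - 2 + 2 * lam‖ := by
    refine le_trans ?_ (Complex.abs_im_le_norm _)
    have : (s - 2 + 2 * lam).im = s.im + 2 * lam.im := by simp
    rw [this]
    have := abs_sub_abs_le_abs_sub s.im (-(2 * lam.im))
    rw [abs_neg, sub_neg_eq_add] at this
    linarith
  have hs1 : s ≠ 1 := fun h => by rw [h, sub_self, norm_zero] at hn1; linarith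
  have hs2 : s ≠ 2 - 2 * lam := fun h => by
    rw [show s - 2 + 2 * lam = 0 by rw [h]; ring, norm_zero] at hn2; linarith
  refine le_trans ?_ (hbd s h1 h2).le
  rw [hEF s hs1 hs2, norm_mul, norm_mul]
  exact le_mul_of_one_le_left (norm_nonneg _) (one_le_mul_of_one_le_of_one_le hn1 hn2)

theorem MildGrowth.pairing (hE : ∀ ε, EntireOfFiniteOrder lam (ξ ε)) (hf : f ∈ lineModel lam ℓ)
    (hab : a < b) : MildGrowth a b (pairing lam ℓ ξ f) :=
  ((MildGrowth.mellinPhi hf 1).mul ((hE 1).mildGrowth hab)).add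
    ((MildGrowth.mellinPhi hf (-1)).mul ((hE (-1)).mildGrowth hab))

end

/-! ### Removing removable singularities -/

theorem RegAt.analyticAt {F : ℂ → ℂ} {p v : ℂ} (h : RegAt F p v) (hF : MeromorphicNFAt F p) :
    AnalyticAt ℂ F p := by
  obtain ⟨g, hg, -, he⟩ := h
  refine hF.meromorphicOrderAt_nonneg_iff_analyticAt.1 ?_
  rw [meromorphicOrderAt_congr he]
  exact hg.meromorphicOrderAt_nonneg

/-- The contour shift combined with the functional equation, which turns the left edge for `H` into
the right edge for `G`. The equation holds only off a discrete set and `H` may have spurious values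
at removable singularities, so the shift is applied to the normal form `K` of `H`. -/
theorem vertical_integral_sub_reflected {H G : ℂ → ℂ} {κ : ℂ} {b T C D : ℝ} {N : ℕ} (hN : 0 < N)
    (hab : κ.re - b < b)
    (hFE : ∀ p, ∀ᶠ s in 𝓝[≠] p, H s = (N : ℂ) ^ (κ - s) * G (κ - s)) (S : Finset ℂ)
    (hS : ∀ p ∈ S, κ.re - b < p.re ∧ p.re < b) (hres : ∀ p, ∃ r, HasResAt H p r)
    (hreg : ∀ p, p ∉ S → HasResAt H p 0) (hHb : ∀ s : ℂ, s.re = b → AnalyticAt ℂ H s)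
    (hGb : ∀ s : ℂ, s.re = b → AnalyticAt ℂ G s) (hT : ∀ s : ℂ, T ≤ |s.im| → AnalyticAt ℂ H s)
    (hgrow : MildGrowth (κ.re - b) b H) (hC : ∀ s : ℂ, s.re = b → ‖H s‖ ≤ C / (1 + |s.im|) ^ 2)
    (hD : ∀ s : ℂ, s.re = b → ‖G s‖ ≤ D / (1 + |s.im|) ^ 2) :
    (∫ t : ℝ, H (b + t * Complex.I)) -
      ∫ t : ℝ, (N : ℂ) ^ ((b : ℂ) + t * Complex.I) * G (b + t * Complex.I) =
      2 * Real.pi * ∑ p ∈ S, simpleResidue H p := by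
  have hNc : (N : ℂ) ≠ 0 := by exact_mod_cast hN.ne'
  have hmer : MeromorphicOn H Set.univ := fun p _ => (hres p).choose_spec.meromorphicAt
  set K := toMeromorphicNFOn H Set.univ with hK
  have hNF : ∀ p, MeromorphicNFAt K p := fun p =>
    meromorphicNFOn_toMeromorphicNFOn H Set.univ (Set.mem_univ p)
  have hKH : ∀ p, K =ᶠ[𝓝[≠] p] H := fun p =>
    hmer.toMeromorphicNFOn_eq_self_on_nhdsNE (Set.mem_univ p)
  have hKan : ∀ p, AnalyticAt ℂ H p → AnalyticAt ℂ K p ∧ K p = H p := fun p hp => by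
    have h1 : RegAt K p (H p) := hp.regAt.congr (hKH p)
    have h2 := h1.analyticAt (hNF p)
    exact ⟨h2, h2.regAt.unique h1⟩
  have hleft : ∀ s : ℂ, s.re = κ.re - b → AnalyticAt ℂ K s ∧
      K s = (N : ℂ) ^ (κ - s) * G (κ - s) := fun s hs => by
    have h0 : AnalyticAt ℂ (fun s => (N : ℂ) ^ (κ - s) * G (κ - s)) s :=
      ((differentiable_natCast_cpow hN κ).analyticAt s).mul
        ((hGb (κ - s) (by simp [hs])).fun_comp_of_eq (by fun_prop) rfl)
    have h1 : RegAt K s ((N : ℂ) ^ (κ - s) * G (κ - s)) :=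
      h0.regAt.congr ((hKH s).trans (hFE s))
    have h2 := h1.analyticAt (hNF s)
    exact ⟨h2, h2.regAt.unique h1⟩
  have hC0 : 0 ≤ C := by
    have := (norm_nonneg _).trans (hC (b : ℂ) (by simp))
    simpa using this
  have hD0 : 0 ≤ D := by
    have := (norm_nonneg _).trans (hD (b : ℂ) (by simp))
    simpa using this
  have hNb : (0 : ℝ) ≤ (N : ℝ) ^ b := by positivity
  set D' : ℝ := (N : ℝ) ^ b * (D * (1 + |κ.im|) ^ 2) with hD'
  have hD'0 : 0 ≤ D' := by positivity
  have hedge : ∀ s : ℂ, s.re = κ.re - b ∨ s.re = b → ‖K s‖ ≤ (C + D') / (1 + |s.im|) ^ 2 := by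
    rintro s (hs | hs)
    · have hs' : (κ - s).re = b := by simp [hs]
      rw [(hleft s hs).2, norm_mul, Complex.norm_natCast_cpow_of_pos hN, hs']
      have h1 : 1 + |s.im| ≤ (1 + |κ.im|) * (1 + |(κ - s).im|) := by
        rw [Complex.sub_im]
        have := abs_sub_abs_le_abs_sub s.im κ.im
        rw [abs_sub_comm] at this
        nlinarith [abs_nonneg κ.im, abs_nonneg (κ.im - s.im)]
      have h2 : D / (1 + |(κ - s).im|) ^ 2 ≤ D * (1 + |κ.im|) ^ 2 / (1 + |s.im|) ^ 2 := by
        rw [div_le_div_iff₀ (by positivity) (by positivity), mul_assoc, ← mul_pow]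
        gcongr
      calc _ ≤ (N : ℝ) ^ b * (D * (1 + |κ.im|) ^ 2 / (1 + |s.im|) ^ 2) := by
            gcongr
            exact (hD _ hs').trans h2
        _ = D' / (1 + |s.im|) ^ 2 := by rw [hD']; ring
        _ ≤ _ := by gcongr; linarith
    · rw [(hKan s (hHb s hs)).2]
      refine (hC s hs).trans ?_
      gcongr
      linarith
  have key := vertical_integral_sub_eq_sum_residues (H := K) (C := C + D') (T := T) hab S
    (simpleResidue H) hS
    (fun p _ => by
      obtain ⟨r, hr⟩ := hres p
      rw [hr.simpleResidue_eq]
      exact hr.congr (hKH p))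
    (fun p hp => RegAt.exists_of_value_zero ((hreg p hp).congr (hKH p)))
    (fun s hs => hs.elim (fun h => (hleft s h).1) fun h => (hKan s (hHb s h)).1)
    (fun s hs => (hKan s (hT s hs)).1)
    (hgrow.congr (T := T) fun s _ _ hs => (hKan s (hT s hs)).2) hedge
  rw [← key]
  congr 1
  · refine MeasureTheory.integral_congr_ae (Eventually.of_forall fun t => ?_)
    exact (hKan _ (hHb _ (by simp))).2.symm
  -- On imaginary parts the reflection s ↦ κ - s is t ↦ Im κ - t.
  · rw [← MeasureTheory.integral_sub_left_eq_self _ MeasureTheory.volume κ.im]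
    refine MeasureTheory.integral_congr_ae (Eventually.of_forall fun t => ?_)
    simp only
    have e : ((b : ℂ) + ((κ.im - t : ℝ) : ℂ) * Complex.I) =
        κ - (((κ.re - b : ℝ) : ℂ) + t * Complex.I) := by
      apply Complex.ext <;> simp
    rw [e, (hleft _ (by simp)).2]

theorem PolynomialGrowth.exists_lseriesSummable {α : ℤ → ℂ} (h : PolynomialGrowth α) :
    ∃ x : ℝ, ∀ (ε : ℤˣ) (s : ℂ), x < s.re →
      LSeriesSummable (fun n : ℕ => α ((ε : ℤ) * (n : ℤ))) s := by
  obtain ⟨C, k, hC⟩ := h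
  refine ⟨k + 1, fun ε s hs => LSeriesSummable_of_le_const_mul_rpow hs
    ⟨|C| * 2 ^ k, fun n hn => ?_⟩⟩
  have hn1 : (1 : ℝ) ≤ n := by exact_mod_cast Nat.one_le_iff_ne_zero.2 hn
  have habs : |(((ε : ℤ) * (n : ℤ) : ℤ) : ℝ)| = n := by
    rcases Int.units_eq_one_or ε with rfl | rfl <;> simp
  have h0 : (ε : ℤ) * (n : ℤ) ≠ 0 := mul_ne_zero ε.ne_zero (by exact_mod_cast hn)
  refine (hC _ h0).trans ?_
  rw [habs, add_sub_cancel_right, Real.rpow_natCast, mul_assoc, ← mul_pow]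
  have h2 : (1 + (n : ℝ)) ^ k ≤ (2 * n) ^ k := by gcongr; linarith
  exact mul_le_mul (le_abs_self C) h2 (by positivity) (abs_nonneg C)

/-! ### The contour shift for the integrand -/

section

variable {lam : ℂ} {ℓ : ℤ} {N : ℕ} {f : ℝ → ℂ} {α β : ℤ → ℂ} {ξα ξβ : ℤˣ → ℂ → ℂ}

/-- At 1 + k, and at the mirror points, the residues cancel. At -k the functional equation passes to
the β-side, which is regular unless κ + k is itself some -j. In that case λ is half an integer q ≥
4, and [A4] removes the pole. -/
theorem hasResAt_pairing_of_ne (hlam : ∀ k : ℕ, lam ≠ 1 / 2 - (k : ℂ) / 2) (hN : 0 < N)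
    (hpα : PoleData lam ξα) (hpβ : PoleData lam ξβ) (hA3 : ConditionA3 lam ℓ N ξα ξβ)
    (hA4 : ConditionA4 lam ℓ ξα ξβ) (hf : f ∈ lineModel lam ℓ)
    (hf' : inftyTransform lam ℓ f ∈ lineModel lam ℓ) {p : ℂ} (hp1 : p ≠ 1) (hp0 : p ≠ 0)
    (hp1' : p ≠ 2 - 2 * lam - 1) (hp0' : p ≠ 2 - 2 * lam) :
    HasResAt (pairing lam ℓ ξα f) p 0 := by
  have hrefl : HasResAt (pairing lam ℓ ξβ (inftyTransform lam ℓ f)) (2 - 2 * lam - p) 0 →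
      HasResAt (pairing lam ℓ ξα f) p 0 := fun h =>
    (hA3.hasResAt_pairing hN hf h).value_eq (by simp)
  by_cases h1 : ∃ k : ℕ, p = 1 + k
  · obtain ⟨k, rfl⟩ := h1
    exact hpα.hasResAt_pairing_one_add hlam hf (by rintro rfl; simp at hp1)
  by_cases h1' : ∃ k : ℕ, p = 2 - 2 * lam - 1 - k
  · obtain ⟨k, rfl⟩ := h1'
    refine hrefl ?_
    rw [show 2 - 2 * lam - (2 - 2 * lam - 1 - k) = 1 + k by ring]
    exact hpβ.hasResAt_pairing_one_add hlam hf' (by rintro rfl; simp at hp1')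
  push Not at h1 h1'
  by_cases hneg : ∃ k : ℕ, p = -(k : ℂ)
  · by_cases hneg' : ∃ j : ℕ, 2 - 2 * lam - p = -(j : ℂ)
    · obtain ⟨k, rfl⟩ := hneg
      obtain ⟨j, hj⟩ := hneg'
      have hk : k ≠ 0 := by rintro rfl; simp at hp0
      have hj0 : j ≠ 0 := by
        rintro rfl
        exact hp0' (by linear_combination -hj)
      -- κ = -k - j means λ = (2 + k + j)/2. Here k, j ≥ 1, since p is neither 0 nor κ; this gives q
      -- ≥ 4 and k ≤ q - 3.
      have hv := hA4.1 (2 + k + j) (by omega) (by push_cast; linear_combination -hj / 2) k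
        (by omega) (by omega)
      exact (hasResAt_pairing_of_gammaL hf h1 h1' (hpα.hasResAt_gammaL_neg hp0' hv)).value_eq
        (by ring)
    · push Not at hneg'
      refine hrefl (hpβ.analyticAt_pairing hf' (fun k hk => h1' k ?_) hneg' (fun h => hp0 ?_)
        fun k hk => h1 k ?_).regAt.hasResAt
      · linear_combination -hk
      · linear_combination -h
      · linear_combination -hk
  · push Not at hneg
    exact (hpα.analyticAt_pairing hf h1 hneg hp0' h1').regAt.hasResAt

theorem exists_hasSum_of_residues (hlam : ∀ k : ℕ, lam ≠ 1 / 2 - (k : ℂ) / 2) (hN : 0 < N)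
    (hα : PolynomialGrowth α) (hβ : PolynomialGrowth β) (hA1 : ConditionA1 lam α β ξα ξβ)
    (hA2 : ConditionA2 ξα ξβ) (hA3 : ConditionA3 lam ℓ N ξα ξβ) (hf : f ∈ lineModel lam ℓ)
    (S : Finset ℂ) (hS : ∀ p ∈ S, p = 1 ∨ p = 0 ∨ p = 2 - 2 * lam - 1 ∨ p = 2 - 2 * lam)
    (hres : ∀ p, ∃ r, HasResAt (pairing lam ℓ ξα f) p r)
    (hreg : ∀ p, p ∉ S → HasResAt (pairing lam ℓ ξα f) p 0) : ∃ Iα Iβ : ℂ,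
    (∀ a₀, HasSum (fun n : ℤ => Function.update α 0 a₀ n * genFourier lam f (n : ℝ))
      (a₀ * genFourier lam f 0 + Iα)) ∧
    (∀ b₀, HasSum (fun n : ℤ => Function.update β 0 b₀ n *
        genFourier lam (inftyTransform lam ℓ f) ((n : ℝ) / (N : ℝ)))
      (b₀ * genFourier lam (inftyTransform lam ℓ f) 0 + Iβ)) ∧
    Iα - Iβ = ∑ p ∈ S, simpleResidue (pairing lam ℓ ξα f) p := by
  have hl : lam ≠ 1 / 2 := by simpa using hlam 0
  have hf' := inftyTransform_mem hf
  have hEα : ∀ ε, EntireOfFiniteOrder lam (ξα ε) := fun ε => (hA1 ε).2.2.1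
  have hEβ : ∀ ε, EntireOfFiniteOrder lam (ξβ ε) := fun ε => (hA1 ε).2.2.2
  have hpα := poleData_of_entireOfFiniteOrder hl hEα hA2.1
  have hpβ := poleData_of_entireOfFiniteOrder hl hEβ hA2.2
  obtain ⟨xα, hxα⟩ := hα.exists_lseriesSummable
  obtain ⟨xβ, hxβ⟩ := hβ.exists_lseriesSummable
  choose σα hσα using fun ε => (hA1 ε).1.2
  choose σβ hσβ using fun ε => (hA1 ε).2.1.2
  have hlarge : ∀ x : ℝ, ∀ᶠ m : ℕ in atTop, x < (m : ℝ) := fun x =>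
    tendsto_natCast_atTop_atTop.eventually_gt_atTop x
  -- One m large enough for the Fourier formula, for absolute convergence of all four Dirichlet
  -- series, and for the line to pass to the right of 1 and κ.
  obtain ⟨m, hm, hm2, hxαm, hxβm, hσα1, hσα2, hσβ1, hσβ2, hκm, h1m⟩ :=
    ((eventually_ge_atTop (fourierOrder lam)).and <| (hlarge (2 - 2 * lam.re)).and <|
      (hlarge xα).and <| (hlarge xβ).and <| (hlarge (σα 1)).and <| (hlarge (σα (-1))).and <|
      (hlarge (σβ 1)).and <| (hlarge (σβ (-1))).and <| (hlarge (2 - 2 * lam).re).and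
      (hlarge 1)).exists
  have hm2' : 2 ≤ 2 * lam.re + m := by linarith
  set b : ℝ := m + 1 / 2 with hb
  have hsα : ∀ ε : ℤˣ, LSeriesSummable (fun n : ℕ => α ((ε : ℤ) * (n : ℤ))) (b : ℂ) := fun ε =>
    hxα ε _ (by rw [Complex.ofReal_re]; linarith)
  have hsβ : ∀ ε : ℤˣ, LSeriesSummable (fun n : ℕ => β ((ε : ℤ) * (n : ℤ))) (b : ℂ) := fun ε =>
    hxβ ε _ (by rw [Complex.ofReal_re]; linarith)
  have hLα : ∀ (ε : ℤˣ) (s : ℂ), s.re = b →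
      ξα ε s = LSeries (fun n : ℕ => α ((ε : ℤ) * (n : ℤ))) s := fun ε s hs => hσα ε s (by
    rcases Int.units_eq_one_or ε with rfl | rfl <;> linarith)
  have hLβ : ∀ (ε : ℤˣ) (s : ℂ), s.re = b →
      ξβ ε s = LSeries (fun n : ℕ => β ((ε : ℤ) * (n : ℤ))) s := fun ε s hs => hσβ ε s (by
    rcases Int.units_eq_one_or ε with rfl | rfl <;> linarith)
  have hne1 : ∀ s : ℂ, s.re = b → s ≠ 1 := by
    rintro s hs rfl
    rw [Complex.one_re] at hs
    linarith
  have hneκ : ∀ s : ℂ, s.re = b → s ≠ 2 - 2 * lam := by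
    rintro s hs rfl
    linarith
  have hcα : ∀ (ε : ℤˣ) (s : ℂ), s.re = b → ContinuousAt (ξα ε) s := fun ε s hs =>
    (hpα.analyticAt ε s (hne1 s hs) (hneκ s hs)).continuousAt
  have hcβ : ∀ (ε : ℤˣ) (s : ℂ), s.re = b → ContinuousAt (ξβ ε) s := fun ε s hs =>
    (hpβ.analyticAt ε s (hne1 s hs) (hneκ s hs)).continuousAt
  have hedge : ∀ {ξ : ℤˣ → ℂ → ℂ} {g : ℝ → ℂ}, PoleData lam ξ → g ∈ lineModel lam ℓ →
      ∀ s : ℂ, s.re = b → AnalyticAt ℂ (pairing lam ℓ ξ g) s := by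
    intro ξ g hp hg s hs
    refine hp.analyticAt_pairing hg ?_ ?_ (hneκ s hs) ?_
    -- The line has half-integral abscissa, so it avoids the poles 1 + k of Φ_±(f; 1-s), which
    -- extend arbitrarily far to the right.
    · rintro k rfl
      have h2 : (1 : ℝ) + k = m + 1 / 2 := by simpa [hb] using hs
      have h3 : 2 * (1 + k) = 2 * m + 1 := by
        have : (2 : ℝ) * (1 + k) = 2 * m + 1 := by linarith
        exact_mod_cast this
      omega
    · rintro k rfl
      have h2 : -(k : ℝ) = b := by simpa using hs
      linarith [(Nat.cast_nonneg k : (0 : ℝ) ≤ k)]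
    · rintro k rfl
      have h2 : (2 - 2 * lam).re - 1 - k = b := by simpa using hs
      linarith [(Nat.cast_nonneg k : (0 : ℝ) ≤ k)]
  obtain ⟨C, hC⟩ := exists_bound_pairing_line (ξ := ξα) hf hm hm2' hsα hLα
  obtain ⟨D, hD⟩ := exists_bound_pairing_line (ξ := ξβ) hf' hm hm2' hsβ hLβ
  have hSα := fun a₀ => hasSum_int_genFourier (ξ := ξα) hf hm hm2' one_pos hsα hLα hcα a₀
  have hSβ := fun b₀ => hasSum_int_genFourier (ξ := ξβ) hf' hm hm2' hN hsβ hLβ hcβ b₀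
  simp only [Nat.cast_one, div_one, Complex.one_cpow, one_mul] at hSα
  -- All poles lie on the horizontal lines Im s = 0 and Im s = -2 Im λ, hence below height T in
  -- absolute value.
  have key := vertical_integral_sub_reflected (T := 1 + |2 * lam.im|) hN
    (b := b) (κ := 2 - 2 * lam) (by linarith) (hA3.eventually_pairing hf) S
    (fun p hp => by
      rcases hS p hp with rfl | rfl | rfl | rfl
      · rw [Complex.one_re]; constructor <;> linarith
      · rw [Complex.zero_re]; constructor <;> linarith
      · rw [Complex.sub_re _ 1, Complex.one_re]; constructor <;> linarith
      · constructor <;> linarith)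
    hres hreg (hedge hpα hf) (hedge hpβ hf')
    (fun s hs => hpα.analyticAt_pairing hf
      (fun k hk => by simp [hk] at hs; linarith [abs_nonneg lam.im])
      (fun k hk => by simp [hk] at hs; linarith [abs_nonneg lam.im])
      (fun hk => by simp [hk] at hs; linarith [abs_nonneg (2 * lam.im)])
      (fun k hk => by simp [hk] at hs; linarith [abs_nonneg (2 * lam.im)]))
    (MildGrowth.pairing hEα hf (by linarith)) hC hD
  refine ⟨_, _, hSα, hSβ, ?_⟩
  have hpi : (2 * (Real.pi : ℂ)) ≠ 0 := by simp [Real.pi_ne_zero]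
  rw [← mul_sub, key]
  field_simp

end

/-! ### The sum of the residues -/

section

variable {lam : ℂ} {ℓ : ℤ} {N : ℕ} {f : ℝ → ℂ} {ξα ξβ : ℤˣ → ℂ → ℂ}

theorem hasResAt_pairing_reflected_one (hlam : ∀ k : ℕ, lam ≠ 1 / 2 - (k : ℂ) / 2) (hN : 0 < N)
    (hpβ : PoleData lam ξβ) (hA3 : ConditionA3 lam ℓ N ξα ξβ) (hf : f ∈ lineModel lam ℓ) :
    HasResAt (pairing lam ℓ ξα f) (2 - 2 * lam - 1)
      (-((N : ℂ) * (valueAtInfty lam ℓ f * simpleResidue (ξβ 1) 1))) := by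
  refine (hA3.hasResAt_pairing hN hf (p := 2 - 2 * lam - 1)
    (r := inftyTransform lam ℓ f 0 * simpleResidue (ξβ 1) 1) ?_).value_eq ?_
  · rw [sub_sub_cancel]
    exact hpβ.hasResAt_pairing_one hlam (inftyTransform_mem hf)
  · rw [sub_sub_cancel, Complex.cpow_one, valueAtInfty]

theorem residue_sum_of_ne_one (hlam : ∀ k : ℕ, lam ≠ 1 / 2 - (k : ℂ) / 2) (h1 : lam ≠ 1)
    (hN : 0 < N) (hpα : PoleData lam ξα) (hpβ : PoleData lam ξβ)
    (hA3 : ConditionA3 lam ℓ N ξα ξβ) (hA4 : ConditionA4 lam ℓ ξα ξβ)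
    (hf : f ∈ lineModel lam ℓ) : ∃ S : Finset ℂ,
    (∀ p ∈ S, p = 1 ∨ p = 0 ∨ p = 2 - 2 * lam - 1 ∨ p = 2 - 2 * lam) ∧
    (∀ p, ∃ r, HasResAt (pairing lam ℓ ξα f) p r) ∧
    (∀ p, p ∉ S → HasResAt (pairing lam ℓ ξα f) p 0) ∧
    ∑ p ∈ S, simpleResidue (pairing lam ℓ ξα f) p =
      f 0 * simpleResidue (ξα 1) 1 + genFourier lam f 0 * evenPart ξα 0 -
        N * (valueAtInfty lam ℓ f * simpleResidue (ξβ 1) 1) -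
        genFourier lam (inftyTransform lam ℓ f) 0 * evenPart ξβ 0 := by
  have hf' := inftyTransform_mem hf
  have hl0 : lam ≠ 0 := by simpa using hlam 1
  have hl2 : lam ≠ 1 / 2 := by simpa using hlam 0
  have r1 := hpα.hasResAt_pairing_one hlam hf
  have r2 := hpα.hasResAt_pairing_zero hlam h1 hf
  have r3 := hasResAt_pairing_reflected_one hlam hN hpβ hA3 hf
  have r4 := hA3.hasResAt_pairing hN hf (p := 2 - 2 * lam) (by
    rw [sub_self]
    exact hpβ.hasResAt_pairing_zero hlam h1 hf')
  rw [sub_self, Complex.cpow_zero, one_mul] at r4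
  have hne : ∀ p : ℂ, p ≠ 1 → p ≠ 0 → p ≠ 2 - 2 * lam - 1 → p ≠ 2 - 2 * lam →
      HasResAt (pairing lam ℓ ξα f) p 0 := fun p =>
    hasResAt_pairing_of_ne hlam hN hpα hpβ hA3 hA4 hf hf'
  refine ⟨{1, 0, 2 - 2 * lam - 1, 2 - 2 * lam}, fun p hp => by simpa using hp, fun p => ?_,
    fun p hp => ?_, ?_⟩
  · by_cases h1 : p = 1
    · exact h1 ▸ ⟨_, r1⟩
    by_cases h2 : p = 0
    · exact h2 ▸ ⟨_, r2⟩
    by_cases h3 : p = 2 - 2 * lam - 1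
    · exact h3 ▸ ⟨_, r3⟩
    by_cases h4 : p = 2 - 2 * lam
    · exact h4 ▸ ⟨_, r4⟩
    exact ⟨0, hne p h1 h2 h3 h4⟩
  · simp only [Finset.mem_insert, Finset.mem_singleton, not_or] at hp
    exact hne p hp.1 hp.2.1 hp.2.2.1 hp.2.2.2
  -- The four points are distinct because λ is none of 0, 1/2, 1; the first two values are excluded
  -- by the hypothesis on λ.
  · have d1 : (1 : ℂ) ≠ 2 - 2 * lam - 1 := fun h => hl0 (by linear_combination h / 2)
    have d2 : (1 : ℂ) ≠ 2 - 2 * lam := fun h => hl2 (by linear_combination h / 2)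
    have d3 : (0 : ℂ) ≠ 2 - 2 * lam - 1 := fun h => hl2 (by linear_combination h / 2)
    have d4 : (0 : ℂ) ≠ 2 - 2 * lam := fun h => h1 (by linear_combination h / 2)
    have d5 : 2 - 2 * lam - 1 ≠ 2 - 2 * lam := fun h => one_ne_zero (by linear_combination -h)
    rw [Finset.sum_insert (by simp [d1, d2]), Finset.sum_insert (by simp [d3, d4]),
      Finset.sum_insert (by simp [d5]), Finset.sum_singleton, r1.simpleResidue_eq,
      r2.simpleResidue_eq, r3.simpleResidue_eq, r4.simpleResidue_eq]
    ring

theorem I_zpow_eq_one_iff (ℓ : ℤ) : Complex.I ^ ℓ = 1 ↔ ℓ ≡ 0 [ZMOD 4] := by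
  rw [Int.modEq_zero_iff_dvd]
  have h : IsPrimitiveRoot Complex.I 4 := Complex.isPrimitiveRoot_I
  exact_mod_cast h.zpow_eq_one_iff_dvd ℓ

/-- The coefficients at `0` account for the residue at `s = 0` when `λ = 1`. -/
theorem zero_terms_of_eq_one (hlam : ∀ k : ℕ, lam ≠ 1 / 2 - (k : ℂ) / 2) (h1 : lam = 1)
    (hf : f ∈ lineModel lam ℓ) (hA4 : ConditionA4 lam ℓ ξα ξβ) (c : ℂ) {A A' : ℤˣ → ℂ}
    (hA : A 1 - A (-1) = 2 * Real.pi * Complex.I * simpleResidue (ξα 1) 0)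
    (hA' : A' 1 - A' (-1) = 2 * Real.pi * Complex.I * simpleResidue (ξβ 1) 0)
    (hAe : (∀ ε, AnalyticAt ℂ (ξα ε) 0) → A 1 + A (-1) = 2 * evenPart ξα 0)
    (hAe' : (∀ ε, AnalyticAt ℂ (ξβ ε) 0) → A' 1 + A' (-1) = 2 * evenPart ξβ 0)
    (hAA : A 1 = -(Complex.I ^ ℓ * A' (-1))) (hAA' : A (-1) = -A' 1) :
    alphaZero lam ℓ c ξα ξβ * genFourier lam f 0 -
      betaZero lam ℓ c ξα ξβ * genFourier lam (inftyTransform lam ℓ f) 0 =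
      -(localPhi lam ℓ 1 f 1 * A 1 + localPhi lam ℓ (-1) f 1 * A (-1)) := by
  have h20 : 2 - 2 * lam = 0 := by rw [h1]; norm_num
  have h211 : 2 * lam - 1 = 1 := by rw [h1]; norm_num
  rw [genFourier_zero hf hlam, genFourier_zero (inftyTransform_mem hf) hlam,
    localPhi_inftyTransform_one hf, localPhi_inftyTransform_neg hf, h211]
  by_cases hℓ : ℓ ≡ 0 [ZMOD 4]
  · have hI := (I_zpow_eq_one_iff ℓ).2 hℓ
    have han := hA4.2.2 h1 hℓ
    rw [h20] at han
    have e1 := hAe fun ε => (han ε).1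
    have e2 := hAe' fun ε => (han ε).2
    have hr : simpleResidue (ξα 1) 0 = 0 := (han 1).1.regAt.hasResAt.simpleResidue_eq
    rw [hr, mul_zero] at hA
    rw [hI, one_mul] at hAA
    -- For i^ℓ = 1 the functional equation gives ξ_e(β; 0) = -ξ_e(α; 0), so each coefficient takes
    -- half of the residue. The constant `c` drops out because 𝓕f(0) = 𝓕f_∞(0).
    have hα0 : alphaZero lam ℓ c ξα ξβ = -(1 / 2) * ((A 1 + A (-1)) / 2) + c := by
      have : evenPart ξα 0 = (A 1 + A (-1)) / 2 := by linear_combination -e1 / 2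
      simp [alphaZero, h1, hℓ, this]
    have hβ0 : betaZero lam ℓ c ξα ξβ = -(1 / 2) * (-(A 1 + A (-1)) / 2) + c := by
      have : evenPart ξβ 0 = -(A 1 + A (-1)) / 2 := by
        linear_combination -e2 / 2 + hAA / 2 + hAA' / 2
      simp [betaZero, h1, hℓ, this]
    rw [hα0, hβ0, hI]
    linear_combination (localPhi lam ℓ 1 f 1 - localPhi lam ℓ (-1) f 1) / 2 * hA
  · have hI : Complex.I ^ ℓ ≠ 1 := fun h => hℓ ((I_zpow_eq_one_iff ℓ).1 h)
    have hz := I_zpow_ne_zero ℓ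
    have hz1 : Complex.I ^ ℓ - 1 ≠ 0 := sub_ne_zero.2 hI
    -- Comparing the coefficients of Φ_+ and Φ_- gives α(0) - i^ℓ β(0) = -A(1) and α(0) - β(0) =
    -- -A(-1). This system has determinant i^ℓ - 1 ≠ 0, up to sign, and the prescribed values are
    -- its solution.
    have hα0 : alphaZero lam ℓ c ξα ξβ =
        (A 1 - Complex.I ^ ℓ * A (-1)) / (Complex.I ^ ℓ - 1) := by
      have e : alphaZero lam ℓ c ξα ξβ = 2 * Real.pi * Complex.I / (1 - Complex.I ^ (-ℓ)) *
          simpleResidue (ξβ 1) 0 := by simp [alphaZero, h1, hℓ]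
      have e' : 1 - (Complex.I ^ ℓ)⁻¹ = (Complex.I ^ ℓ - 1) / Complex.I ^ ℓ := by field_simp
      rw [e, div_mul_eq_mul_div, ← hA', zpow_neg, e', div_div_eq_mul_div]
      congr 1
      linear_combination -hAA + Complex.I ^ ℓ * hAA'
    have hβ0 : betaZero lam ℓ c ξα ξβ = (A 1 - A (-1)) / (Complex.I ^ ℓ - 1) := by
      have e : betaZero lam ℓ c ξα ξβ = 2 * Real.pi * Complex.I / (Complex.I ^ ℓ - 1) *
          simpleResidue (ξα 1) 0 := by simp [betaZero, h1, hℓ]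
      rw [e, div_mul_eq_mul_div, ← hA]
    rw [hα0, hβ0]
    field_simp
    ring

/-- For λ = 1 the points 0 and κ merge, so only three remain. The functional equation at 0 expresses
the residues of γ(s)Ξ on the α-side through those on the β-side, which lets one residue account for
both zero coefficients. -/
theorem residue_sum_of_eq_one (hlam : ∀ k : ℕ, lam ≠ 1 / 2 - (k : ℂ) / 2) (h1 : lam = 1)
    (hN : 0 < N) (hpα : PoleData lam ξα) (hpβ : PoleData lam ξβ)
    (hA3 : ConditionA3 lam ℓ N ξα ξβ) (hA4 : ConditionA4 lam ℓ ξα ξβ)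
    (hf : f ∈ lineModel lam ℓ) (c : ℂ) : ∃ S : Finset ℂ,
    (∀ p ∈ S, p = 1 ∨ p = 0 ∨ p = 2 - 2 * lam - 1 ∨ p = 2 - 2 * lam) ∧
    (∀ p, ∃ r, HasResAt (pairing lam ℓ ξα f) p r) ∧
    (∀ p, p ∉ S → HasResAt (pairing lam ℓ ξα f) p 0) ∧
    ∑ p ∈ S, simpleResidue (pairing lam ℓ ξα f) p =
      f 0 * simpleResidue (ξα 1) 1 - (alphaZero lam ℓ c ξα ξβ * genFourier lam f 0 -
        betaZero lam ℓ c ξα ξβ * genFourier lam (inftyTransform lam ℓ f) 0) -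
        N * (valueAtInfty lam ℓ f * simpleResidue (ξβ 1) 1) := by
  have hf' := inftyTransform_mem hf
  have h20 : 2 - 2 * lam = 0 := by rw [h1]; norm_num
  obtain ⟨A, hA, hAr, hAe⟩ := hpα.hasResAt_gammaL_zero' h1 (hA4.2.1 h1).1
  obtain ⟨A', hA', hAr', hAe'⟩ := hpβ.hasResAt_gammaL_zero' h1 (hA4.2.1 h1).2
  have hNpow : AnalyticAt ℂ (fun s : ℂ => (N : ℂ) ^ (2 - 2 * lam - s)) 0 :=
    (differentiable_natCast_cpow hN _).analyticAt 0
  have hrefl : ∀ ε, HasResAt (fun s => gammaL ξβ ε (2 - 2 * lam - s)) 0 (-A' ε) := fun ε =>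
    HasResAt.comp_sub (by rw [h20, sub_zero]; exact hA' ε)
  have hAA : A 1 = -(Complex.I ^ ℓ * A' (-1)) := by
    refine (hA 1).unique (((hNpow.regAt.regAt_mul_hasResAt
      ((hrefl (-1)).const_mul (Complex.I ^ ℓ))).congr
      ((hA3.eventually_gammaL 0).mono fun s hs => hs.1)).value_eq ?_)
    rw [h20, sub_zero, Complex.cpow_zero]
    ring
  have hAA' : A (-1) = -A' 1 := by
    refine (hA (-1)).unique (((hNpow.regAt.regAt_mul_hasResAt (hrefl 1)).congr
      ((hA3.eventually_gammaL 0).mono fun s hs => hs.2)).value_eq ?_)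
    rw [h20, sub_zero, Complex.cpow_zero]
    ring
  have r1 := hpα.hasResAt_pairing_one hlam hf
  have r2 := hasResAt_pairing_of_gammaL hf zero_ne_one_add_nat
    (fun k hk => hlam k (by linear_combination hk / 2)) hA
  have r3 := hasResAt_pairing_reflected_one hlam hN hpβ hA3 hf
  rw [sub_zero, ← neg_eq_iff_eq_neg.2
    (zero_terms_of_eq_one hlam h1 hf hA4 c hAr hAr' hAe hAe' hAA hAA')] at r2
  have hne : ∀ p : ℂ, p ≠ 1 → p ≠ 0 → p ≠ 2 - 2 * lam - 1 →
      HasResAt (pairing lam ℓ ξα f) p 0 := fun p hp1 hp0 hp2 =>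
    hasResAt_pairing_of_ne hlam hN hpα hpβ hA3 hA4 hf hf' hp1 hp0 hp2 (by rwa [h20])
  refine ⟨{1, 0, 2 - 2 * lam - 1}, fun p hp => ?_, fun p => ?_, fun p hp => ?_, ?_⟩
  · simp only [Finset.mem_insert, Finset.mem_singleton] at hp
    tauto
  · by_cases h1 : p = 1
    · exact h1 ▸ ⟨_, r1⟩
    by_cases h2 : p = 0
    · exact h2 ▸ ⟨_, r2⟩
    by_cases h3 : p = 2 - 2 * lam - 1
    · exact h3 ▸ ⟨_, r3⟩
    exact ⟨0, hne p h1 h2 h3⟩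
  · simp only [Finset.mem_insert, Finset.mem_singleton, not_or] at hp
    exact hne p hp.1 hp.2.1 hp.2.2
  · have d1 : (1 : ℂ) ≠ 2 - 2 * lam - 1 := by rw [h20]; norm_num
    have d3 : (0 : ℂ) ≠ 2 - 2 * lam - 1 := by rw [h20]; norm_num
    rw [Finset.sum_insert (by simp [d1]), Finset.sum_insert (by simp [d3]),
      Finset.sum_singleton, r1.simpleResidue_eq, r2.simpleResidue_eq, r3.simpleResidue_eq]
    ring

end

end

/-- The sequences `α, β` are prescribed on `ℤ ∖ {0}`; their values at `0` are replaced by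
`alphaZero` and `betaZero`. -/
theorem mainTheorem3 (lam : ℂ) (hlam : ∀ k : ℕ, lam ≠ 1 / 2 - (k : ℂ) / 2)
    (ℓ : ℤ) (N : ℕ) (hN : 0 < N)
    (α β : ℤ → ℂ) (hα : PolynomialGrowth α) (hβ : PolynomialGrowth β)
    (ξα ξβ : ℤˣ → ℂ → ℂ)
    (hA1 : ConditionA1 lam α β ξα ξβ)
    (hA2 : ConditionA2 ξα ξβ)
    (hA3 : ConditionA3 lam ℓ N ξα ξβ)
    (hA4 : ConditionA4 lam ℓ ξα ξβ)
    (c : ℂ) (f : ℝ → ℂ) (hf : f ∈ lineModel lam ℓ) :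
    Summable (fun n : ℤ =>
      Function.update α 0 (alphaZero lam ℓ c ξα ξβ) n * genFourier lam f (n : ℝ)) ∧
    Summable (fun n : ℤ =>
      Function.update β 0 (betaZero lam ℓ c ξα ξβ) n *
        genFourier lam (inftyTransform lam ℓ f) ((n : ℝ) / (N : ℝ))) ∧
    alphaInfty N ξβ * valueAtInfty lam ℓ f +
      ∑' n : ℤ, Function.update α 0 (alphaZero lam ℓ c ξα ξβ) n * genFourier lam f (n : ℝ) =
    betaInfty ℓ ξα * valueAtInfty lam ℓ (inftyTransform lam ℓ f) +
      ∑' n : ℤ, Function.update β 0 (betaZero lam ℓ c ξα ξβ) n *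
        genFourier lam (inftyTransform lam ℓ f) ((n : ℝ) / (N : ℝ)) := by
  have hl2 : lam ≠ 1 / 2 := by simpa using hlam 0
  have hpα := poleData_of_entireOfFiniteOrder hl2 (fun ε => (hA1 ε).2.2.1) hA2.1
  have hpβ := poleData_of_entireOfFiniteOrder hl2 (fun ε => (hA1 ε).2.2.2) hA2.2
  have hval : valueAtInfty lam ℓ (inftyTransform lam ℓ f) = Complex.I ^ ℓ * f 0 := by
    rw [valueAtInfty, inftyTransform_inftyTransform hf.1.continuous]
  have hI : Complex.I ^ (-ℓ) * Complex.I ^ ℓ = 1 := by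
    rw [← zpow_add₀ Complex.I_ne_zero, neg_add_cancel, zpow_zero]
  have hS : ∃ S : Finset ℂ,
      (∀ p ∈ S, p = 1 ∨ p = 0 ∨ p = 2 - 2 * lam - 1 ∨ p = 2 - 2 * lam) ∧
      (∀ p, ∃ r, HasResAt (pairing lam ℓ ξα f) p r) ∧
      (∀ p, p ∉ S → HasResAt (pairing lam ℓ ξα f) p 0) ∧
      ∑ p ∈ S, simpleResidue (pairing lam ℓ ξα f) p =
        f 0 * simpleResidue (ξα 1) 1 - (alphaZero lam ℓ c ξα ξβ * genFourier lam f 0 -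
          betaZero lam ℓ c ξα ξβ * genFourier lam (inftyTransform lam ℓ f) 0) -
          N * (valueAtInfty lam ℓ f * simpleResidue (ξβ 1) 1) := by
    by_cases h1 : lam = 1
    · exact residue_sum_of_eq_one hlam h1 hN hpα hpβ hA3 hA4 hf c
    · obtain ⟨S, hS1, hS2, hS3, hS4⟩ := residue_sum_of_ne_one hlam h1 hN hpα hpβ hA3 hA4 hf
      refine ⟨S, hS1, hS2, hS3, hS4.trans ?_⟩
      rw [alphaZero, betaZero, if_pos h1, if_pos h1]
      ring
  obtain ⟨S, hS1, hS2, hS3, hS4⟩ := hS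
  obtain ⟨Iα, Iβ, hsumα, hsumβ, hdiff⟩ :=
    exists_hasSum_of_residues hlam hN hα hβ hA1 hA2 hA3 hf S hS1 hS2 hS3
  refine ⟨(hsumα _).summable, (hsumβ _).summable, ?_⟩
  -- By [A2] the residue of ξ_e at 1 is twice that of ξ_+, which cancels the factors 1/2 in α(∞) and
  -- β(∞).
  rw [(hsumα _).tsum_eq, (hsumβ _).tsum_eq, hval, alphaInfty, betaInfty,
    hpα.simpleResidue_evenPart_one, hpβ.simpleResidue_evenPart_one]
  linear_combination hdiff + hS4 - (simpleResidue (ξα 1) 1 * f 0) * hI
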